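/- Let $\mathcal A$ be a unital $C^*$-algebra, $\mathcal D\subset\mathcal A$ a unital $C^*$-subalgebra, and $\mathbb E^{\mathcal D}:\mathcal A\to\mathcal D$ a positive, normalized ($\mathbb E^{\mathcal D}[1]=1$), linear $\mathcal D$-bimodule map which is nondegenerate: if $\mathbb E^{\mathcal D}[xay]=0$ for all $x,y\in\mathcal A$, then $a=0$ (this holds for instance if $\mathbb E^{\mathcal D}$ is faithful). Let $\sigma_\epsilon:\mathcal D\to\mathcal D$ be a completely positive map and let $(X_t)_{t\ge0}\subset\mathcal A$ be a $\mathcal D$-valued semicircular free Brownian motion with variance $\sigma_\epsilon$. That is: $X_0=0$ and $X_t^*=X_t$; the $X_t$ form a centred $\mathcal D$-valued semicircular family with $\mathbb E^{\mathcal D}[X_t\Delta X_s]=(t\wedge s)\,\sigma_\epsilon(\Delta)$ for $\Delta\in\mathcal D$ (their $\mathcal D$-valued moments are sums over non-crossing pairings of nested covariances); and the increments over disjoint time intervals are free over $\mathcal D$. Let $\mathcal A_t$ be the norm-closed $*$-algebra generated by $\mathcal D$ and $\{X_s: s\le t\}$, and assume that $\mathcal A$ is the norm-closed $*$-algebra generated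 by $\mathcal D$ and all the $X_s$. Let $(U_t)_{t\ge0}$ be a norm-continuous process with $U_t\in\mathcal A_t$ which solves the free SDE $\mathrm dU_t=(i\,\mathrm dX_t-\tfrac{\sigma_\epsilon(1)}2\mathrm dt)\,U_t$, $U_0=1$, i.e. $$U_t=1+i\int_0^t(\mathrm dX_s)\,U_s-\frac{\sigma_\epsilon(1)}2\int_0^tU_s\,\mathrm ds\qquad(t\ge0).$$ Here $\int_0^t(\mathrm dX_s)U_s$ is an element $J\in\mathcal A$ to which the sums $\Sigma=\sum_k(X_{t_{k+1}}-X_{t_k})U_{t_k}$ over the discretizations $0=t_0\le\dots\le t_n=t$ converge as the mesh goes to $0$, in the sense that $\mathbb E^{\mathcal D}[a\Sigma b]\to\mathbb E^{\mathcal D}[aJb]$ in norm for all $a,b\in\mathcal A$ (which is the case if they converge in norm). Then: 1. $U_t$ is unitary for every $t\ge0$, $U_t^*=U_t^{-1}$. 2. For every $s\ge0$, the increments after $s$ are free from $\mathcal A_s$ over $\mathcal D$: the $*$-algebra generated by $\mathcal D$ and $\{U_tU_s^{-1}: t\ge s\}$ and the algebra $\mathcal A_s$ are free over $\mathcal D$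 with respect to $\mathbb E^{\mathcal D}$. 3. For all $t\ge s\ge0$, $U_tU_s^{-1}$ and $U_{t-s}$ have the same $\mathcal D$-valued $*$-distribution: for all $n$, all $\varepsilon_1,\dots,\varepsilon_n\in\{1,*\}$ and all $\Delta_1,\dots,\Delta_n\in\mathcal D$, with $V=U_tU_s^{-1}$, $$\mathbb E^{\mathcal D}[V^{\varepsilon_1}\Delta_1\cdots V^{\varepsilon_n}\Delta_n]=\mathbb E^{\mathcal D}[U_{t-s}^{\varepsilon_1}\Delta_1\cdots U_{t-s}^{\varepsilon_n}\Delta_n].$$ -/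

import Mathlib

open scoped NNReal CStarAlgebra Ring

noncomputable section

namespace CondFree

variable {D A : Type*}
  [CStarAlgebra D] [PartialOrder D] [StarOrderedRing D] [CStarAlgebra A]

/-- `E` is a conditioned measure (conditional expectation) on `A` over the `*`-algebra `D`, which
sits in `A` through the unital `*`-homomorphism `ι` (injective, since `E (ι d) = d`): `E` is
linear, a `D`-bimodule map, normalized, and positive. -/
structure IsConditionedMeasure (ι : D →⋆ₐ[ℂ] A) (E : A →ₗ[ℂ] D) : Prop where
  bimodule : ∀ (d₁ d₂ : D) (a : A), E (ι d₁ * a * ι d₂) = d₁ * E a * d₂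
  map_one : E 1 = 1
  nonneg : ∀ a : A, 0 ≤ E (star a * a)

/-- `E` separates the points of `A`. If `E` is faithful, that is if `E (a* a) = 0` forces `a = 0`,
this holds (take `x = a*` and `y = 1`). For a positive `E` it says that the representation of `A`
on the `D`-module with `D`-valued inner product `E (x* y)` (the Fock space representation, in the
semicircular case) is faithful. -/
def IsNondegenerate (E : A →ₗ[ℂ] D) : Prop :=
  ∀ a : A, (∀ x y : A, E (x * a * y) = 0) → a = 0

/-- Freeness over `D` of a family of `*`-subalgebras of `A`: alternating products of centred
elements are centred. -/
def IsFreeOver (E : A →ₗ[ℂ] D) {κ : Type*} (B : κ → StarSubalgebra ℂ A) : Prop :=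
  ∀ w : List (κ × A), w ≠ [] →
    (∀ p ∈ w, p.2 ∈ B p.1 ∧ E p.2 = 0) →
    (w.map Prod.fst).IsChain (· ≠ ·) →
    E (w.map Prod.snd).prod = 0

/-- The `*`-algebra generated by `D` and a set `S` of elements of `A`. -/
def algOver (ι : D →⋆ₐ[ℂ] A) (S : Set A) : StarSubalgebra ℂ A :=
  StarAlgebra.adjoin ℂ (Set.range ι ∪ S)

/-- The closed `*`-algebra `𝒜_t` generated by `D` and `X_s`, `s ≤ t`. -/
def filtration (ι : D →⋆ₐ[ℂ] A) (X : ℝ≥0 → A) (t : ℝ≥0) : StarSubalgebra ℂ A :=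
  (algOver ι (X '' Set.Iic t)).topologicalClosure

/-- The sum over the non-crossing pairings of the letters of a word of the nested products of
covariances. The list `[(i₁, Δ₁), …, (iₙ, Δₙ)]` stands for the word `X_{i₁} Δ₁ ⋯ X_{iₙ} Δₙ`, and
`g i j : D → D` is the covariance `Δ ↦ 𝔼[X_i Δ X_j]`. The sum is organized by the partner `j` of
the first letter: in a non-crossing pairing, the letters between the two are paired among
themselves, and so are the letters after the partner. -/
def ncPairingSum {I : Type*} (g : I → I → D → D) : List (I × D) → D
  | [] => 1
  | (i, d) :: w =>
      ∑ j : Fin w.length,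
        g i (w.get j).1 (d * ncPairingSum g (w.take j)) * (w.get j).2 *
          ncPairingSum g (w.drop (j + 1))
termination_by w => w.length
decreasing_by
  · have := j.isLt
    simp only [List.length_take, List.length_cons]
    omega
  · simp only [List.length_drop, List.length_cons]
    omega

/-- A centred `D`-valued semicircular family with covariance `g`: its `D`-valued moments are the
sums over non-crossing pairings (all `D`-valued free cumulants but the second ones vanish). -/
def IsSemicircularFamily (ι : D →⋆ₐ[ℂ] A) (E : A →ₗ[ℂ] D) {I : Type*}
    (g : I → I → D → D) (X : I → A) : Prop :=
  (∀ i, IsSelfAdjoint (X i)) ∧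
    ∀ w : List (I × D), E (w.map fun p => X p.1 * ι p.2).prod = ncPairingSum g w

/-- `X` is a `D`-valued semicircular free Brownian motion with variance `σ`: `X_0 = 0`, the `X_t`
are self-adjoint and form a centred `D`-valued semicircular family with
`𝔼[X_t Δ X_s] = (t ∧ s) σ(Δ)`, and the increments over disjoint intervals are free over `D`. -/
structure IsFreeBrownianMotion (ι : D →⋆ₐ[ℂ] A) (E : A →ₗ[ℂ] D) (σ : D →CP D)
    (X : ℝ≥0 → A) : Prop where
  zero : X 0 = 0
  semicircular :
    IsSemicircularFamily ι E (fun t s d => ((min t s : ℝ≥0) : ℝ) • σ d) X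
  free_increments : ∀ τ : ℕ → ℝ≥0, Monotone τ →
    IsFreeOver E fun k => algOver ι {X (τ (k + 1)) - X (τ k)}

/-- `0 = π 0 ≤ π 1 ≤ ⋯ ≤ π n = t`, with all steps smaller than `δ`. -/
def IsDiscretization (t : ℝ≥0) (δ : ℝ) (n : ℕ) (π : ℕ → ℝ≥0) : Prop :=
  π 0 = 0 ∧ π n = t ∧
    ∀ k < n, π k ≤ π (k + 1) ∧ (π (k + 1) : ℝ) - (π k : ℝ) < δ

/-- The Riemann sum `∑ₖ A_{tₖ} (X_{tₖ₊₁} - X_{tₖ}) C_{tₖ}`. -/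
def riemannSum (X P C : ℝ≥0 → A) (n : ℕ) (π : ℕ → ℝ≥0) : A :=
  ∑ k ∈ Finset.range n, P (π k) * (X (π (k + 1)) - X (π k)) * C (π k)

/-- `J` is the free stochastic integral `∫₀ᵗ P_s (dX_s) C_s`: the Riemann sums converge to `J` as
the mesh of the discretization goes to zero. The convergence asked for is that of the `D`-valued
moments `𝔼[a (·) b]` for all `a, b` in `A`; it follows from convergence in norm, and it determines
`J` when `E` is nondegenerate. -/
def IsStochIntegral (E : A →ₗ[ℂ] D) (X P C : ℝ≥0 → A) (t : ℝ≥0) (J : A) : Prop :=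
  ∀ a b : A, ∀ ε > (0 : ℝ), ∃ δ > (0 : ℝ), ∀ (n : ℕ) (π : ℕ → ℝ≥0),
    IsDiscretization t δ n π → ‖E (a * (riemannSum X P C n π - J) * b)‖ < ε

/-- `U` solves `dU_t = (i dX_t - σ(1)/2 dt) U_t`, `U_0 = 1`: it is an adapted norm-continuous
process with `U_t = 1 + i ∫₀ᵗ (dX_s) U_s - (σ(1)/2) ∫₀ᵗ U_s ds` for all `t`. -/
structure IsEvolution (ι : D →⋆ₐ[ℂ] A) (E : A →ₗ[ℂ] D) (σ : D →CP D)
    (X U : ℝ≥0 → A) : Prop where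
  adapted : ∀ t, U t ∈ filtration ι X t
  continuous : Continuous U
  init : U 0 = 1
  equation : ∀ t : ℝ≥0, ∃ J : A, IsStochIntegral E X (fun _ => 1) U t J ∧
    U t = 1 + Complex.I • J
      - ι ((1 / 2 : ℂ) • σ 1) * ∫ s in (0 : ℝ)..(t : ℝ), U s.toNNReal

/-- `a` and `b` have the same `D`-valued `*`-distribution: the expectations of
`a^{ε₁} Δ₁ ⋯ a^{εₙ} Δₙ` and `b^{ε₁} Δ₁ ⋯ b^{εₙ} Δₙ` agree, each `εₖ` being `1` or `*`. -/
def SameDistribution (ι : D →⋆ₐ[ℂ] A) (E : A →ₗ[ℂ] D) (a b : A) : Prop :=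
  ∀ w : List (Bool × D),
    E (w.map fun p => (if p.1 then star a else a) * ι p.2).prod =
      E (w.map fun p => (if p.1 then star b else b) * ι p.2).prod

end CondFree

end

set_option linter.unusedSectionVars false

open scoped NNReal CStarAlgebra Ring

noncomputable section

namespace CondFree

variable {D A : Type*}
  [CStarAlgebra D] [PartialOrder D] [StarOrderedRing D] [CStarAlgebra A]

/-! ### Conditioned measures -/

namespace IsConditionedMeasure

variable {ι : D →⋆ₐ[ℂ] A} {E : A →ₗ[ℂ] D}

/-! The solution is the limit of products of unitaries. For the `n`-th dyadic partition of `[s, t]`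
let `W n` (`dyadicEvol`) be the product of the `exp (i ΔX)` over the subintervals, later factors on
the left. Each `W n` is unitary, and everything is deduced from the convergence of `W n` to `U t *
star (U s)`.

The analytic input is `‖X v - X u‖ ≤ C √(v - u)` (`exists_norm_sub_le`): the non-crossing pairing
formula bounds all moments of an increment against words, and nondegeneracy turns moment growth into
an operator norm. A polynomial in `X` is then within `O(√h)` of the algebra of increments outside an
interval of length `h`, and freeness kills a centred element of the interval placed between outer
elements. So a centred element of the interval gains a factor `√h` over its norm when tested weakly
(`norm_map_near_le`).

This gain is used twice. Halving an interval changes `exp (i ΔX)` by half a commutator, which is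
centred, up to third order; the weak error is `O(h ^ (3/2))` per interval, hence `O(2 ^ (-n/2))` in
total. Thus `star (W n) * y` is Cauchy in the seminorm `condNorm` for polynomials `y`. For the
equation, `U v - exp (i ΔX) U u` consists of a stochastic integral of small oscillation, the term
`((ΔX)² / 2 - h σ(1) / 2) U u`, whose bracket is centred exactly because of the drift, and a
remainder. All are weakly `o(h)`, so telescoping gives `star (W n) * U t → U s` weakly
(`tendsto_map_star_dyadicEvol`). The Cauchy property allows multiplication by `W n`, so `W n * U s →
U t` weakly (`tendsto_map_dyadicEvol_mul`).

With `s = 0` these limits and the Cauchy property give both unitarity relations. Weak convergence of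
unitaries to a unitary is strong (`StrongTendsto.of_unitary`), and strong convergence is stable
under `*`-algebra operations. Since `W n` lies in the closed algebra of the increments after `s`,
freeness passes to the limit. Since increments of `X` are stationary, so is the law of `W n`, and
hence that of its limit. -/

lemma map_mul_right (hE : IsConditionedMeasure ι E) (a : A) (d : D) :
    E (a * ι d) = E a * d := by
  simpa using hE.bimodule 1 d a

lemma map_mul_left (hE : IsConditionedMeasure ι E) (d : D) (a : A) :
    E (ι d * a) = d * E a := by
  simpa using hE.bimodule d 1 a

lemma map_coe (hE : IsConditionedMeasure ι E) (d : D) : E (ι d) = d := by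
  simpa [hE.map_one] using hE.map_mul_right 1 d

lemma map_centre (hE : IsConditionedMeasure ι E) (a : A) : E (a - ι (E a)) = 0 := by
  rw [map_sub, hE.map_coe, sub_self]

lemma map_star (hE : IsConditionedMeasure ι E) (a : A) : E (star a) = star (E a) := by
  let _ := CStarAlgebra.spectralOrder A
  have _ := CStarAlgebra.spectralOrderedRing A
  let f : A →ₚ[ℂ] D := PositiveLinearMap.mk₀ E fun x hx => by
    obtain ⟨c, rfl⟩ := CStarAlgebra.nonneg_iff_eq_star_mul_self.mp hx
    exact hE.nonneg c
  exact StarHomClass.map_star f a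

/-- Write `‖b‖² - b* b = c* c` and apply positivity to `c * y`. The square root `c` is needed
because positivity of `E` is only given on elements of the form `a* a`. -/
lemma conj_le (hE : IsConditionedMeasure ι E) (b y : A) :
    E (star (b * y) * (b * y)) ≤ (‖b‖ ^ 2 : ℝ) • E (star y * y) := by
  let _ := CStarAlgebra.spectralOrder A
  have _ := CStarAlgebra.spectralOrderedRing A
  obtain ⟨c, hc⟩ := CStarAlgebra.nonneg_iff_eq_star_mul_self.mp
    (sub_nonneg.mpr (CStarAlgebra.star_mul_le_algebraMap_norm_sq (a := b)))
  have h := hE.nonneg (c * y)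
  have h2 : star (c * y) * (c * y) =
      ((‖b‖ ^ 2 : ℝ) : ℂ) • (star y * y) - star (b * y) * (b * y) := by
    rw [star_mul, mul_assoc, ← mul_assoc (star c), ← hc, Algebra.algebraMap_eq_smul_one]
    rw [Complex.coe_smul]
    simp [sub_mul, mul_sub, mul_assoc]
  rw [h2, map_sub, map_smul, sub_nonneg, Complex.coe_smul] at h
  exact h

/-- The Cauchy-Schwarz inequality for the `D`-valued inner product. -/
lemma norm_map_mul_sq_le (hE : IsConditionedMeasure ι E) (a b : A) :
    ‖E (star a * b)‖ ^ 2 ≤ ‖E (star a * a)‖ * ‖E (star b * b)‖ := by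
  set d := E (star a * b) with hd
  have hd' : E (star b * a) = star d := by rw [hd, ← hE.map_star]; simp
  -- Taking `q` strictly above `‖E (a* a)‖` avoids dividing by zero; `q` is optimized at the end.
  -- The inequality is positivity at `b - a d / q`, the usual near-minimizer of the quadratic form.
  have key : ∀ q : ℝ, ‖E (star a * a)‖ < q → ‖d‖ ^ 2 ≤ q * ‖E (star b * b)‖ := by
    intro q hq
    have hq0 : 0 < q := (norm_nonneg _).trans_lt hq
    have h := hE.nonneg (b - a * ι (((1 / q : ℝ) : ℂ) • d))
    have e : E (star (b - a * ι (((1 / q : ℝ) : ℂ) • d)) * (b - a * ι (((1 / q : ℝ) : ℂ) • d)))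
        = E (star b * b) - ((2 / q : ℝ) : ℂ) • (star d * d)
          + ((1 / q ^ 2 : ℝ) : ℂ) • (star d * E (star a * a) * d) := by
      have e1 : star (b - a * ι (((1 / q : ℝ) : ℂ) • d)) * (b - a * ι (((1 / q : ℝ) : ℂ) • d))
        = star b * b - ((1 / q : ℝ) : ℂ) • (star b * a * ι d)
          - ((1 / q : ℝ) : ℂ) • (ι (star d) * (star a * b))
          + ((1 / q ^ 2 : ℝ) : ℂ) • (ι (star d) * (star a * a) * ι d) := by
        simp only [star_sub, star_mul, map_smul, star_smul, sub_mul, mul_sub, StarHomClass.map_star,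
          mul_smul_comm, smul_mul_assoc, smul_sub, mul_assoc, RCLike.star_def, Complex.conj_ofReal]
        rw [show ((1 / q ^ 2 : ℝ) : ℂ) = ((1 / q : ℝ) : ℂ) * ((1 / q : ℝ) : ℂ) by
          rw [← Complex.ofReal_mul]; congr 1; ring, mul_smul]
        abel
      rw [e1, map_add, map_sub, map_sub, map_smul, map_smul, map_smul, hE.map_mul_right,
        hE.map_mul_left, hE.bimodule, hd', ← hd,
        show ((2 / q : ℝ) : ℂ) = ((1 / q : ℝ) : ℂ) + ((1 / q : ℝ) : ℂ) by
          rw [← Complex.ofReal_add]; congr 1; ring, add_smul]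
      abel
    rw [e] at h
    have h1 : star d * E (star a * a) * d ≤ (q : ℝ) • (star d * d) := by
      have hsa : IsSelfAdjoint (E (star a * a)) := .of_nonneg (hE.nonneg a)
      refine (CStarAlgebra.star_left_conjugate_le_norm_smul (a := d) (b := E (star a * a))).trans ?_
      exact smul_le_smul_of_nonneg_right hq.le (star_mul_self_nonneg d)
    have h2 : (1 / q : ℝ) • (star d * d) ≤ E (star b * b) := by
      have h3 : ((1 / q ^ 2 : ℝ)) • (star d * E (star a * a) * d) ≤
          (1 / q ^ 2 : ℝ) • (q : ℝ) • (star d * d) :=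
        smul_le_smul_of_nonneg_left h1 (by positivity)
      rw [smul_smul, show (1 / q ^ 2) * q = 1 / q by field_simp] at h3
      simp only [Complex.coe_smul] at h
      rw [show (2 / q : ℝ) = 1 / q + 1 / q by ring, add_smul] at h
      have h4 := h.trans (add_le_add_right h3 _)
      rw [← sub_nonneg]
      convert h4 using 1
      abel
    have h3 := CStarAlgebra.norm_le_norm_of_nonneg_of_le
      (smul_nonneg (by positivity : (0 : ℝ) ≤ 1 / q) (star_mul_self_nonneg d)) h2
    rw [norm_smul, CStarRing.norm_star_mul_self, Real.norm_of_nonneg (by positivity), one_div,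
      inv_mul_le_iff₀ hq0] at h3
    rw [sq]; exact h3
  refine le_of_forall_gt_imp_ge_of_dense fun r hr => ?_
  rcases (norm_nonneg (E (star b * b))).eq_or_lt with h0 | h0
  · have := key (‖E (star a * a)‖ + 1) (lt_add_one _)
    rw [← h0, mul_zero] at this hr
    linarith
  · have := key (r / ‖E (star b * b)‖) ((lt_div_iff₀ h0).mpr hr)
    rwa [div_mul_cancel₀ _ h0.ne'] at this

end IsConditionedMeasure

lemma norm_one_le_one (B : Type*) [CStarAlgebra B] : ‖(1 : B)‖ ≤ 1 := by
  rcases subsingleton_or_nontrivial B with h | h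
  · simp [Subsingleton.elim (1 : B) 0]
  · simp

lemma norm_le_one_of_mem_unitary {B : Type*} [CStarAlgebra B] {u : B} (hu : u ∈ unitary B) :
    ‖u‖ ≤ 1 := by
  have h := CStarRing.norm_star_mul_self (x := u)
  rw [Unitary.star_mul_self_of_mem hu] at h
  have := norm_one_le_one B
  nlinarith [norm_nonneg u]

/-- The seminorm `‖𝔼[a* a]‖^{1/2}`. -/
def condNorm (E : A →ₗ[ℂ] D) (a : A) : ℝ := √‖E (star a * a)‖

section condNorm

variable {ι : D →⋆ₐ[ℂ] A} {E : A →ₗ[ℂ] D}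

lemma condNorm_nonneg (a : A) : 0 ≤ condNorm E a := Real.sqrt_nonneg _

lemma condNorm_sq (a : A) : condNorm E a ^ 2 = ‖E (star a * a)‖ := Real.sq_sqrt (norm_nonneg _)

namespace IsConditionedMeasure

lemma norm_map_star_mul_le (hE : IsConditionedMeasure ι E) (a b : A) :
    ‖E (star a * b)‖ ≤ condNorm E a * condNorm E b := by
  refine abs_le_of_sq_le_sq' ?_ (mul_nonneg (condNorm_nonneg _) (condNorm_nonneg _)) |>.2
  rw [mul_pow, condNorm_sq, condNorm_sq]
  exact hE.norm_map_mul_sq_le a b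

lemma norm_map_mul_le (hE : IsConditionedMeasure ι E) (a b : A) :
    ‖E (a * b)‖ ≤ condNorm E (star a) * condNorm E b := by
  simpa using hE.norm_map_star_mul_le (star a) b

lemma condNorm_add_le (hE : IsConditionedMeasure ι E) (a b : A) :
    condNorm E (a + b) ≤ condNorm E a + condNorm E b := by
  refine abs_le_of_sq_le_sq' ?_ (add_nonneg (condNorm_nonneg _) (condNorm_nonneg _)) |>.2
  rw [condNorm_sq, star_add, add_mul, mul_add, mul_add, map_add, map_add, map_add]
  refine (norm_add_le _ _).trans ?_
  refine (add_le_add (norm_add_le _ _) (norm_add_le _ _)).trans ?_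
  have h1 := hE.norm_map_star_mul_le a b
  have h2 := hE.norm_map_star_mul_le b a
  have h3 := hE.norm_map_star_mul_le a a
  have h4 := hE.norm_map_star_mul_le b b
  nlinarith

/-- Left multiplication is bounded for the seminorm; right multiplication need not be. For this
reason later estimates keep the small factor next to the test vector and move only bounded factors
out on the left. -/
lemma condNorm_mul_le (hE : IsConditionedMeasure ι E) (b y : A) :
    condNorm E (b * y) ≤ ‖b‖ * condNorm E y := by
  refine abs_le_of_sq_le_sq' ?_ (mul_nonneg (norm_nonneg _) (condNorm_nonneg _)) |>.2
  rw [mul_pow, condNorm_sq, condNorm_sq]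
  refine (CStarAlgebra.norm_le_norm_of_nonneg_of_le (hE.nonneg _) (hE.conj_le b y)).trans ?_
  rw [norm_smul, Real.norm_of_nonneg (by positivity)]

lemma condNorm_le (hE : IsConditionedMeasure ι E) (a : A) : condNorm E a ≤ ‖a‖ := by
  have h := hE.condNorm_mul_le a 1
  have h1 : condNorm E (1 : A) ≤ 1 := by
    rw [condNorm, star_one, one_mul, hE.map_one]
    exact Real.sqrt_le_one.mpr (norm_one_le_one D)
  rw [mul_one] at h
  nlinarith [norm_nonneg a]

lemma norm_map_le (hE : IsConditionedMeasure ι E) (a : A) : ‖E a‖ ≤ ‖a‖ := by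
  have h := hE.norm_map_star_mul_le 1 a
  have h1 := (hE.condNorm_le 1).trans (norm_one_le_one A)
  rw [star_one, one_mul] at h
  nlinarith [hE.condNorm_le a, condNorm_nonneg (E := E) a]

lemma norm_map_mul_mul_le (hE : IsConditionedMeasure ι E) (x a y : A) :
    ‖E (x * a * y)‖ ≤ ‖x‖ * ‖a‖ * ‖y‖ :=
  (hE.norm_map_le _).trans ((norm_mul_le _ _).trans
    (mul_le_mul_of_nonneg_right (norm_mul_le _ _) (norm_nonneg _)))

lemma continuous (hE : IsConditionedMeasure ι E) : Continuous E :=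
  AddMonoidHomClass.continuous_of_bound E 1 fun a => by simpa using hE.norm_map_le a

end IsConditionedMeasure

end condNorm

/-! ### Norm bounds from moments -/

section NormBound

variable {ι : D →⋆ₐ[ℂ] A} {E : A →ₗ[ℂ] D}

/-- An element whose powers have moments of geometric growth against a dense set is bounded. -/
lemma norm_le_of_moment_growth (hE : IsConditionedMeasure ι E) (hE' : IsNondegenerate E)
    {S : Set A} (hS : Dense S) {a : A} (ha : IsSelfAdjoint a) {c : ℝ} (hc : 0 ≤ c)
    (h : ∀ y ∈ S, ∃ K : ℝ, ∀ n : ℕ, ‖E (star y * a ^ n * y)‖ ≤ K * c ^ n) : ‖a‖ ≤ c := by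
  let _ := CStarAlgebra.spectralOrder A
  have _ := CStarAlgebra.spectralOrderedRing A
  refine le_of_forall_gt_imp_ge_of_dense fun r hr => ?_
  have hr0 : 0 < r := hc.trans_lt hr
  -- The positive element `p = f(a)` measures the spectrum of `a` beyond `r`, so `p = 0` gives `‖a‖
  -- ≤ r`. Where `f` is nonzero, `(|x| / r) ^ (2 n) ≥ 1`, whence `p ≤ ‖a‖ r ^ (-2 n) a ^ (2 n)` for
  -- all `n`.
  set f : ℝ → ℝ := fun x => max (|x| - r) 0 with hf
  have hfc : Continuous f := by fun_prop
  have hsp : ∀ x ∈ spectrum ℝ a, |x| ≤ ‖a‖ := fun x hx => by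
    rcases subsingleton_or_nontrivial A with hA | hA
    · exact absurd hx (by simp [spectrum.of_subsingleton])
    · simpa using spectrum.norm_le_norm_of_mem hx
  set p := cfc f a with hp
  have hp0 : 0 ≤ p := cfc_nonneg fun x _ => le_max_right _ _
  have hpn : ∀ n : ℕ, p ≤ (‖a‖ / r ^ (2 * n)) • a ^ (2 * n) := fun n => by
    have : (‖a‖ / r ^ (2 * n)) • a ^ (2 * n) =
        cfc (fun x : ℝ => ‖a‖ / r ^ (2 * n) * x ^ (2 * n)) a := by
      rw [cfc_const_mul (‖a‖ / r ^ (2 * n)) (fun x : ℝ => x ^ (2 * n)) a,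
        cfc_pow_id a (2 * n) ha]
    rw [this, hp]
    refine cfc_mono fun x hx => ?_
    rw [hf]
    refine max_le ?_ ?_
    · rcases le_or_gt |x| r with h | h
      · exact (sub_nonpos.mpr h).trans
          (mul_nonneg (by positivity) (Even.pow_nonneg (even_two_mul n) x))
      · rw [div_mul_eq_mul_div, mul_div_assoc, ← div_pow, ← Even.pow_abs (even_two_mul n), abs_div,
          abs_of_pos hr0]
        have h1 : 1 ≤ (|x| / r) ^ (2 * n) := one_le_pow₀ ((one_le_div hr0).mpr h.le)
        nlinarith [hsp x hx, norm_nonneg a]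
    · exact mul_nonneg (by positivity) (Even.pow_nonneg (even_two_mul n) x)
  obtain ⟨s, hs⟩ := CStarAlgebra.nonneg_iff_eq_star_mul_self.mp hp0
  have hmono : ∀ n : ℕ, ∀ y : A, ‖E (star y * p * y)‖ ≤
      ‖a‖ / r ^ (2 * n) * ‖E (star y * a ^ (2 * n) * y)‖ := fun n y => by
    obtain ⟨b, hb⟩ := CStarAlgebra.nonneg_iff_eq_star_mul_self.mp (sub_nonneg.mpr (hpn n))
    have h1 : E (star y * p * y) ≤
        (((‖a‖ / r ^ (2 * n) : ℝ)) : ℂ) • E (star y * a ^ (2 * n) * y) := by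
      rw [← sub_nonneg, ← map_smul, ← map_sub]
      have := hE.nonneg (b * y)
      rw [star_mul, mul_assoc, ← mul_assoc (star b), ← hb, ← Complex.coe_smul] at this
      convert this using 2
      simp only [sub_mul, mul_sub, mul_smul_comm, smul_mul_assoc, mul_assoc]
    have h0 : 0 ≤ E (star y * p * y) := by
      have := hE.nonneg (s * y)
      rwa [star_mul, mul_assoc, ← mul_assoc (star s), ← hs, ← mul_assoc] at this
    refine (CStarAlgebra.norm_le_norm_of_nonneg_of_le h0 h1).trans_eq ?_
    rw [norm_smul, Complex.norm_real, Real.norm_of_nonneg (by positivity)]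
  -- The moments grow at most like `c ^ (2 n)` with `c < r`, so letting `n → ∞` forces `E (y* p y) =
  -- 0`.
  have hzero : ∀ y ∈ S, condNorm E (s * y) = 0 := fun y hy => by
    obtain ⟨K, hK⟩ := h y hy
    have hlim : Filter.Tendsto (fun n : ℕ => ‖a‖ * K * ((c / r) ^ 2) ^ n) Filter.atTop
        (nhds (‖a‖ * K * 0)) :=
      (tendsto_pow_atTop_nhds_zero_of_lt_one (by positivity)
        (pow_lt_one₀ (by positivity) ((div_lt_one hr0).mpr hr) two_ne_zero)).const_mul _
    have hle : ∀ n : ℕ, ‖E (star y * p * y)‖ ≤ ‖a‖ * K * ((c / r) ^ 2) ^ n := fun n => by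
      refine (hmono n y).trans ((mul_le_mul_of_nonneg_left (hK (2 * n)) (by positivity)).trans_eq ?_)
      rw [← pow_mul, div_pow]
      ring
    have h2 := ge_of_tendsto' hlim hle
    rw [mul_zero] at h2
    rw [condNorm, star_mul, mul_assoc, ← mul_assoc (star s), ← hs, ← mul_assoc,
      le_antisymm h2 (norm_nonneg _), Real.sqrt_zero]
  have hzero' : ∀ y, condNorm E (s * y) = 0 := fun y => by
    refine le_antisymm (le_of_forall_pos_le_add fun ε hε => ?_) (condNorm_nonneg _)
    obtain ⟨z, hyz, hz⟩ := Metric.dense_iff.mp hS y (ε / (‖s‖ + 1)) (by positivity)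
    rw [Metric.mem_ball, dist_eq_norm] at hyz
    have e : s * y = s * z + s * (y - z) := by noncomm_ring
    have h1 := hE.condNorm_add_le (s * z) (s * (y - z))
    rw [← e, hzero z hz, zero_add] at h1
    refine h1.trans ((hE.condNorm_le _).trans ((norm_mul_le _ _).trans ?_))
    rw [norm_sub_rev, lt_div_iff₀ (by positivity)] at hyz
    nlinarith [norm_nonneg (y - z), norm_nonneg (z - y), norm_sub_rev y z]
  have hp00 : p = 0 := hE' p fun x y => by
    have := hE.norm_map_mul_le (x * star s) (s * y)
    rw [hzero', mul_zero, ← mul_assoc, mul_assoc x, ← hs] at this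
    exact norm_le_zero_iff.mp this
  rw [hp, ← cfc_zero ℝ a, cfc_eq_cfc_iff_eqOn] at hp00
  rw [← cfc_id' ℝ a]
  refine norm_cfc_le hr0.le fun x hx => ?_
  have h1 := hp00 hx
  have h2 : |x| - r ≤ 0 := (le_max_left _ _).trans_eq h1
  rw [Real.norm_eq_abs]
  linarith

end NormBound

/-! ### The exponential series -/

/-- The tail term of index `n + k` is dominated by `‖a‖ ^ n * ‖a‖ ^ k / k!`, since `k! ≤ (n + k)!`.
Assuming only `‖1‖ ≤ 1` includes the zero algebra. -/
lemma norm_exp_sub_sum_le {B : Type*} [NormedRing B] [NormedAlgebra ℂ B] [CompleteSpace B]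
    (h1 : ‖(1 : B)‖ ≤ 1) (a : B) (n : ℕ) :
    ‖NormedSpace.exp a - ∑ k ∈ Finset.range n, ((k.factorial : ℂ)⁻¹) • a ^ k‖ ≤
      ‖a‖ ^ n * Real.exp ‖a‖ := by
  have hs := NormedSpace.expSeries_summable' (𝕂 := ℂ) a
  have hp : ∀ k, ‖a ^ k‖ ≤ ‖a‖ ^ k := fun k => by
    induction k with
    | zero => simpa using h1
    | succ k ih =>
      rw [pow_succ, pow_succ]
      exact (norm_mul_le _ _).trans (mul_le_mul_of_nonneg_right ih (norm_nonneg _))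
  have hr : HasSum (fun k : ℕ => ‖a‖ ^ n * (‖a‖ ^ k / k.factorial)) (‖a‖ ^ n * Real.exp ‖a‖) := by
    rw [Real.exp_eq_exp_ℝ]
    exact (NormedSpace.expSeries_div_hasSum_exp ‖a‖).mul_left _
  rw [NormedSpace.exp_eq_tsum ℂ]
  beta_reduce
  rw [← hs.sum_add_tsum_nat_add n, add_sub_cancel_left]
  refine tsum_of_norm_bounded hr fun k => ?_
  rw [norm_smul, norm_inv, Complex.norm_natCast, ← mul_div_assoc, ← pow_add, add_comm n k,
    inv_mul_eq_div]
  gcongr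
  · exact hp _
  · exact Nat.le_add_right k n

/-! ### Sums over non-crossing pairings -/

section Pairings

/-- The sum of `F l b r` over all the ways to write a list as `l ++ b :: r`. -/
def splitSum {α M : Type*} [AddCommGroup M] : List α → (List α → α → List α → M) → M
  | [], _ => 0
  | a :: w, F => F [] a w + splitSum w fun l b r => F (a :: l) b r

/-- Replaces the sum over positions by a structural recursion on the list, so that pairing sums can
be manipulated by induction on words. -/
lemma sum_split_eq_splitSum {α M : Type*} [AddCommGroup M] (w : List α)
    (F : List α → α → List α → M) :
    ∑ j : Fin w.length, F (w.take j) (w.get j) (w.drop (j + 1)) = splitSum w F := by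
  induction w generalizing F with
  | nil => simp [splitSum]
  | cons a w ih =>
    rw [splitSum, ← ih]
    simp only [List.length_cons]
    rw [Fin.sum_univ_succ]
    simp

lemma splitSum_congr {α M : Type*} [AddCommGroup M] (w : List α)
    {F G : List α → α → List α → M} (h : ∀ l b r, w = l ++ b :: r → F l b r = G l b r) :
    splitSum w F = splitSum w G := by
  induction w generalizing F G with
  | nil => rfl
  | cons a w ih =>
    rw [splitSum, splitSum, h [] a w rfl]
    congr 1
    exact ih fun l b r hw => h (a :: l) b r (by rw [hw]; rfl)

lemma splitSum_sub {α M : Type*} [AddCommGroup M] (w : List α) (F G : List α → α → List α → M) :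
    splitSum w (fun l b r => F l b r - G l b r) = splitSum w F - splitSum w G := by
  induction w generalizing F G with
  | nil => simp [splitSum]
  | cons a w ih => simp only [splitSum, ih]; abel

lemma ncPairingSum_nil {I : Type*} (g : I → I → D → D) : ncPairingSum g [] = 1 := by
  rw [ncPairingSum]

lemma ncPairingSum_cons {I : Type*} (g : I → I → D → D) (i : I) (d : D) (w : List (I × D)) :
    ncPairingSum g ((i, d) :: w) = splitSum w fun l b r =>
      g i b.1 (d * ncPairingSum g l) * b.2 * ncPairingSum g r := by
  rw [ncPairingSum, ← sum_split_eq_splitSum]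

variable {I J : Type*}

/-- The alternating sum that arises when the letters `p i - q i` of a word are expanded. -/
def altSum {M : Type*} [AddCommGroup M] (p q : I → J) :
    List (I × D) → (List (J × D) → M) → M
  | [], F => F []
  | (i, d) :: w, F => altSum p q w (fun l => F ((p i, d) :: l)) -
      altSum p q w (fun l => F ((q i, d) :: l))

section altSum

variable {M : Type*} [AddCommGroup M] (p q : I → J)

lemma altSum_map {N : Type*} [AddCommGroup N] (φ : M →+ N) (w : List (I × D))
    (F : List (J × D) → M) : altSum p q w (fun l => φ (F l)) = φ (altSum p q w F) := by
  induction w generalizing F with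
  | nil => rfl
  | cons a w ih => simp only [altSum, ih, map_sub]

lemma altSum_add (w : List (I × D)) (F G : List (J × D) → M) :
    altSum p q w (fun l => F l + G l) = altSum p q w F + altSum p q w G := by
  induction w generalizing F G with
  | nil => rfl
  | cons a w ih => simp only [altSum, ih]; abel

lemma altSum_sub (w : List (I × D)) (F G : List (J × D) → M) :
    altSum p q w (fun l => F l - G l) = altSum p q w F - altSum p q w G := by
  induction w generalizing F G with
  | nil => rfl
  | cons a w ih => simp only [altSum, ih]; abel

/-- The choice of the partner depends only on positions, not on which of `p`, `q` labels a letter.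
The signed expansion therefore factors into the block before the partner, the partner itself and the
block after it. -/
lemma altSum_splitSum (w : List (I × D))
    (F : List (J × D) → J × D → List (J × D) → M) :
    altSum p q w (fun l => splitSum l F) = splitSum w fun w₁ b w₂ =>
      altSum p q w₁ fun l₁ => altSum p q w₂ fun l₂ =>
        F l₁ (p b.1, b.2) l₂ - F l₁ (q b.1, b.2) l₂ := by
  induction w generalizing F with
  | nil => rfl
  | cons a w ih =>
    obtain ⟨i, d⟩ := a
    simp only [altSum, splitSum, altSum_add, ih, splitSum_sub, altSum_sub]
    abel

end altSum

/-- Pairing sums are multilinear in the letters, so expanding differences replaces the covariance by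
its mixed second difference. Additivity of `γ i j` in the `D`-variable lets the nested sums be
pulled through. For Brownian motion this makes the increments semicircular as well. -/
lemma altSum_ncPairingSum (p q : I → J) (γ : J → J → D →+ D) (w : List (I × D)) :
    altSum p q w (ncPairingSum fun i j d => γ i j d) =
      ncPairingSum (fun i j d => γ (p i) (p j) d - γ (p i) (q j) d -
        (γ (q i) (p j) d - γ (q i) (q j) d)) w := by
  induction hn : w.length using Nat.strong_induction_on generalizing w with
  | _ n ih =>
  match w with
  | [] => simp [altSum, ncPairingSum_nil]
  | (i, d) :: w =>
    simp only [altSum, ncPairingSum_cons]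
    rw [← altSum_sub]
    simp only [← splitSum_sub]
    rw [altSum_splitSum]
    refine splitSum_congr _ fun l b r hw => ?_
    have hl : l.length < n := by
      rw [← hn, hw]; simp only [List.length_cons, List.length_append]; omega
    have hr : r.length < n := by
      rw [← hn, hw]; simp only [List.length_cons, List.length_append]; omega
    rw [← ih _ hl l rfl, ← ih _ hr r rfl]
    let Γ : D →+ D := γ (p i) (p b.1) - γ (p i) (q b.1) - (γ (q i) (p b.1) - γ (q i) (q b.1))
    have e1 : ∀ x y : D, γ (p i) (p b.1) (d * x) * b.2 * y - γ (q i) (p b.1) (d * x) * b.2 * y -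
        (γ (p i) (q b.1) (d * x) * b.2 * y - γ (q i) (q b.1) (d * x) * b.2 * y) =
        -- The summand is rewritten as an additive map, first of the right-hand block `y` and then
        -- of the inner block `x`, so that `altSum_map` applies to each in turn.
        AddMonoidHom.mulLeft (Γ (d * x) * b.2) y := fun x y => by
      simp only [Γ, AddMonoidHom.sub_apply, AddMonoidHom.coe_mulLeft, sub_mul]
      abel
    have e2 : ∀ x y : D, AddMonoidHom.mulLeft (Γ (d * x) * b.2) y =
        ((AddMonoidHom.mulRight (b.2 * y)).comp (Γ.comp (AddMonoidHom.mulLeft d))) x :=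
      fun x y => by simp [mul_assoc]
    simp only [e1, altSum_map]
    simp only [e2, altSum_map]
    simp only [Γ, AddMonoidHom.sub_apply, AddMonoidHom.coe_comp, Function.comp_apply,
      AddMonoidHom.coe_mulLeft, AddMonoidHom.coe_mulRight, mul_assoc]

lemma catalan_le_succ (n : ℕ) : catalan n ≤ catalan (n + 1) := by
  rw [catalan_succ]
  refine le_trans ?_ (Finset.single_le_sum (fun _ _ => Nat.zero_le _) (Finset.mem_univ 0))
  simp

lemma catalan_le_four_pow (n : ℕ) : catalan n ≤ 4 ^ n := by
  calc catalan n ≤ (n + 1) * catalan n := Nat.le_mul_of_pos_left _ n.succ_pos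
    _ = n.centralBinom := succ_mul_catalan_eq_centralBinom n
    _ ≤ 2 ^ (2 * n) := Nat.choose_le_two_pow _ _
    _ = 4 ^ n := by rw [pow_mul]; norm_num

/-- Every pairing contributes at most the product of the weights, and the recursion over the partner
of the first letter is majorized by the Catalan recursion. The index `w.length` is not sharp, but
any geometric bound suffices. -/
lemma norm_ncPairingSum_le_catalan {g : I → I → D → D} {ρ : I → ℝ} (hρ : ∀ i, 0 ≤ ρ i)
    (hg : ∀ i j d, ‖g i j d‖ ≤ ρ i * ρ j * ‖d‖) (w : List (I × D)) :
    ‖ncPairingSum g w‖ ≤ catalan w.length * (w.map fun x => ρ x.1 * ‖x.2‖).prod := by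
  induction hn : w.length using Nat.strong_induction_on generalizing w with
  | _ n ih =>
  have hpos : ∀ l : List (I × D), 0 ≤ (l.map fun x => ρ x.1 * ‖x.2‖).prod := fun l =>
    List.prod_nonneg fun y hy => by
      obtain ⟨x, _, rfl⟩ := List.mem_map.mp hy
      exact mul_nonneg (hρ _) (norm_nonneg _)
  match w with
  | [] => subst hn; simpa [ncPairingSum_nil] using norm_one_le_one D
  | [(i, d)] => rw [ncPairingSum_cons]; simpa [splitSum] using
      mul_nonneg (Nat.cast_nonneg _) (mul_nonneg (hρ i) (norm_nonneg d))
  | (i, d) :: b :: w' =>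
    set w := b :: w' with hw
    set P := ((((i, d) :: w)).map fun x => ρ x.1 * ‖x.2‖).prod with hP
    have hnw : w.length + 1 = n := by rw [← hn]; rfl
    have hterm : ∀ j : Fin w.length,
        ‖g i (w.get j).1 (d * ncPairingSum g (w.take j)) * (w.get j).2 *
          ncPairingSum g (w.drop (j + 1))‖ ≤
          (catalan j * catalan (w.length - (j + 1)) : ℝ) * P := fun j => by
      have hj := j.isLt
      have h1 := ih _ (by simp only [List.length_take]; omega) (w.take j) rfl
      have h2 := ih _ (by simp only [List.length_drop]; omega) (w.drop (j + 1)) rfl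
      rw [List.length_take, min_eq_left hj.le] at h1
      rw [List.length_drop] at h2
      have hsplit : P = ρ i * ‖d‖ * (((w.take j).map fun x => ρ x.1 * ‖x.2‖).prod *
          ((ρ (w.get j).1 * ‖(w.get j).2‖) *
            ((w.drop (j + 1)).map fun x => ρ x.1 * ‖x.2‖).prod)) := by
        rw [hP, List.map_cons, List.prod_cons]
        congr 1
        conv_lhs => rw [← List.take_append_drop j w, List.drop_eq_getElem_cons hj]
        rw [List.map_append, List.prod_append, List.map_cons, List.prod_cons]
        rfl
      calc _ ≤ ‖g i (w.get j).1 (d * ncPairingSum g (w.take j))‖ * ‖(w.get j).2‖ *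
            ‖ncPairingSum g (w.drop (j + 1))‖ :=
            (norm_mul_le _ _).trans (mul_le_mul_of_nonneg_right (norm_mul_le _ _) (norm_nonneg _))
        _ ≤ ρ i * ρ (w.get j).1 * (‖d‖ * ‖ncPairingSum g (w.take j)‖) * ‖(w.get j).2‖ *
            ‖ncPairingSum g (w.drop (j + 1))‖ := by
            have := (hg i (w.get j).1 (d * ncPairingSum g (w.take j))).trans
              (mul_le_mul_of_nonneg_left (norm_mul_le _ _) (mul_nonneg (hρ _) (hρ _)))
            gcongr
        _ ≤ ρ i * ρ (w.get j).1 * (‖d‖ *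
              (catalan j * ((w.take j).map fun x => ρ x.1 * ‖x.2‖).prod)) * ‖(w.get j).2‖ *
            (catalan (w.length - (j + 1)) *
              ((w.drop (j + 1)).map fun x => ρ x.1 * ‖x.2‖).prod) := by
            have := hρ i
            have := hρ (w.get j).1
            have := hpos (w.take j)
            gcongr
        _ = _ := by rw [hsplit]; ring
    have hP0 : 0 ≤ P := hpos _
    calc ‖ncPairingSum g ((i, d) :: w)‖
        ≤ ∑ j : Fin w.length, (catalan j * catalan (w.length - (j + 1)) : ℝ) * P := by
          rw [ncPairingSum]
          exact (norm_sum_le _ _).trans (Finset.sum_le_sum fun j _ => hterm j)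
      _ = catalan w.length * P := by
          rw [← Finset.sum_mul]
          congr 1
          have : w.length = w'.length + 1 := rfl
          rw [this, catalan_succ]
          push_cast
          refine Finset.sum_congr rfl fun j _ => ?_
          congr 3
      _ ≤ catalan n * P := by
          rw [← hnw]
          exact mul_le_mul_of_nonneg_right (by exact_mod_cast catalan_le_succ _) hP0

lemma norm_ncPairingSum_le {g : I → I → D → D} {ρ : I → ℝ} (hρ : ∀ i, 0 ≤ ρ i)
    (hg : ∀ i j d, ‖g i j d‖ ≤ ρ i * ρ j * ‖d‖) (w : List (I × D)) :
    ‖ncPairingSum g w‖ ≤ (w.map fun x => 4 * (ρ x.1 * ‖x.2‖)).prod := by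
  refine (norm_ncPairingSum_le_catalan hρ hg w).trans ?_
  have e : (w.map fun x => 4 * (ρ x.1 * ‖x.2‖)).prod =
      4 ^ w.length * (w.map fun x => ρ x.1 * ‖x.2‖).prod := by
    induction w with
    | nil => simp
    | cons a w ih => simp only [List.map_cons, List.prod_cons, ih, List.length_cons, pow_succ]; ring
  rw [e]
  refine mul_le_mul_of_nonneg_right (by exact_mod_cast catalan_le_four_pow _) ?_
  refine List.prod_nonneg fun y hy => ?_
  obtain ⟨x, _, rfl⟩ := List.mem_map.mp hy
  exact mul_nonneg (hρ _) (norm_nonneg _)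

end Pairings

/-! ### Increments of the free Brownian motion -/

/-- The covariance of the increments `X_a - X_b` and `X_c - X_d` of a Brownian motion. -/
def incrCov (a b c d : ℝ≥0) : ℝ :=
  ((min a c : ℝ≥0) : ℝ) - ((min a d : ℝ≥0) : ℝ) -
    (((min b c : ℝ≥0) : ℝ) - ((min b d : ℝ≥0) : ℝ))

/-- Up to sign, the covariance is the length of the overlap of two intervals. It is at most either
length, hence at most their geometric mean. The product form is what `norm_ncPairingSum_le` needs.
-/
lemma abs_incrCov_le (a b c d : ℝ≥0) :
    |incrCov a b c d| ≤ √|(a : ℝ) - b| * √|(c : ℝ) - d| := by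
  have h1 : |incrCov a b c d| ≤ |(a : ℝ) - b| := by
    simp only [incrCov, NNReal.coe_min]
    generalize (a : ℝ) = a, (b : ℝ) = b, (c : ℝ) = c, (d : ℝ) = d
    grind
  have h2 : |incrCov a b c d| ≤ |(c : ℝ) - d| := by
    simp only [incrCov, NNReal.coe_min]
    generalize (a : ℝ) = a, (b : ℝ) = b, (c : ℝ) = c, (d : ℝ) = d
    grind
  rw [← Real.sqrt_mul (abs_nonneg _)]
  refine Real.le_sqrt_of_sq_le ?_
  nlinarith [abs_nonneg (incrCov a b c d)]

variable {ι : D →⋆ₐ[ℂ] A} {E : A →ₗ[ℂ] D} {σ : D →CP D} {X : ℝ≥0 → A}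

lemma altSum_prod {I J : Type*} (p q : I → J) (Y : J → A) (w : List (I × D)) :
    (w.map fun x => (Y (p x.1) - Y (q x.1)) * ι x.2).prod =
      altSum p q w fun l => (l.map fun x => Y x.1 * ι x.2).prod := by
  induction w with
  | nil => rfl
  | cons a w ih =>
    obtain ⟨i, d⟩ := a
    have h := altSum_map (D := D) p q (AddMonoidHom.mulLeft (Y (p i) * ι d)) w
      fun l => (l.map fun x => Y x.1 * ι x.2).prod
    have h' := altSum_map (D := D) p q (AddMonoidHom.mulLeft (Y (q i) * ι d)) w
      fun l => (l.map fun x => Y x.1 * ι x.2).prod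
    simp only [AddMonoidHom.coe_mulLeft] at h h'
    rw [List.map_cons, List.prod_cons, ih, sub_mul, sub_mul]
    simp only [List.map_cons, List.prod_cons, altSum, h, h']

namespace IsFreeBrownianMotion

lemma isSelfAdjoint (hX : IsFreeBrownianMotion ι E σ X) (t : ℝ≥0) : IsSelfAdjoint (X t) :=
  hX.semicircular.1 t

/-- The moments of the increments of a free Brownian motion. -/
lemma moment_increments (hX : IsFreeBrownianMotion ι E σ X) {I : Type*} (p q : I → ℝ≥0)
    (w : List (I × D)) :
    E (w.map fun x => (X (p x.1) - X (q x.1)) * ι x.2).prod =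
      ncPairingSum (fun i j d => incrCov (p i) (q i) (p j) (q j) • σ d) w := by
  rw [altSum_prod]
  have h := altSum_map (D := D) p q E.toAddMonoidHom w fun l => (l.map fun x => X x.1 * ι x.2).prod
  simp only [LinearMap.toAddMonoidHom_coe] at h
  rw [← h]
  simp only [hX.semicircular.2]
  let γ : ℝ≥0 → ℝ≥0 → D →+ D := fun t s =>
    { toFun := fun d => ((min t s : ℝ≥0) : ℝ) • σ d
      map_zero' := by simp
      map_add' := fun x y => by rw [map_add, smul_add] }
  refine (altSum_ncPairingSum p q γ w).trans ?_
  congr 1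
  funext i j d
  simp only [γ, AddMonoidHom.coe_mk, ZeroHom.coe_mk, incrCov, sub_smul]

end IsFreeBrownianMotion

lemma exists_norm_le_of_cp (σ : D →CP D) : ∃ C : ℝ, 0 ≤ C ∧ ∀ d, ‖σ d‖ ≤ C * ‖d‖ := by
  obtain ⟨C, hC⟩ := PositiveLinearMap.exists_norm_apply_le (.ofClass σ : D →ₚ[ℂ] D)
  exact ⟨C, C.2, hC⟩

/-- An induction principle for the `*`-algebra generated by a selfadjoint set. -/
lemma starAdjoin_subset_of_mul_mem {S : Set A} (hS : star S ⊆ S) (M : Submodule ℂ A)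
    (h1 : 1 ∈ M) (hmul : ∀ s ∈ S, ∀ m ∈ M, s * m ∈ M) :
    ((StarAlgebra.adjoin ℂ S : StarSubalgebra ℂ A) : Set A) ⊆ M := by
  intro a ha
  have h' : a ∈ (StarAlgebra.adjoin ℂ S).toSubalgebra := ha
  rw [StarAlgebra.adjoin_toSubalgebra, Set.union_eq_left.mpr hS, ← Subalgebra.mem_toSubmodule,
    Algebra.adjoin_eq_span] at h'
  refine Submodule.span_le.mpr (fun b hb => ?_) h'
  induction hb using Submonoid.closure_induction_left with
  | one => exact h1
  | mul_left x hx y _ ih => exact hmul x hx y ih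

lemma star_range_subset : star (Set.range ι) ⊆ Set.range ι := by
  rintro x ⟨d, hd⟩
  exact ⟨star d, by rw [StarHomClass.map_star, hd, star_star]⟩

/-- The `*`-algebra generated by `D` and selfadjoint elements is spanned by words. -/
lemma algOver_le_span_words {I : Type*} {Y : I → A} (hY : ∀ i, IsSelfAdjoint (Y i)) :
    ((algOver ι (Set.range Y) : StarSubalgebra ℂ A) : Set A) ⊆
      Submodule.span ℂ {a | ∃ (d : D) (w : List (I × D)),
        a = ι d * (w.map fun x => Y x.1 * ι x.2).prod} := by
  refine starAdjoin_subset_of_mul_mem ?_ _ (Submodule.subset_span ⟨1, [], by simp⟩) ?_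
  · rw [Set.union_star]
    refine Set.union_subset_union star_range_subset ?_
    rintro x ⟨i, hi⟩
    exact ⟨i, by rw [← (hY i).star_eq, hi, star_star]⟩
  · intro s hs m hm
    induction hm using Submodule.span_induction with
    | zero => simp
    | add x y _ _ hx hy => rw [mul_add]; exact add_mem hx hy
    | smul r x _ hx => rw [mul_smul_comm]; exact Submodule.smul_mem _ _ hx
    | mem x hx =>
      obtain ⟨d, w, rfl⟩ := hx
      refine Submodule.subset_span ?_
      rcases hs with ⟨d', rfl⟩ | ⟨i, rfl⟩
      · exact ⟨d' * d, w, by rw [map_mul, mul_assoc]⟩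
      · exact ⟨1, (i, d) :: w, by simp [mul_assoc]⟩

namespace IsFreeBrownianMotion

/-- The operator norm of the increments of a free Brownian motion. -/
lemma exists_norm_sub_le (hX : IsFreeBrownianMotion ι E σ X) (hE : IsConditionedMeasure ι E)
    (hE' : IsNondegenerate E) (hA : (algOver ι (Set.range X)).topologicalClosure = ⊤) :
    ∃ C : ℝ, 0 ≤ C ∧ ∀ u v : ℝ≥0, u ≤ v → ‖X v - X u‖ ≤ C * √((v : ℝ) - u) := by
  obtain ⟨M, hM0, hM⟩ := exists_norm_le_of_cp σ
  -- The `4` is the growth rate in the pairing bound. The norm of `1 : D` is the weight of the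
  -- trivial coefficients between consecutive copies of the increment.
  refine ⟨4 * √M * ‖(1 : D)‖, by positivity, fun u v huv => ?_⟩
  set Y := X v - X u with hY
  have hYsa : IsSelfAdjoint Y := (hX.isSelfAdjoint v).sub (hX.isSelfAdjoint u)
  set c := 4 * √M * ‖(1 : D)‖ * √((v : ℝ) - u) with hc
  have hc0 : 0 ≤ c := by positivity
  have hdense : Dense ((algOver ι (Set.range X) : StarSubalgebra ℂ A) : Set A) := by
    rw [dense_iff_closure_eq, ← StarSubalgebra.topologicalClosure_coe, hA]; rfl
  let ρ : ℝ≥0 × ℝ≥0 → ℝ := fun x => √M * √|(x.1 : ℝ) - x.2|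
  have hρ : ∀ x, 0 ≤ ρ x := fun x => by positivity
  have hbound : ∀ w : List ((ℝ≥0 × ℝ≥0) × D),
      ‖E (w.map fun x => (X x.1.1 - X x.1.2) * ι x.2).prod‖ ≤
        (w.map fun x => 4 * (ρ x.1 * ‖x.2‖)).prod := fun w => by
    rw [hX.moment_increments Prod.fst Prod.snd]
    refine norm_ncPairingSum_le hρ (fun i j d => ?_) w
    rw [norm_smul, Real.norm_eq_abs]
    calc _ ≤ (√|(i.1 : ℝ) - i.2| * √|(j.1 : ℝ) - j.2|) * (M * ‖d‖) :=
          mul_le_mul (abs_incrCov_le _ _ _ _) (hM d) (norm_nonneg _) (by positivity)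
      _ = (√|(i.1 : ℝ) - i.2| * √|(j.1 : ℝ) - j.2|) * ((√M * √M) * ‖d‖) := by
          rw [Real.mul_self_sqrt hM0]
      _ = _ := by simp only [ρ]; ring
  let word : List (ℝ≥0 × D) → A := fun w => (w.map fun x => X x.1 * ι x.2).prod
  -- As `X 0 = 0`, each letter `X r` is the increment over `[0, r]`, so words in `X` and powers of
  -- `Y` fall under one moment formula.
  let lift : List (ℝ≥0 × D) → List ((ℝ≥0 × ℝ≥0) × D) := fun w => w.map fun x => ((x.1, 0), x.2)
  have hlift : ∀ w, ((lift w).map fun x => (X x.1.1 - X x.1.2) * ι x.2).prod = word w := fun w => by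
    simp only [lift, word, List.map_map, Function.comp_def, hX.zero, sub_zero]
  have hwords : ∀ (d e : D) (w₁ w₂ : List (ℝ≥0 × D)), ∃ K : ℝ, ∀ n : ℕ,
      ‖E (ι d * word w₁ * Y ^ n * (ι e * word w₂))‖ ≤ K * c ^ n := by
    intro d e w₁ w₂
    let P : List (ℝ≥0 × D) → ℝ := fun w => ((lift w).map fun x => 4 * (ρ x.1 * ‖x.2‖)).prod
    have hP : ∀ w, 0 ≤ P w := fun w => List.prod_nonneg fun y hy => by
      obtain ⟨x, _, rfl⟩ := List.mem_map.mp hy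
      exact mul_nonneg (by norm_num) (mul_nonneg (hρ _) (norm_nonneg _))
    refine ⟨‖E (ι d * word w₁ * (ι e * word w₂))‖ + ‖d‖ * P w₁ * (‖e‖ * P w₂), fun n => ?_⟩
    have h1 := hP w₁
    have h2 := hP w₂
    rcases n with _ | n
    · simp only [pow_zero, mul_one]
      exact le_add_of_nonneg_right (by positivity)
    -- The last copy of `Y` absorbs the coefficient `e`, which requires at least one copy. The
    -- zeroth power is covered by the first summand of the constant chosen above.
    · have hw : ι d * word w₁ * Y ^ (n + 1) * (ι e * word w₂) =
          ι d * ((lift w₁ ++ (List.replicate n ((v, u), 1) ++ ((v, u), e) :: lift w₂)).map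
            fun x : (ℝ≥0 × ℝ≥0) × D => (X x.1.1 - X x.1.2) * ι x.2).prod := by
        simp only [List.map_append, List.prod_append, hlift, List.map_cons, List.prod_cons,
          List.map_replicate, List.prod_replicate, map_one, mul_one, ← hY, pow_succ, mul_assoc]
      have hl4 : 4 * (ρ (v, u) * ‖e‖) ≤ c * ‖e‖ := by
        have hee : ‖e‖ ≤ ‖(1 : D)‖ * ‖e‖ := by simpa using norm_mul_le (1 : D) e
        simp only [ρ, hc, abs_of_nonneg (sub_nonneg.mpr (NNReal.coe_le_coe.mpr huv))]
        calc _ = 4 * √M * √((v : ℝ) - u) * ‖e‖ := by ring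
          _ ≤ 4 * √M * √((v : ℝ) - u) * (‖(1 : D)‖ * ‖e‖) := by gcongr
          _ = _ := by ring
      have hl5 : 4 * (ρ (v, u) * ‖(1 : D)‖) = c := by
        simp only [ρ, hc, abs_of_nonneg (sub_nonneg.mpr (NNReal.coe_le_coe.mpr huv))]
        ring
      rw [hw, hE.map_mul_left]
      refine (norm_mul_le _ _).trans ?_
      refine (mul_le_mul_of_nonneg_left (hbound _) (norm_nonneg _)).trans ?_
      simp only [List.map_append, List.prod_append, List.map_cons, List.prod_cons,
          List.map_replicate, List.prod_replicate, hl5]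
      calc ‖d‖ * (P w₁ * (c ^ n * (4 * (ρ (v, u) * ‖e‖) * P w₂)))
          ≤ ‖d‖ * (P w₁ * (c ^ n * (c * ‖e‖ * P w₂))) := by gcongr
        _ = ‖d‖ * P w₁ * (‖e‖ * P w₂) * c ^ (n + 1) := by ring
        _ ≤ _ := by
          gcongr
          exact le_add_of_nonneg_left (norm_nonneg _)
  have hadd : ∀ f g : ℕ → D, (∃ K : ℝ, ∀ n, ‖f n‖ ≤ K * c ^ n) →
      (∃ K : ℝ, ∀ n, ‖g n‖ ≤ K * c ^ n) → ∃ K : ℝ, ∀ n, ‖f n + g n‖ ≤ K * c ^ n := by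
    rintro f g ⟨K, hK⟩ ⟨L, hL⟩
    exact ⟨K + L, fun n => (norm_add_le _ _).trans (by rw [add_mul]; exact add_le_add (hK n) (hL n))⟩
  have hsmul : ∀ (r : ℂ) (f : ℕ → D), (∃ K : ℝ, ∀ n, ‖f n‖ ≤ K * c ^ n) →
      ∃ K : ℝ, ∀ n, ‖r • f n‖ ≤ K * c ^ n := by
    rintro r f ⟨K, hK⟩
    refine ⟨‖r‖ * K, fun n => ?_⟩
    rw [norm_smul, mul_assoc]
    exact mul_le_mul_of_nonneg_left (hK n) (norm_nonneg _)
  have hgrowth : ∀ x ∈ algOver ι (Set.range X), ∀ y ∈ algOver ι (Set.range X),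
      ∃ K : ℝ, ∀ n : ℕ, ‖E (x * Y ^ n * y)‖ ≤ K * c ^ n := by
    intro x hx y hy
    have hx' := algOver_le_span_words hX.isSelfAdjoint hx
    have hy' := algOver_le_span_words hX.isSelfAdjoint hy
    clear hx hy
    induction hx' using Submodule.span_induction with
    | zero => exact ⟨0, fun n => by simp⟩
    | add x₁ x₂ _ _ h₁ h₂ => simpa only [add_mul, map_add] using hadd _ _ h₁ h₂
    | smul r x _ h => simpa only [smul_mul_assoc, map_smul] using hsmul r _ h
    | mem x hx =>
      obtain ⟨d, w₁, rfl⟩ := hx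
      induction hy' using Submodule.span_induction with
      | zero => exact ⟨0, fun n => by simp⟩
      | add x₁ x₂ _ _ h₁ h₂ => simpa only [mul_add, map_add] using hadd _ _ h₁ h₂
      | smul r x _ h => simpa only [mul_smul_comm, map_smul] using hsmul r _ h
      | mem y hy =>
        obtain ⟨e, w₂, rfl⟩ := hy
        exact hwords d e w₁ w₂
  exact norm_le_of_moment_growth hE hE' hdense hYsa hc0 fun y hy =>
    hgrowth _ (star_mem hy) y hy

end IsFreeBrownianMotion

/-! ### Freeness -/

section Freeness

variable {ι : D →⋆ₐ[ℂ] A} {E : A →ₗ[ℂ] D}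

lemma coe_mem_algOver (S : Set A) (d : D) : ι d ∈ algOver ι S :=
  StarAlgebra.subset_adjoin ℂ _ (Or.inl ⟨d, rfl⟩)

lemma mem_algOver {S : Set A} {a : A} (ha : a ∈ S) : a ∈ algOver ι S :=
  StarAlgebra.subset_adjoin ℂ _ (Or.inr ha)

lemma algOver_le {S : Set A} {B : StarSubalgebra ℂ A} (hι : ∀ d, ι d ∈ B) (hS : S ⊆ B) :
    algOver ι S ≤ B :=
  StarAlgebra.adjoin_le (Set.union_subset (by rintro _ ⟨d, rfl⟩; exact hι d) hS)

lemma algOver_mono {S T : Set A} (h : S ⊆ T) : algOver ι S ≤ algOver ι T :=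
  StarAlgebra.adjoin_mono (Set.union_subset_union_right _ h)

/-- The products of alternating centred elements of the algebras of a given colour. -/
def altWords {κ Λ : Type*} (E : A →ₗ[ℂ] D) (B : κ → StarSubalgebra ℂ A) (c : κ → Λ) (l : Λ) :
    Set A :=
  {a | ∃ w : List (κ × A), w ≠ [] ∧ (∀ p ∈ w, c p.1 = l ∧ p.2 ∈ B p.1 ∧ E p.2 = 0) ∧
    (w.map Prod.fst).IsChain (· ≠ ·) ∧ a = (w.map Prod.snd).prod}

section Group

variable {κ Λ : Type*} {B : κ → StarSubalgebra ℂ A} {c : κ → Λ} {l : Λ}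

lemma coe_mul_mem_altWords (hE : IsConditionedMeasure ι E) (hι : ∀ k d, ι d ∈ B k) (d : D) {a : A}
    (ha : a ∈ altWords E B c l) : ι d * a ∈ altWords E B c l := by
  obtain ⟨w, hw, hm, hc, rfl⟩ := ha
  match w with
  | [] => exact absurd rfl hw
  | p :: w =>
    refine ⟨(p.1, ι d * p.2) :: w, by simp, ?_, by simpa using hc, by simp [mul_assoc]⟩
    intro q hq
    rcases List.mem_cons.mp hq with rfl | hq
    · obtain ⟨h1, h2, h3⟩ := hm p (by simp)
      exact ⟨h1, mul_mem (hι _ _) h2, by rw [hE.map_mul_left, h3, mul_zero]⟩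
    · exact hm q (by simp [hq])

/-- The span of `D` and the alternating centred words. -/
def altSpan (ι : D →⋆ₐ[ℂ] A) (E : A →ₗ[ℂ] D) (B : κ → StarSubalgebra ℂ A) (c : κ → Λ) (l : Λ) :
    Submodule ℂ A :=
  LinearMap.range ι.toAlgHom.toLinearMap ⊔ Submodule.span ℂ (altWords E B c l)

lemma coe_mem_altSpan (d : D) : ι d ∈ altSpan ι E B c l :=
  Submodule.mem_sup_left ⟨d, rfl⟩

lemma altWords_subset_altSpan {a : A} (ha : a ∈ altWords E B c l) : a ∈ altSpan ι E B c l :=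
  Submodule.mem_sup_right (Submodule.subset_span ha)

/-- The centring reduction: if `b` has the index of the first letter, merge the two and recentre,
the scalar part leaving a shorter word; otherwise centre `b` and prepend it. Elements of `D` are
absorbed into the next letter. -/
lemma mul_mem_altSpan (hE : IsConditionedMeasure ι E) (hι : ∀ k d, ι d ∈ B k) {k : κ}
    (hk : c k = l) {b m : A} (hb : b ∈ B k) (hm : m ∈ altSpan ι E B c l) :
    b * m ∈ altSpan ι E B c l := by
  have hcentre : ∀ b ∈ B k, b - ι (E b) ∈ B k ∧ E (b - ι (E b)) = 0 := fun b hb =>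
    ⟨sub_mem hb (hι _ _), hE.map_centre b⟩
  obtain ⟨_, ⟨d, rfl⟩, s, hs, rfl⟩ := Submodule.mem_sup.mp hm
  rw [mul_add]
  refine add_mem ?_ ?_
  · have hb' : b * ι d ∈ B k := mul_mem hb (hι _ _)
    obtain ⟨h1, h2⟩ := hcentre _ hb'
    change b * ι d ∈ _
    rw [← sub_add_cancel (b * ι d) (ι (E (b * ι d)))]
    exact add_mem (altWords_subset_altSpan ⟨[(k, _)], by simp,
      by simpa using ⟨hk, h1, h2⟩, by simp, by simp⟩) (coe_mem_altSpan _)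
  · clear hm
    induction hs using Submodule.span_induction with
    | zero => simp
    | add x y _ _ hx hy => rw [mul_add]; exact add_mem hx hy
    | smul r x _ hx => rw [mul_smul_comm]; exact Submodule.smul_mem _ _ hx
    | mem x hx =>
      have hxx := hx
      obtain ⟨w, hw, hwm, hc, rfl⟩ := hx
      match w with
      | [] => exact absurd rfl hw
      | p :: w =>
        obtain ⟨hp1, hp2, hp3⟩ := hwm p (by simp)
        by_cases hkp : k = p.1
        · subst hkp
          obtain ⟨h1, h2⟩ := hcentre _ (mul_mem hb hp2)
          rw [List.map_cons, List.prod_cons, ← mul_assoc,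
            ← sub_add_cancel (b * p.2) (ι (E (b * p.2))), add_mul]
          refine add_mem (altWords_subset_altSpan ⟨(p.1, b * p.2 - ι (E (b * p.2))) :: w, by simp,
            ?_, by simpa using hc, by simp⟩) ?_
          · intro q hq
            rcases List.mem_cons.mp hq with rfl | hq
            · exact ⟨hk, h1, h2⟩
            · exact hwm q (by simp [hq])
          · by_cases hw0 : w = []
            · subst hw0
              simpa using coe_mem_altSpan _
            · refine altWords_subset_altSpan (coe_mul_mem_altWords hE hι _ ⟨w, hw0, ?_, ?_, rfl⟩)
              · exact fun q hq => hwm q (by simp [hq])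
              · rw [List.map_cons] at hc
                exact hc.tail
        · obtain ⟨h1, h2⟩ := hcentre _ hb
          rw [← sub_add_cancel b (ι (E b)), add_mul]
          refine add_mem (altWords_subset_altSpan ⟨(k, b - ι (E b)) :: p :: w, by simp,
            ?_, ?_, by simp⟩) (altWords_subset_altSpan (coe_mul_mem_altWords hE hι _ hxx))
          · intro q hq
            rcases List.mem_cons.mp hq with rfl | hq
            · exact ⟨hk, h1, h2⟩
            · exact hwm q hq
          · simp only [List.map_cons] at hc ⊢
            exact List.isChain_cons_cons.mpr ⟨hkp, hc⟩

/-- The `*`-algebra generated by the algebras of a given colour. -/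
def groupAlg (ι : D →⋆ₐ[ℂ] A) (B : κ → StarSubalgebra ℂ A) (c : κ → Λ) (l : Λ) :
    StarSubalgebra ℂ A :=
  algOver ι (⋃ k ∈ c ⁻¹' {l}, (B k : Set A))

lemma groupAlg_subset_altSpan (hE : IsConditionedMeasure ι E) (hι : ∀ k d, ι d ∈ B k) :
    (groupAlg ι B c l : Set A) ⊆ altSpan ι E B c l := by
  refine starAdjoin_subset_of_mul_mem ?_ _ (by simpa using coe_mem_altSpan (ι := ι) (1 : D)) ?_
  · rw [Set.union_star]
    refine Set.union_subset_union star_range_subset ?_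
    intro x hx
    simp only [Set.mem_star, Set.mem_iUnion, SetLike.mem_coe] at hx ⊢
    obtain ⟨k, hk, hx⟩ := hx
    exact ⟨k, hk, by simpa using star_mem hx⟩
  · rintro s (⟨d, rfl⟩ | hs) m hm
    · obtain ⟨_, ⟨d', rfl⟩, s, hs, rfl⟩ := Submodule.mem_sup.mp hm
      rw [mul_add]
      refine add_mem ?_ ?_
      · change ι d * ι d' ∈ _
        rw [← map_mul]
        exact coe_mem_altSpan _
      · clear hm
        induction hs using Submodule.span_induction with
        | zero => simp
        | add x y _ _ hx hy => rw [mul_add]; exact add_mem hx hy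
        | smul r x _ hx => rw [mul_smul_comm]; exact Submodule.smul_mem _ _ hx
        | mem x hx => exact altWords_subset_altSpan (coe_mul_mem_altWords hE hι _ hx)
    · simp only [Set.mem_iUnion, SetLike.mem_coe] at hs
      obtain ⟨k, hk, hs⟩ := hs
      exact mul_mem_altSpan hE hι hk hs hm

/-- By freeness the alternating part has expectation zero. Since `E (ι d) = d`, the expectation of
the element is exactly its `D`-component, which must therefore vanish. -/
lemma mem_span_altWords_of_centred (hE : IsConditionedMeasure ι E) (hι : ∀ k d, ι d ∈ B k)
    (hB : IsFreeOver E B) {a : A} (ha : a ∈ groupAlg ι B c l) (ha0 : E a = 0) :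
    a ∈ Submodule.span ℂ (altWords E B c l) := by
  obtain ⟨_, ⟨d, rfl⟩, s, hs, rfl⟩ := Submodule.mem_sup.mp (groupAlg_subset_altSpan hE hι ha)
  have hs0 : E s = 0 := by
    have : Submodule.span ℂ (altWords E B c l) ≤ LinearMap.ker E := by
      refine Submodule.span_le.mpr ?_
      rintro _ ⟨w, hw, hm, hc, rfl⟩
      exact hB w hw (fun p hp => (hm p hp).2) hc
    exact this hs
  have hd : ι.toAlgHom.toLinearMap d = 0 := by
    change ι d = 0
    have h1 : E (ι d + s) = 0 := ha0
    rw [map_add, hs0, hE.map_coe, add_zero] at h1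
    rw [h1, map_zero]
  rwa [hd, zero_add]

/-- Grouping the members of a free family preserves freeness. -/
lemma IsFreeOver.group (hE : IsConditionedMeasure ι E) (hι : ∀ k d, ι d ∈ B k)
    (hB : IsFreeOver E B) (c : κ → Λ) : IsFreeOver E (groupAlg ι B c) := by
  -- The list `w₁` holds the part already expanded into original letters, `w₂` the grouped letters
  -- still to be expanded. Letters on the two sides of the junction have different colours, hence
  -- different indices, so alternation survives concatenation.
  have key : ∀ (w₂ : List (Λ × A)) (w₁ : List (κ × A)), (w₁ ≠ [] ∨ w₂ ≠ []) →
      (∀ p ∈ w₁, p.2 ∈ B p.1 ∧ E p.2 = 0) → (w₁.map Prod.fst).IsChain (· ≠ ·) →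
      (∀ p ∈ w₂, p.2 ∈ groupAlg ι B c p.1 ∧ E p.2 = 0) → (w₂.map Prod.fst).IsChain (· ≠ ·) →
      (∀ p ∈ w₁.getLast?, ∀ q ∈ w₂.head?, c p.1 ≠ q.1) →
      E ((w₁.map Prod.snd).prod * (w₂.map Prod.snd).prod) = 0 := by
    intro w₂
    induction w₂ with
    | nil =>
      intro w₁ h hm₁ hc₁ _ _ _
      simpa using hB w₁ (by simpa using h) hm₁ hc₁
    | cons q w₂ ih =>
      intro w₁ h hm₁ hc₁ hm₂ hc₂ hb
      obtain ⟨hq1, hq2⟩ := hm₂ q (by simp)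
      have hspan := mem_span_altWords_of_centred hE hι hB hq1 hq2
      rw [List.map_cons, List.prod_cons]
      generalize q.2 = a at hspan
      induction hspan using Submodule.span_induction with
      | zero => simp
      | add x y _ _ hx hy => rw [add_mul, mul_add, map_add, hx, hy, add_zero]
      | smul r x _ hx => rw [smul_mul_assoc, mul_smul_comm, map_smul, hx, smul_zero]
      | mem x hx =>
        obtain ⟨w, hw, hwm, hwc, rfl⟩ := hx
        rw [← mul_assoc, ← List.prod_append, ← List.map_append]
        refine ih (w₁ ++ w) (Or.inl (by simp [hw])) ?_ ?_ (fun p hp => hm₂ p (by simp [hp])) ?_ ?_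
        · intro p hp
          rcases List.mem_append.mp hp with hp | hp
          · exact hm₁ p hp
          · exact (hwm p hp).2
        · rw [List.map_append, List.isChain_append]
          refine ⟨hc₁, hwc, ?_⟩
          intro x hx y hy hxy
          rw [List.getLast?_map, Option.mem_map] at hx
          rw [List.head?_map, Option.mem_map] at hy
          obtain ⟨p, hp, rfl⟩ := hx
          obtain ⟨p', hp', rfl⟩ := hy
          refine hb p hp q (by simp) ?_
          rw [hxy]
          exact (hwm p' (List.mem_of_mem_head? hp')).1
        · rw [List.map_cons] at hc₂
          exact hc₂.tail
        · intro p hp p' hp'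
          rw [List.getLast?_append_of_ne_nil _ hw] at hp
          rw [(hwm p (List.mem_of_mem_getLast? hp)).1]
          rw [List.map_cons, List.isChain_cons] at hc₂
          exact hc₂.1 p'.1 (by rw [List.head?_map]; exact Option.mem_map_of_mem _ hp')
  intro w hw hm hc
  simpa using key w [] (Or.inr hw) (by simp) (by simp) hm hc (by simp)

end Group

/-- Freeness passes to weak sequential limits. -/
lemma IsFreeOver.of_weak_limits (hE : IsConditionedMeasure ι E) {κ : Type*}
    {B B' : κ → StarSubalgebra ℂ A} (hB : IsFreeOver E B) (hι : ∀ k d, ι d ∈ B k)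
    (h : ∀ k, ∀ b ∈ B' k, ∃ u : ℕ → A, (∀ n, u n ∈ B k) ∧ ∀ x y, Filter.Tendsto
      (fun n => E (x * u n * y)) Filter.atTop (nhds (E (x * b * y)))) : IsFreeOver E B' := by
  -- Letters are approximated one at a time, `w₁` containing those already replaced by elements of
  -- `B`. Only one factor varies in each limit, so no joint continuity of the product is needed.
  have key : ∀ (w₂ w₁ : List (κ × A)), (w₁ ≠ [] ∨ w₂ ≠ []) →
      (∀ p ∈ w₁, p.2 ∈ B p.1 ∧ E p.2 = 0) → (∀ p ∈ w₂, p.2 ∈ B' p.1 ∧ E p.2 = 0) →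
      ((w₁ ++ w₂).map Prod.fst).IsChain (· ≠ ·) →
      E ((w₁.map Prod.snd).prod * (w₂.map Prod.snd).prod) = 0 := by
    intro w₂
    induction w₂ with
    | nil =>
      intro w₁ h hm₁ _ hc₁
      simpa using hB w₁ (by simpa using h) hm₁ (by simpa using hc₁)
    | cons q w₂ ih =>
      intro w₁ _ hm₁ hm₂ hc
      obtain ⟨hq1, hq2⟩ := hm₂ q (by simp)
      obtain ⟨u, hu, hlim⟩ := h q.1 q.2 hq1
      rw [List.map_cons, List.prod_cons, ← mul_assoc]
      set x := (w₁.map Prod.snd).prod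
      set y := (w₂.map Prod.snd).prod
      -- The approximants need not be centred. They are recentred, and the correction tends to zero
      -- because `E (u n) → E q.2 = 0`.
      have hz : ∀ n, E (x * (u n - ι (E (u n))) * y) = 0 := fun n => by
        have := ih (w₁ ++ [(q.1, u n - ι (E (u n)))]) (Or.inl (by simp)) ?_
          (fun p hp => hm₂ p (by simp [hp])) (by simpa using hc)
        · simpa [mul_assoc] using this
        · intro p hp
          rcases List.mem_append.mp hp with hp | hp
          · exact hm₁ p hp
          · rw [List.mem_singleton] at hp
            subst hp
            exact ⟨sub_mem (hu n) (hι _ _), hE.map_centre _⟩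
      have h1 : Filter.Tendsto (fun n => E (u n)) Filter.atTop (nhds (E q.2)) := by
        simpa using hlim 1 1
      have hιc : Continuous ι := AddMonoidHomClass.continuous_of_bound ι 1 fun d => by
        simpa using NonUnitalStarAlgHom.norm_apply_le ι d
      have h2 : Filter.Tendsto (fun n => E (x * ι (E (u n)) * y)) Filter.atTop
          (nhds (E (x * ι (E q.2) * y))) := by
        have hc : Continuous fun d : D => E (x * ι d * y) :=
          hE.continuous.comp ((continuous_const.mul hιc).mul continuous_const)
        exact (hc.tendsto _).comp h1
      have h3 := (hlim x y).sub h2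
      rw [hq2, map_zero, mul_zero, zero_mul, map_zero, sub_zero] at h3
      refine tendsto_nhds_unique h3 ?_
      refine tendsto_const_nhds.congr fun n => ?_
      rw [← hz n, mul_sub, sub_mul, map_sub]
  intro w hw hm hc
  simpa using key w [] (Or.inr hw) (by simp) hm (by simpa using hc)

lemma exists_weak_limit_of_mem_closure (hE : IsConditionedMeasure ι E) {B : StarSubalgebra ℂ A}
    {b : A} (hb : b ∈ B.topologicalClosure) :
    ∃ u : ℕ → A, (∀ n, u n ∈ B) ∧ ∀ x y, Filter.Tendsto
      (fun n => E (x * u n * y)) Filter.atTop (nhds (E (x * b * y))) := by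
  rw [← SetLike.mem_coe, StarSubalgebra.topologicalClosure_coe, mem_closure_iff_seq_limit] at hb
  obtain ⟨u, hu, hlim⟩ := hb
  exact ⟨u, hu, fun x y => (hE.continuous.tendsto _).comp ((hlim.const_mul x).mul_const y)⟩

/-- For free algebras, a centred element of the one is centred against the other. -/
lemma IsFreeOver.map_mul_mul_eq_zero (hE : IsConditionedMeasure ι E) {B C : StarSubalgebra ℂ A}
    (hBC : IsFreeOver E ![B, C]) (hB : ∀ d, ι d ∈ B) {x m y : A} (hx : x ∈ B)
    (hy : y ∈ B) (hm : m ∈ C) (hm0 : E m = 0) : E (x * m * y) = 0 := by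
  have h1 : ∀ m ∈ C, E m = 0 → ∀ y ∈ B, E (m * y) = 0 := fun m hm hm0 y hy => by
    rw [← sub_add_cancel y (ι (E y)), mul_add, map_add, hE.map_mul_right, hm0, zero_mul, add_zero]
    simpa using hBC [(1, m), (0, y - ι (E y))] (by simp)
      (by simpa [-map_sub] using ⟨⟨hm, hm0⟩, sub_mem hy (hB _), hE.map_centre y⟩) (by simp)
  have h2 : ∀ y ∈ B, E ((x - ι (E x)) * m * y) = 0 := fun y hy => by
    rw [← sub_add_cancel y (ι (E y)), mul_add, map_add, hE.map_mul_right]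
    have e1 : E ((x - ι (E x)) * m) = 0 := by
      simpa using hBC [(0, x - ι (E x)), (1, m)] (by simp)
        (by simpa [-map_sub] using ⟨⟨sub_mem hx (hB _), hE.map_centre x⟩, hm, hm0⟩) (by simp)
    rw [e1, zero_mul, add_zero]
    simpa [mul_assoc] using hBC [(0, x - ι (E x)), (1, m), (0, y - ι (E y))] (by simp)
      (by simpa [-map_sub] using ⟨⟨sub_mem hx (hB _), hE.map_centre x⟩, ⟨hm, hm0⟩,
        sub_mem hy (hB _), hE.map_centre y⟩) (by simp)
  rw [← sub_add_cancel x (ι (E x)), add_mul, add_mul, map_add, h2 y hy, zero_add, mul_assoc,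
    hE.map_mul_left, h1 m hm hm0 y hy, mul_zero]

end Freeness

/-! ### Algebras generated by increments -/

section Increments

variable {ι : D →⋆ₐ[ℂ] A} {E : A →ₗ[ℂ] D} {σ : D →CP D} {X : ℝ≥0 → A}

/-- The `*`-algebra generated by `D` and the increments over the intervals that satisfy `P`. -/
def incrAlg (ι : D →⋆ₐ[ℂ] A) (X : ℝ≥0 → A) (P : ℝ≥0 → ℝ≥0 → Prop) : StarSubalgebra ℂ A :=
  algOver ι {x | ∃ a b, a ≤ b ∧ P a b ∧ x = X b - X a}

/-- The closed `*`-algebra generated by `D` and the increments over the intervals satisfying `P`. -/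
def incrClosure (ι : D →⋆ₐ[ℂ] A) (X : ℝ≥0 → A) (P : ℝ≥0 → ℝ≥0 → Prop) : StarSubalgebra ℂ A :=
  (incrAlg ι X P).topologicalClosure

lemma incrAlg_mono {P Q : ℝ≥0 → ℝ≥0 → Prop} (h : ∀ a b, a ≤ b → P a b → Q a b) :
    incrAlg ι X P ≤ incrAlg ι X Q :=
  algOver_mono (by rintro x ⟨a, b, hab, hP, rfl⟩; exact ⟨a, b, hab, h a b hab hP, rfl⟩)

lemma incrClosure_mono {P Q : ℝ≥0 → ℝ≥0 → Prop} (h : ∀ a b, a ≤ b → P a b → Q a b) :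
    incrClosure ι X P ≤ incrClosure ι X Q :=
  StarSubalgebra.topologicalClosure_mono (incrAlg_mono h)

lemma coe_mem_incrClosure (P : ℝ≥0 → ℝ≥0 → Prop) (d : D) : ι d ∈ incrClosure ι X P :=
  StarSubalgebra.le_topologicalClosure _ (coe_mem_algOver _ d)

lemma sub_mem_incrClosure {P : ℝ≥0 → ℝ≥0 → Prop} {a b : ℝ≥0} (hab : a ≤ b) (h : P a b) :
    X b - X a ∈ incrClosure ι X P :=
  StarSubalgebra.le_topologicalClosure _ (mem_algOver ⟨a, b, hab, h, rfl⟩)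

/-- An element of the generated algebra is a finite expression, so only finitely many endpoints
occur. Quantifying over all larger `G` lets several elements share a single finite set. -/
lemma exists_finset_mem_incrAlg {P : ℝ≥0 → ℝ≥0 → Prop} {x : A} (hx : x ∈ incrAlg ι X P) :
    ∃ F : Finset ℝ≥0, ∀ G : Finset ℝ≥0, F ⊆ G →
      x ∈ incrAlg ι X fun a b => a ∈ G ∧ b ∈ G ∧ P a b := by
  classical
  induction hx using StarAlgebra.adjoin_induction with
  | mem x hx =>
    rcases hx with ⟨d, rfl⟩ | ⟨a, b, hab, hP, rfl⟩
    · exact ⟨∅, fun G _ => coe_mem_algOver _ d⟩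
    · exact ⟨{a, b}, fun G hG => mem_algOver ⟨a, b, hab, ⟨hG (by simp), hG (by simp), hP⟩, rfl⟩⟩
  | algebraMap r => exact ⟨∅, fun G _ => algebraMap_mem _ r⟩
  | add x y _ _ hx hy =>
    obtain ⟨F, hF⟩ := hx
    obtain ⟨F', hF'⟩ := hy
    exact ⟨F ∪ F', fun G hG => add_mem (hF G (Finset.union_subset_left hG))
      (hF' G (Finset.union_subset_right hG))⟩
  | mul x y _ _ hx hy =>
    obtain ⟨F, hF⟩ := hx
    obtain ⟨F', hF'⟩ := hy
    exact ⟨F ∪ F', fun G hG => mul_mem (hF G (Finset.union_subset_left hG))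
      (hF' G (Finset.union_subset_right hG))⟩
  | star x _ hx =>
    obtain ⟨F, hF⟩ := hx
    exact ⟨F, fun G hG => star_mem (hF G hG)⟩

lemma exists_monotone_range_superset (F : Finset ℝ≥0) :
    ∃ τ : ℕ → ℝ≥0, Monotone τ ∧ ∀ x ∈ F, ∃ k, τ k = x := by
  -- Enumerate `F` in increasing order and stay at the maximum afterwards.
  refine ⟨fun k => if h : k < F.card then F.orderEmbOfFin rfl ⟨k, h⟩ else F.sup id, ?_, ?_⟩
  · intro k l hkl
    beta_reduce
    split_ifs with h1 h2 h2
    · exact (F.orderEmbOfFin rfl).monotone hkl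
    · exact Finset.le_sup (f := id) (Finset.orderEmbOfFin_mem F rfl _)
    · omega
    · exact le_rfl
  · intro x hx
    rw [← Finset.mem_coe, ← Finset.range_orderEmbOfFin F rfl] at hx
    obtain ⟨⟨k, hk⟩, rfl⟩ := hx
    exact ⟨k, by simp [hk]⟩

lemma sub_mem_of_forall_increment {C : StarSubalgebra ℂ A} {τ : ℕ → ℝ≥0} {m n : ℕ} (hmn : m ≤ n)
    (h : ∀ k, m ≤ k → k < n → X (τ (k + 1)) - X (τ k) ∈ C) : X (τ n) - X (τ m) ∈ C := by
  induction n, hmn using Nat.le_induction with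
  | base => simp
  | succ n hmn ih =>
    rw [← sub_add_sub_cancel (X (τ (n + 1))) (X (τ n))]
    exact add_mem (h n hmn n.lt_succ_self) (ih fun k hk hkn => h k hk (hkn.trans n.lt_succ_self))

/-- Increments over non-overlapping sets of intervals are free. -/
lemma IsFreeBrownianMotion.isFreeOver_incrAlg (hX : IsFreeBrownianMotion ι E σ X)
    (hE : IsConditionedMeasure ι E) {P Q : ℝ≥0 → ℝ≥0 → Prop}
    (hPQ : ∀ a b c d, a ≤ b → c ≤ d → P a b → Q c d → b ≤ c ∨ d ≤ a) :
    IsFreeOver E ![incrAlg ι X P, incrAlg ι X Q] := by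
  classical
  intro w hw hm hc
  obtain ⟨F, hF⟩ : ∃ F : Finset ℝ≥0, ∀ p ∈ w,
      p.2 ∈ ![incrAlg ι X fun a b => a ∈ F ∧ b ∈ F ∧ P a b,
        incrAlg ι X fun a b => a ∈ F ∧ b ∈ F ∧ Q a b] p.1 := by
    have h1 : ∀ p ∈ w, ∃ F : Finset ℝ≥0, ∀ G : Finset ℝ≥0, F ⊆ G →
        p.2 ∈ ![incrAlg ι X fun a b => a ∈ G ∧ b ∈ G ∧ P a b,
        incrAlg ι X fun a b => a ∈ G ∧ b ∈ G ∧ Q a b] p.1 := by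
      rintro ⟨k, x⟩ hp
      have := (hm _ hp).1
      fin_cases k
      · exact exists_finset_mem_incrAlg this
      · exact exists_finset_mem_incrAlg this
    choose! F hF using fun p : Fin 2 × A => fun hp : p ∈ w => h1 p hp
    refine ⟨w.toFinset.biUnion F, fun p hp => hF p hp _ ?_⟩
    exact Finset.subset_biUnion_of_mem F (List.mem_toFinset.mpr hp)
  obtain ⟨τ, hτ, hFτ⟩ := exists_monotone_range_superset F
  -- An elementary interval gets colour `0` when it is nondegenerate and contained in an interval of
  -- type `P`. By `hPQ` no such interval is contained in one of type `Q`. Degenerate intervals have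
  -- zero increment, so their colour is irrelevant.
  let c : ℕ → Fin 2 := fun k =>
    if τ k < τ (k + 1) ∧ ∃ a b, a ≤ b ∧ P a b ∧ a ≤ τ k ∧ τ (k + 1) ≤ b then 0 else 1
  let B : ℕ → StarSubalgebra ℂ A := fun k => algOver ι {X (τ (k + 1)) - X (τ k)}
  have hfree : IsFreeOver E (groupAlg ι B c) :=
    (hX.free_increments τ hτ).group hE (fun k d => coe_mem_algOver _ d) c
  have hBc : ∀ k, X (τ (k + 1)) - X (τ k) ∈ groupAlg ι B c (c k) := fun k =>
    mem_algOver (Set.mem_biUnion (show k ∈ c ⁻¹' {c k} from rfl) (mem_algOver rfl))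
  have hdeg : ∀ k l, ¬ τ k < τ (k + 1) → X (τ (k + 1)) - X (τ k) ∈ groupAlg ι B c l := fun k l h => by
    rw [le_antisymm (not_lt.mp h) (hτ k.le_succ), sub_self]
    exact zero_mem _
  have hle : ∀ (R : ℝ≥0 → ℝ≥0 → Prop) (l : Fin 2),
      (∀ a b k, a ≤ b → R a b → a ≤ τ k → τ (k + 1) ≤ b → τ k < τ (k + 1) → c k = l) →
      (incrAlg ι X fun a b => a ∈ F ∧ b ∈ F ∧ R a b) ≤ groupAlg ι B c l := by
    intro R l hR
    refine algOver_le (fun d => coe_mem_algOver _ d) ?_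
    rintro _ ⟨a, b, hab, ⟨ha, hb, hab'⟩, rfl⟩
    obtain ⟨m, rfl⟩ := hFτ a ha
    obtain ⟨n, rfl⟩ := hFτ b hb
    rcases le_or_gt m n with hmn | hmn
    · refine sub_mem_of_forall_increment hmn fun k hk hkn => ?_
      by_cases hlt : τ k < τ (k + 1)
      · rw [← hR _ _ k hab hab' (hτ hk) (hτ hkn) hlt]
        exact hBc k
      · exact hdeg k l hlt
    · rw [le_antisymm hab (hτ hmn.le), sub_self]
      exact zero_mem _
  have hP := hle P 0 fun a b k hab hP hak hkb hlt => if_pos ⟨hlt, a, b, hab, hP, hak, hkb⟩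
  have hQ := hle Q 1 fun a b k hab hQ hak hkb hlt => by
    refine if_neg ?_
    rintro ⟨-, a', b', hab', hP', hak', hkb'⟩
    rcases hPQ a' b' a b hab' hab hP' hQ with h | h
    · exact (hlt.trans_le (hkb'.trans (h.trans hak))).false
    · exact (hlt.trans_le (hkb.trans (h.trans hak'))).false
  refine hfree w hw (fun p hp => ⟨?_, (hm p hp).2⟩) hc
  have := hF p hp
  obtain ⟨k, x⟩ := p
  fin_cases k
  · exact hP this
  · exact hQ this

lemma IsFreeBrownianMotion.isFreeOver_incrClosure (hX : IsFreeBrownianMotion ι E σ X)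
    (hE : IsConditionedMeasure ι E) {P Q : ℝ≥0 → ℝ≥0 → Prop}
    (hPQ : ∀ a b c d, a ≤ b → c ≤ d → P a b → Q c d → b ≤ c ∨ d ≤ a) :
    IsFreeOver E ![incrClosure ι X P, incrClosure ι X Q] := by
  refine (hX.isFreeOver_incrAlg hE hPQ).of_weak_limits hE ?_ ?_
  · intro k d
    fin_cases k
    · exact coe_mem_algOver _ d
    · exact coe_mem_algOver _ d
  · intro k b hb
    fin_cases k
    · exact exists_weak_limit_of_mem_closure hE hb
    · exact exists_weak_limit_of_mem_closure hE hb

end Increments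

/-! ### Unitaries `exp (i a)` -/

section ExpI

/-- The exponential `exp (i a)`. -/
def expI (a : A) : A := NormedSpace.exp (Complex.I • a)

lemma expI_mem_unitary {a : A} (ha : IsSelfAdjoint a) : expI a ∈ unitary A :=
  (selfAdjoint.expUnitary ⟨a, ha⟩).2

lemma norm_expI_le {a : A} (ha : IsSelfAdjoint a) : ‖expI a‖ ≤ 1 :=
  norm_le_one_of_mem_unitary (expI_mem_unitary ha)

lemma expI_mem {B : StarSubalgebra ℂ A} (hB : IsClosed (B : Set A)) {a : A} (ha : a ∈ B) :
    expI a ∈ B := by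
  let +nondep : NormedAlgebra ℚ A := .restrictScalars ℚ ℂ A
  exact NormedSpace.exp_mem (R := ℂ) hB (B.smul_mem ha _)

lemma star_expI {a : A} (ha : IsSelfAdjoint a) : star (expI a) = expI (-a) := by
  rw [expI, expI, NormedSpace.star_exp, star_smul, ha.star_eq]
  simp

lemma norm_expI_sub_one_le (a : A) : ‖expI a - 1‖ ≤ ‖a‖ * Real.exp ‖a‖ := by
  have h := norm_exp_sub_sum_le (norm_one_le_one A) (Complex.I • a) 1
  simpa [norm_smul, expI] using h

lemma norm_expI_sub_linear_le (a : A) :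
    ‖expI a - (1 + Complex.I • a)‖ ≤ ‖a‖ ^ 2 * Real.exp ‖a‖ := by
  have h := norm_exp_sub_sum_le (norm_one_le_one A) (Complex.I • a) 2
  simpa [norm_smul, expI, Finset.sum_range_succ] using h

lemma norm_expI_sub_quadratic_le (a : A) :
    ‖expI a - (1 + Complex.I • a - (1 / 2 : ℂ) • (a * a))‖ ≤ ‖a‖ ^ 3 * Real.exp ‖a‖ := by
  have h := norm_exp_sub_sum_le (norm_one_le_one A) (Complex.I • a) 3
  have e : ∑ k ∈ Finset.range 3, ((k.factorial : ℂ)⁻¹) • (Complex.I • a) ^ k =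
      1 + Complex.I • a - (1 / 2 : ℂ) • (a * a) := by
    simp [Finset.sum_range_succ, sq, smul_smul, sub_eq_add_neg]
  rw [e, norm_smul, Complex.norm_I, one_mul] at h
  exact h

/-- `exp (i (a + b)) - exp (i a) exp (i b)` is half the commutator, up to third order. -/
lemma norm_expI_add_sub_le {a b : A} (hb : IsSelfAdjoint b) {r R : ℝ} (har : ‖a‖ ≤ r)
    (hbr : ‖b‖ ≤ r) (hrR : r ≤ R) :
    ‖expI (a + b) - expI a * expI b - (1 / 2 : ℂ) • (a * b - b * a)‖ ≤
      (8 * Real.exp (2 * R) + Real.exp R + (1 + R + R ^ 2) * Real.exp R + (1 + R)) * r ^ 3 := by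
  have hr0 : 0 ≤ r := (norm_nonneg a).trans har
  set P : A → A := fun a => 1 + Complex.I • a - (1 / 2 : ℂ) • (a * a) with hP
  have hab : ‖a + b‖ ≤ 2 * r := (norm_add_le _ _).trans (by linarith)
  have h1 : ‖expI (a + b) - P (a + b)‖ ≤ 8 * Real.exp (2 * R) * r ^ 3 := by
    calc _ ≤ ‖a + b‖ ^ 3 * Real.exp ‖a + b‖ := norm_expI_sub_quadratic_le _
      _ ≤ (2 * r) ^ 3 * Real.exp (2 * R) := by gcongr; linarith
      _ = _ := by ring
  have h2 : ‖(expI a - P a) * expI b‖ ≤ Real.exp R * r ^ 3 := by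
    calc _ ≤ ‖expI a - P a‖ * ‖expI b‖ := norm_mul_le _ _
      _ ≤ (‖a‖ ^ 3 * Real.exp ‖a‖) * 1 := by
          gcongr
          · exact norm_expI_sub_quadratic_le _
          · exact norm_expI_le hb
      _ ≤ (r ^ 3 * Real.exp R) * 1 := by gcongr; linarith
      _ = _ := by ring
  have hPa : ‖P a‖ ≤ 1 + R + R ^ 2 := by
    calc ‖P a‖ ≤ ‖(1 : A)‖ + ‖Complex.I • a‖ + ‖(1 / 2 : ℂ) • (a * a)‖ :=
          (norm_sub_le _ _).trans (add_le_add_left (norm_add_le _ _) _)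
      _ ≤ 1 + ‖a‖ + 1 / 2 * (‖a‖ * ‖a‖) := by
          rw [norm_smul, norm_smul, Complex.norm_I, one_mul]
          gcongr
          · exact norm_one_le_one A
          · norm_num
          · exact norm_mul_le _ _
      _ ≤ _ := by nlinarith [norm_nonneg a]
  have h3 : ‖P a * (expI b - P b)‖ ≤ (1 + R + R ^ 2) * Real.exp R * r ^ 3 := by
    calc _ ≤ ‖P a‖ * ‖expI b - P b‖ := norm_mul_le _ _
      _ ≤ (1 + R + R ^ 2) * (‖b‖ ^ 3 * Real.exp ‖b‖) := by
          gcongr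
          · have := hr0.trans hrR; positivity
          · exact norm_expI_sub_quadratic_le _
      _ ≤ (1 + R + R ^ 2) * (r ^ 3 * Real.exp R) := by
          have := hr0.trans hrR
          gcongr; linarith
      _ = _ := by ring
  -- The terms of order at least three in the product of the quadratic Taylor polynomials. Up to
  -- order two, `P (a + b)` and `P a * P b` differ only by half the commutator.
  set c : A := (Complex.I / 2) • (a * (b * b)) + (Complex.I / 2) • (a * a * b)
    - (1 / 4 : ℂ) • (a * a * (b * b)) with hc
  have h4 : ‖c‖ ≤ (1 + R) * r ^ 3 := by
    have e1 : ‖a * (b * b)‖ ≤ r * (r * r) := by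
      refine (norm_mul_le _ _).trans ?_
      gcongr
      refine (norm_mul_le _ _).trans ?_
      gcongr
    have e2 : ‖a * a * b‖ ≤ r * r * r := by
      refine (norm_mul_le _ _).trans ?_
      gcongr
      refine (norm_mul_le _ _).trans ?_
      gcongr
    have e3 : ‖a * a * (b * b)‖ ≤ r * r * (r * r) := by
      refine (norm_mul_le _ _).trans ?_
      gcongr
      · refine (norm_mul_le _ _).trans ?_
        gcongr
      · refine (norm_mul_le _ _).trans ?_
        gcongr
    have e4 : ‖Complex.I / 2‖ = 1 / 2 := by simp
    have e5 : ‖(1 / 4 : ℂ)‖ = 1 / 4 := by norm_num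
    calc ‖c‖ ≤ ‖(Complex.I / 2) • (a * (b * b))‖ + ‖(Complex.I / 2) • (a * a * b)‖ +
          ‖(1 / 4 : ℂ) • (a * a * (b * b))‖ :=
          (norm_sub_le _ _).trans (add_le_add_left (norm_add_le _ _) _)
      _ ≤ 1 / 2 * (r * (r * r)) + 1 / 2 * (r * r * r) + 1 / 4 * (r * r * (r * r)) := by
          rw [norm_smul, norm_smul, norm_smul, e4, e5]
          gcongr
      _ ≤ _ := by
          have : r * r ^ 3 ≤ R * r ^ 3 := by gcongr
          have : 0 ≤ r ^ 4 := by positivity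
          nlinarith
  have e : expI (a + b) - expI a * expI b - (1 / 2 : ℂ) • (a * b - b * a) =
      (expI (a + b) - P (a + b)) - (expI a - P a) * expI b - P a * (expI b - P b) + c := by
    have e' : P (a + b) - P a * P b = (1 / 2 : ℂ) • (a * b - b * a) + c := by
      simp only [hP, hc, mul_add, add_mul, mul_sub, sub_mul, smul_add, smul_sub, mul_one, one_mul,
        smul_mul_assoc, mul_smul_comm, smul_smul, mul_assoc, Complex.I_mul_I]
      module
    have : c = P (a + b) - P a * P b - (1 / 2 : ℂ) • (a * b - b * a) := by rw [e']; abel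
    rw [this]
    noncomm_ring
  rw [e]
  calc _ ≤ ‖expI (a + b) - P (a + b)‖ + ‖(expI a - P a) * expI b‖ + ‖P a * (expI b - P b)‖ + ‖c‖ :=
        (norm_add_le _ _).trans (add_le_add_left ((norm_sub_le _ _).trans
          (add_le_add_left (norm_sub_le _ _) _)) _)
    _ ≤ _ := by linarith

end ExpI

/-! ### Elements that are almost independent of an interval -/

section Near

variable {ι : D →⋆ₐ[ℂ] A} {E : A →ₗ[ℂ] D} {σ : D →CP D} {X : ℝ≥0 → A}

/-- The closed algebra generated by the increments outside `[u, v]`. -/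
def outerAlg (ι : D →⋆ₐ[ℂ] A) (X : ℝ≥0 → A) (u v : ℝ≥0) : StarSubalgebra ℂ A :=
  incrClosure ι X fun a b => b ≤ u ∨ v ≤ a

/-- The closed algebra generated by the increments inside `[u, v]`. -/
def innerAlg (ι : D →⋆ₐ[ℂ] A) (X : ℝ≥0 → A) (u v : ℝ≥0) : StarSubalgebra ℂ A :=
  incrClosure ι X fun a b => u ≤ a ∧ b ≤ v

/-- The closed algebra generated by the increments before `u`. -/
def pastAlg (ι : D →⋆ₐ[ℂ] A) (X : ℝ≥0 → A) (u : ℝ≥0) : StarSubalgebra ℂ A :=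
  incrClosure ι X fun _ b => b ≤ u

/-- The closed algebra generated by the increments after `u`. -/
def futureAlg (ι : D →⋆ₐ[ℂ] A) (X : ℝ≥0 → A) (u : ℝ≥0) : StarSubalgebra ℂ A :=
  incrClosure ι X fun a _ => u ≤ a

lemma pastAlg_le_outerAlg {p u : ℝ≥0} (h : p ≤ u) (v : ℝ≥0) : pastAlg ι X p ≤ outerAlg ι X u v :=
  incrClosure_mono fun _ _ _ hb => Or.inl (hb.trans h)

lemma futureAlg_le_outerAlg {v q : ℝ≥0} (h : v ≤ q) (u : ℝ≥0) :
    futureAlg ι X q ≤ outerAlg ι X u v :=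
  incrClosure_mono fun _ _ _ ha => Or.inr (h.trans ha)

lemma pastAlg_mono {u v : ℝ≥0} (h : u ≤ v) : pastAlg ι X u ≤ pastAlg ι X v :=
  incrClosure_mono fun _ _ _ hb => hb.trans h

lemma isClosed_incrClosure (P : ℝ≥0 → ℝ≥0 → Prop) : IsClosed (incrClosure ι X P : Set A) :=
  StarSubalgebra.isClosed_topologicalClosure _

lemma filtration_le_pastAlg (h0 : X 0 = 0) (t : ℝ≥0) : filtration ι X t ≤ pastAlg ι X t := by
  refine StarSubalgebra.topologicalClosure_mono (algOver_le (fun d => coe_mem_algOver _ d) ?_)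
  rintro _ ⟨s, hs, rfl⟩
  exact mem_algOver ⟨0, s, zero_le, hs, by rw [h0, sub_zero]⟩

/-- `x` is at distance at most `K √(v - u)` from the algebra of the increments outside `[u, v]`. -/
def NearOuter (ι : D →⋆ₐ[ℂ] A) (X : ℝ≥0 → A) (K : ℝ) (u v : ℝ≥0) (x : A) : Prop :=
  ∃ x₀ ∈ outerAlg ι X u v, ‖x - x₀‖ ≤ K * √((v : ℝ) - u)

namespace NearOuter

variable {K L S : ℝ} {u v : ℝ≥0} {x y z : A}

lemma of_mem (hx : x ∈ outerAlg ι X u v) : NearOuter ι X 0 u v x := ⟨x, hx, by simp⟩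

lemma mono (hx : NearOuter ι X K u v x) (h : K ≤ L) : NearOuter ι X L u v x := by
  obtain ⟨x₀, hx₀, hx⟩ := hx
  exact ⟨x₀, hx₀, hx.trans (by gcongr)⟩

lemma of_norm_sub_le (hx : NearOuter ι X K u v x) (h : ‖y - x‖ ≤ L * √((v : ℝ) - u)) :
    NearOuter ι X (L + K) u v y := by
  obtain ⟨x₀, hx₀, hx⟩ := hx
  refine ⟨x₀, hx₀, ?_⟩
  rw [← sub_add_sub_cancel y x x₀, add_mul]
  exact (norm_add_le _ _).trans (add_le_add h hx)

lemma add (hx : NearOuter ι X K u v x) (hy : NearOuter ι X L u v y) :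
    NearOuter ι X (K + L) u v (x + y) := by
  obtain ⟨x₀, hx₀, hx⟩ := hx
  obtain ⟨y₀, hy₀, hy⟩ := hy
  refine ⟨x₀ + y₀, add_mem hx₀ hy₀, ?_⟩
  rw [add_sub_add_comm, add_mul]
  exact (norm_add_le _ _).trans (add_le_add hx hy)

lemma star (hx : NearOuter ι X K u v x) : NearOuter ι X K u v (star x) := by
  obtain ⟨x₀, hx₀, hx⟩ := hx
  exact ⟨_, star_mem hx₀, by rwa [← star_sub, norm_star]⟩

/-- Exchange one factor at a time. The bound `S` on `√(v - u)` controls the norm of the approximant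
of `x`, making the constant independent of the interval. -/
lemma mul (hx : NearOuter ι X K u v x) (hy : NearOuter ι X L u v y) (hK : 0 ≤ K)
    (hS : √((v : ℝ) - u) ≤ S) :
    NearOuter ι X (K * ‖y‖ + (‖x‖ + K * S) * L) u v (x * y) := by
  obtain ⟨x₀, hx₀, hx⟩ := hx
  obtain ⟨y₀, hy₀, hy⟩ := hy
  refine ⟨x₀ * y₀, mul_mem hx₀ hy₀, ?_⟩
  have hx₀n : ‖x₀‖ ≤ ‖x‖ + K * S := by
    calc ‖x₀‖ = ‖x - (x - x₀)‖ := by rw [sub_sub_cancel]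
      _ ≤ ‖x‖ + ‖x - x₀‖ := norm_sub_le _ _
      _ ≤ _ := by gcongr; exact hx.trans (by gcongr)
  rw [show x * y - x₀ * y₀ = (x - x₀) * y + x₀ * (y - y₀) by noncomm_ring]
  calc _ ≤ ‖x - x₀‖ * ‖y‖ + ‖x₀‖ * ‖y - y₀‖ :=
        (norm_add_le _ _).trans (add_le_add (norm_mul_le _ _) (norm_mul_le _ _))
    _ ≤ K * √((v : ℝ) - u) * ‖y‖ + (‖x‖ + K * S) * (L * √((v : ℝ) - u)) := by
        gcongr
        exact (norm_nonneg _).trans hx₀n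
    _ = _ := by ring

lemma mul_mem_right (hx : NearOuter ι X K u v x) (hz : z ∈ outerAlg ι X u v) :
    NearOuter ι X (‖z‖ * K) u v (x * z) := by
  obtain ⟨x₀, hx₀, hx⟩ := hx
  refine ⟨x₀ * z, mul_mem hx₀ hz, ?_⟩
  rw [← sub_mul]
  calc _ ≤ ‖x - x₀‖ * ‖z‖ := norm_mul_le _ _
    _ ≤ K * √((v : ℝ) - u) * ‖z‖ := by gcongr
    _ = _ := by ring

lemma mem_mul_left (hx : NearOuter ι X K u v x) (hz : z ∈ outerAlg ι X u v) :
    NearOuter ι X (‖z‖ * K) u v (z * x) := by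
  obtain ⟨x₀, hx₀, hx⟩ := hx
  refine ⟨z * x₀, mul_mem hz hx₀, ?_⟩
  rw [← mul_sub]
  calc _ ≤ ‖z‖ * ‖x - x₀‖ := norm_mul_le _ _
    _ ≤ ‖z‖ * (K * √((v : ℝ) - u)) := by gcongr
    _ = _ := by ring

end NearOuter

lemma IsFreeBrownianMotion.map_outer_inner_outer (hX : IsFreeBrownianMotion ι E σ X)
    (hE : IsConditionedMeasure ι E) {u v : ℝ≥0} {x m y : A}
    (hx : x ∈ outerAlg ι X u v) (hy : y ∈ outerAlg ι X u v) (hm : m ∈ innerAlg ι X u v)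
    (hm0 : E m = 0) : E (x * m * y) = 0 := by
  refine IsFreeOver.map_mul_mul_eq_zero hE (hX.isFreeOver_incrClosure hE ?_)
    (coe_mem_incrClosure _) hx hy hm hm0
  rintro a b c d - - (h | h) ⟨h1, h2⟩
  · exact Or.inl (h.trans h1)
  · exact Or.inr (h2.trans h)

/-- A centred element of the algebra of an interval has small moments against elements that are
almost independent of the interval. -/
lemma IsFreeBrownianMotion.norm_map_near_le (hX : IsFreeBrownianMotion ι E σ X)
    (hE : IsConditionedMeasure ι E) {u v : ℝ≥0} {x m y : A} {K L S : ℝ}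
    (hx : NearOuter ι X K u v x) (hy : NearOuter ι X L u v y) (hK : 0 ≤ K)
    (hS : √((v : ℝ) - u) ≤ S) (hm : m ∈ innerAlg ι X u v) (hm0 : E m = 0) :
    ‖E (x * m * y)‖ ≤ ‖m‖ * √((v : ℝ) - u) * (K * ‖y‖ + (‖x‖ + K * S) * L) := by
  obtain ⟨x₀, hx₀, hx⟩ := hx
  obtain ⟨y₀, hy₀, hy⟩ := hy
  have hx₀n : ‖x₀‖ ≤ ‖x‖ + K * S := by
    calc ‖x₀‖ = ‖x - (x - x₀)‖ := by rw [sub_sub_cancel]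
      _ ≤ ‖x‖ + ‖x - x₀‖ := norm_sub_le _ _
      _ ≤ _ := by gcongr; exact hx.trans (by gcongr)
  have hL : 0 ≤ L * √((v : ℝ) - u) := (norm_nonneg _).trans hy
  -- The last term vanishes by freeness; each of the others contains an approximation error of size
  -- `√(v - u)`.
  rw [show x * m * y = (x - x₀) * m * y + x₀ * m * (y - y₀) + x₀ * m * y₀ by noncomm_ring, map_add,
    map_add, hX.map_outer_inner_outer hE hx₀ hy₀ hm hm0, add_zero]
  calc _ ≤ ‖x - x₀‖ * ‖m‖ * ‖y‖ + ‖x₀‖ * ‖m‖ * ‖y - y₀‖ :=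
        (norm_add_le _ _).trans (add_le_add (hE.norm_map_mul_mul_le _ _ _)
          (hE.norm_map_mul_mul_le _ _ _))
    _ ≤ K * √((v : ℝ) - u) * ‖m‖ * ‖y‖ + (‖x‖ + K * S) * ‖m‖ * (L * √((v : ℝ) - u)) := by
        have h := (norm_nonneg _).trans hx₀n
        gcongr
    _ = _ := by ring

/-- Polynomials in the Brownian motion are almost independent of small intervals. -/
lemma exists_nearOuter (h0 : X 0 = 0) {C : ℝ} (hC0 : 0 ≤ C)
    (hC : ∀ u v : ℝ≥0, u ≤ v → ‖X v - X u‖ ≤ C * √((v : ℝ) - u)) {x : A}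
    (hx : x ∈ algOver ι (Set.range X)) {S : ℝ} (hS : 0 ≤ S) :
    ∃ K : ℝ, 0 ≤ K ∧ ∀ u v : ℝ≥0, u ≤ v → √((v : ℝ) - u) ≤ S → NearOuter ι X K u v x := by
  induction hx using StarAlgebra.adjoin_induction with
  | mem x hx =>
    rcases hx with ⟨d, rfl⟩ | ⟨r, rfl⟩
    · exact ⟨0, le_rfl, fun u v _ _ => .of_mem (coe_mem_incrClosure _ d)⟩
    · have hXr : ∀ r, X r = X r - X 0 := fun r => by rw [h0, sub_zero]
      refine ⟨C, hC0, fun u v huv _ => ?_⟩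
      -- If `r` lies before the interval nothing is lost. If it lies inside, approximate by `X u`;
      -- if after, delete the increment over `[u, v]`.
      rcases le_total r u with hru | hur
      · refine (NearOuter.of_mem ?_).mono hC0
        rw [hXr]
        exact sub_mem_incrClosure zero_le (Or.inl hru)
      · have hu : X u ∈ outerAlg ι X u v := by
          rw [hXr]
          exact sub_mem_incrClosure zero_le (Or.inl le_rfl)
        rcases le_total r v with hrv | hvr
        · refine ⟨X u, hu, (hC u r hur).trans ?_⟩
          gcongr
        · refine ⟨X r - X v + X u, add_mem (sub_mem_incrClosure hvr (Or.inr le_rfl)) hu, ?_⟩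
          rw [show X r - (X r - X v + X u) = X v - X u by abel]
          exact hC u v huv
  | algebraMap r => exact ⟨0, le_rfl, fun u v _ _ => .of_mem (algebraMap_mem _ r)⟩
  | add x y _ _ hx hy =>
    obtain ⟨K, hK, hx⟩ := hx
    obtain ⟨L, hL, hy⟩ := hy
    exact ⟨K + L, add_nonneg hK hL, fun u v huv h => (hx u v huv h).add (hy u v huv h)⟩
  | mul x y _ _ hx hy =>
    obtain ⟨K, hK, hx⟩ := hx
    obtain ⟨L, hL, hy⟩ := hy
    exact ⟨_, by positivity, fun u v huv h => (hx u v huv h).mul (hy u v huv h) hK h⟩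
  | star x _ hx =>
    obtain ⟨K, hK, hx⟩ := hx
    exact ⟨K, hK, fun u v huv h => (hx u v huv h).star⟩

end Near

/-! ### Low moments of the increments -/

section LowMoments

variable {ι : D →⋆ₐ[ℂ] A} {E : A →ₗ[ℂ] D} {σ : D →CP D} {X : ℝ≥0 → A}

namespace IsFreeBrownianMotion

lemma map_sub_eq_zero (hX : IsFreeBrownianMotion ι E σ X) (u v : ℝ≥0) : E (X v - X u) = 0 := by
  have h := hX.moment_increments (fun _ : Unit => v) (fun _ => u) [((), 1)]
  simpa [ncPairingSum_cons, splitSum, -map_sub] using h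

lemma map_sub_mul_sub (hX : IsFreeBrownianMotion ι E σ X) (a b c d : ℝ≥0) :
    E ((X a - X b) * (X c - X d)) = incrCov a b c d • σ 1 := by
  have h := hX.moment_increments (fun k : Bool => cond k a c) (fun k => cond k b d)
    [(true, 1), (false, 1)]
  simpa [ncPairingSum_cons, ncPairingSum_nil, splitSum, -map_sub] using h

lemma map_sub_mul_self (hX : IsFreeBrownianMotion ι E σ X) {u v : ℝ≥0} (huv : u ≤ v) :
    E ((X v - X u) * (X v - X u)) = ((v : ℝ) - u) • σ 1 := by
  rw [hX.map_sub_mul_sub, incrCov]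
  simp [huv]

/-- The covariance is symmetric in the two increments, so both orders give the same multiple of `σ
1`. Hence the second-order term of `norm_expI_add_sub_le` is centred. -/
lemma map_commutator_eq_zero (hX : IsFreeBrownianMotion ι E σ X) (a b c d : ℝ≥0) :
    E ((X a - X b) * (X c - X d) - (X c - X d) * (X a - X b)) = 0 := by
  rw [map_sub, hX.map_sub_mul_sub, hX.map_sub_mul_sub, ← sub_smul, incrCov, incrCov,
    min_comm c a, min_comm c b, min_comm d a, min_comm d b]
  simp [sub_sub_sub_comm]

end IsFreeBrownianMotion

end LowMoments

/-! ### Products of unitary increments -/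

section Evol

variable {ι : D →⋆ₐ[ℂ] A} {E : A →ₗ[ℂ] D} {σ : D →CP D} {X : ℝ≥0 → A}

/-- The product of `exp (i (X_{s + (j+1) h} - X_{s + j h}))`, `j < k`, later factors on the left. -/
def evol (X : ℝ≥0 → A) (s h : ℝ≥0) : ℕ → A
  | 0 => 1
  | k + 1 => expI (X (s + (k + 1 : ℕ) * h) - X (s + k * h)) * evol X s h k

/-- The definition splits off the latest factor, this identity the earliest. In `W * star W'` the
earliest factors stand in the middle, so this form drives the comparison with the halved partition.
-/
lemma evol_succ_left (s h : ℝ≥0) (k : ℕ) :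
    evol X s h (k + 1) = evol X (s + h) h k * expI (X (s + h) - X s) := by
  induction k with
  | zero => simp [evol]
  | succ k ih =>
    rw [evol, ih, evol, mul_assoc,
      show s + (k + 1 + 1 : ℕ) * h = s + h + (k + 1 : ℕ) * h by push_cast; ring,
      show s + (k + 1 : ℕ) * h = s + h + k * h by push_cast; ring]

lemma evol_mem_unitary (hX : IsFreeBrownianMotion ι E σ X) (s h : ℝ≥0) (k : ℕ) :
    evol X s h k ∈ unitary A := by
  induction k with
  | zero => exact one_mem _
  | succ k ih => exact mul_mem (expI_mem_unitary ((hX.isSelfAdjoint _).sub (hX.isSelfAdjoint _))) ih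

lemma norm_evol_le (hX : IsFreeBrownianMotion ι E σ X) (s h : ℝ≥0) (k : ℕ) :
    ‖evol X s h k‖ ≤ 1 :=
  norm_le_one_of_mem_unitary (evol_mem_unitary hX s h k)

lemma evol_mem (s h : ℝ≥0) (k : ℕ) :
    evol X s h k ∈ incrClosure ι X fun a b => s ≤ a ∧ b ≤ s + k * h := by
  induction k with
  | zero => exact one_mem _
  | succ k ih =>
    have hle : s + k * h ≤ s + (k + 1 : ℕ) * h := by gcongr; simp
    refine mul_mem (expI_mem (isClosed_incrClosure _) (sub_mem_incrClosure hle ⟨?_, le_rfl⟩))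
      (incrClosure_mono (fun a b _ hab => ⟨hab.1, hab.2.trans hle⟩) ih)
    exact le_self_add

lemma evol_mem_futureAlg (s h : ℝ≥0) (k : ℕ) : evol X s h k ∈ futureAlg ι X s :=
  incrClosure_mono (fun _ _ _ h => h.1) (evol_mem s h k)

lemma evol_mem_pastAlg (s h : ℝ≥0) (k : ℕ) : evol X s h k ∈ pastAlg ι X (s + k * h) :=
  incrClosure_mono (fun _ _ _ h => h.2) (evol_mem s h k)

/-- Halving an interval changes the product of unitary increments by a small amount, weakly. -/
lemma exists_norm_map_refine_le (hX : IsFreeBrownianMotion ι E σ X)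
    (hE : IsConditionedMeasure ι E) {C : ℝ} (hC0 : 0 ≤ C)
    (hC : ∀ u v : ℝ≥0, u ≤ v → ‖X v - X u‖ ≤ C * √((v : ℝ) - u)) {x y : A}
    (hx : x ∈ algOver ι (Set.range X)) (hy : y ∈ algOver ι (Set.range X)) {S : ℝ} (hS : 0 ≤ S) :
    ∃ K : ℝ, 0 ≤ K ∧ ∀ u w v : ℝ≥0, u ≤ w → w ≤ v → √((v : ℝ) - u) ≤ S →
      ∀ Q ∈ outerAlg ι X u v, ∀ R ∈ outerAlg ι X u v, ‖Q‖ ≤ 1 → ‖R‖ ≤ 1 →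
      ‖E (x * Q * (expI (X v - X u) - expI (X v - X w) * expI (X w - X u)) *
        (star (expI (X v - X w) * expI (X w - X u)) * R * y))‖ ≤ K * √((v : ℝ) - u) ^ 3 := by
  obtain ⟨K, hK0, hK⟩ := exists_nearOuter hX.zero hC0 hC hx hS
  obtain ⟨L, hL0, hL⟩ := exists_nearOuter hX.zero hC0 hC hy hS
  set M := Real.exp (C * S) with hM
  set R0 := C * S with hR0
  set c3 := 8 * Real.exp (2 * R0) + Real.exp R0 + (1 + R0 + R0 ^ 2) * Real.exp R0 + (1 + R0) with hc3
  have hR00 : 0 ≤ R0 := by positivity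
  refine ⟨C ^ 2 * (K * ‖y‖ + (‖x‖ + K * S) * (2 * C * M * ‖y‖ + L)) + ‖x‖ * (c3 * C ^ 3) * ‖y‖,
    by positivity, ?_⟩
  intro u w v huw hwv huvS Q hQ R hR hQ1 hR1
  have huv := huw.trans hwv
  set r := √((v : ℝ) - u) with hr
  have hr0 : 0 ≤ r := Real.sqrt_nonneg _
  set a := X v - X w with ha
  set b := X w - X u with hb
  have hab : X v - X u = a + b := by rw [ha, hb]; abel
  have hasa : IsSelfAdjoint a := (hX.isSelfAdjoint _).sub (hX.isSelfAdjoint _)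
  have hbsa : IsSelfAdjoint b := (hX.isSelfAdjoint _).sub (hX.isSelfAdjoint _)
  have hwv' : ((v : ℝ) - w) ≤ v - u := by have := NNReal.coe_le_coe.mpr huw; linarith
  have huw' : ((w : ℝ) - u) ≤ v - u := by have := NNReal.coe_le_coe.mpr hwv; linarith
  have han : ‖a‖ ≤ C * r := (hC w v hwv).trans (by rw [hr]; gcongr)
  have hbn : ‖b‖ ≤ C * r := (hC u w huw).trans (by rw [hr]; gcongr)
  have hCr : C * r ≤ R0 := by rw [hR0]; gcongr
  have hexp : ∀ z : A, ‖z‖ ≤ C * r → ‖expI z - 1‖ ≤ C * r * M := fun z hz =>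
    (norm_expI_sub_one_le z).trans (by rw [hM]; gcongr; exact hz.trans hCr)
  set Z := star (expI a * expI b) with hZ
  have hZ1 : ‖Z‖ ≤ 1 := norm_le_one_of_mem_unitary
    (Unitary.star_mem (mul_mem (expI_mem_unitary hasa) (expI_mem_unitary hbsa)))
  -- The factor `Z` belongs to `[u, v]` itself, but it is `O(√(v - u))`-close to `1`, so the
  -- right-hand test element remains almost outer.
  have hZd : ‖Z - 1‖ ≤ 2 * C * M * r := by
    rw [hZ, ← star_one A, ← star_sub, norm_star,
      show expI a * expI b - 1 = (expI a - 1) * expI b + (expI b - 1) by noncomm_ring]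
    calc _ ≤ ‖expI a - 1‖ * ‖expI b‖ + ‖expI b - 1‖ :=
          (norm_add_le _ _).trans (add_le_add_left (norm_mul_le _ _) _)
      _ ≤ C * r * M * 1 + C * r * M := by
          gcongr
          · exact hexp a han
          · exact norm_expI_le hbsa
          · exact hexp b hbn
      _ = _ := by ring
  have hRy : ‖R * y‖ ≤ ‖y‖ := (norm_mul_le _ _).trans (mul_le_of_le_one_left (norm_nonneg _) hR1)
  have hxQn : ‖x * Q‖ ≤ ‖x‖ := (norm_mul_le _ _).trans (mul_le_of_le_one_right (norm_nonneg _) hQ1)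
  have hyn : ‖Z * R * y‖ ≤ ‖y‖ := by
    rw [mul_assoc]
    exact (norm_mul_le _ _).trans ((mul_le_of_le_one_left (norm_nonneg _) hZ1).trans hRy)
  have hxQ : NearOuter ι X K u v (x * Q) :=
    ((hK u v huv huvS).mul_mem_right hQ).mono (mul_le_of_le_one_left hK0 hQ1)
  have hZy : NearOuter ι X (2 * C * M * ‖y‖ + L) u v (Z * R * y) := by
    refine NearOuter.of_norm_sub_le
      (((hL u v huv huvS).mem_mul_left hR).mono (mul_le_of_le_one_left hL0 hR1)) ?_
    rw [show Z * R * y - R * y = (Z - 1) * (R * y) by noncomm_ring]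
    calc _ ≤ ‖Z - 1‖ * ‖R * y‖ := norm_mul_le _ _
      _ ≤ 2 * C * M * r * ‖y‖ := by gcongr
      _ = _ := by ring
  -- The commutator term has norm `O(r ^ 2)`; being centred, it gains another `r`, which matches the
  -- cubic remainder.
  set m : A := (1 / 2 : ℂ) • (a * b - b * a) with hm
  have hai : a ∈ innerAlg ι X u v := sub_mem_incrClosure hwv ⟨huw, le_rfl⟩
  have hbi : b ∈ innerAlg ι X u v := sub_mem_incrClosure huw ⟨le_rfl, hwv⟩
  have hmi : m ∈ innerAlg ι X u v :=
    (innerAlg ι X u v).smul_mem (sub_mem (mul_mem hai hbi) (mul_mem hbi hai)) _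
  have hm0 : E m = 0 := by rw [hm, map_smul, hX.map_commutator_eq_zero, smul_zero]
  have hmn : ‖m‖ ≤ C ^ 2 * r ^ 2 := by
    rw [hm, norm_smul]
    calc ‖(1 / 2 : ℂ)‖ * ‖a * b - b * a‖ ≤ 1 / 2 * (‖a‖ * ‖b‖ + ‖b‖ * ‖a‖) := by
          gcongr
          · norm_num
          · exact (norm_sub_le _ _).trans (add_le_add (norm_mul_le _ _) (norm_mul_le _ _))
      _ ≤ 1 / 2 * ((C * r) * (C * r) + (C * r) * (C * r)) := by gcongr
      _ = _ := by ring
  have h3 := norm_expI_add_sub_le hbsa han hbn hCr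
  rw [← hc3, ← hm] at h3
  rw [hab, show x * Q * (expI (a + b) - expI a * expI b) * (Z * R * y) =
    x * Q * m * (Z * R * y) + x * Q * (expI (a + b) - expI a * expI b - m) * (Z * R * y) by
      noncomm_ring, map_add]
  calc _ ≤ ‖m‖ * r * (K * ‖Z * R * y‖ + (‖x * Q‖ + K * S) * (2 * C * M * ‖y‖ + L)) +
        ‖x * Q‖ * ‖expI (a + b) - expI a * expI b - m‖ * ‖Z * R * y‖ :=
        (norm_add_le _ _).trans (add_le_add
          (hX.norm_map_near_le hE hxQ hZy hK0 huvS hmi hm0) (hE.norm_map_mul_mul_le _ _ _))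
    _ ≤ C ^ 2 * r ^ 2 * r * (K * ‖y‖ + (‖x‖ + K * S) * (2 * C * M * ‖y‖ + L)) +
        ‖x‖ * (c3 * (C * r) ^ 3) * ‖y‖ := by
        gcongr
    _ = _ := by ring

/-- The products of unitary increments over a partition and over its halving. -/
lemma exists_norm_map_evol_half_le (hX : IsFreeBrownianMotion ι E σ X)
    (hE : IsConditionedMeasure ι E) {C : ℝ} (hC0 : 0 ≤ C)
    (hC : ∀ u v : ℝ≥0, u ≤ v → ‖X v - X u‖ ≤ C * √((v : ℝ) - u)) {x y : A}
    (hx : x ∈ algOver ι (Set.range X)) (hy : y ∈ algOver ι (Set.range X)) {S : ℝ} (hS : 0 ≤ S) :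
    ∃ K : ℝ, 0 ≤ K ∧ ∀ h : ℝ≥0, √(h : ℝ) ≤ S → ∀ (N : ℕ) (s : ℝ≥0),
      ‖E (x * (evol X s h N * star (evol X s (h / 2) (2 * N)) - 1) * y)‖ ≤
        N * (K * √(h : ℝ) ^ 3) := by
  obtain ⟨K, hK0, hK⟩ := exists_norm_map_refine_le hX hE hC0 hC hx hy hS
  refine ⟨K, hK0, fun h hh N => ?_⟩
  induction N with
  | zero => intro s; simp [evol]
  | succ N ih =>
    intro s
    have hhalf : s + h / 2 + h / 2 = s + h := by rw [add_assoc, add_halves]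
    have hsub : ((s + h : ℝ≥0) : ℝ) - s = h := by push_cast; ring
    rw [evol_succ_left, show 2 * (N + 1) = 2 * N + 1 + 1 by ring, evol_succ_left (s := s),
      evol_succ_left (s := s + h / 2), hhalf]
    set Q := evol X (s + h) h N
    set R := evol X (s + h) (h / 2) (2 * N)
    have hQ : Q ∈ outerAlg ι X s (s + h) :=
      futureAlg_le_outerAlg le_rfl _ (evol_mem_futureAlg _ _ _)
    have hR : star R ∈ outerAlg ι X s (s + h) :=
      star_mem (futureAlg_le_outerAlg le_rfl _ (evol_mem_futureAlg _ _ _))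
    have h1 := hK s (s + h / 2) (s + h) le_self_add (by gcongr; exact NNReal.half_le_self _)
      (by rwa [hsub]) Q hQ (star R) hR (norm_evol_le hX _ _ _)
      (by rw [norm_star]; exact norm_evol_le hX _ _ _)
    rw [hsub] at h1
    set a := expI (X (s + h) - X (s + h / 2))
    set b := expI (X (s + h / 2) - X s)
    have hab : a * b * star (a * b) = 1 := Unitary.mul_star_self_of_mem (mul_mem
      (expI_mem_unitary ((hX.isSelfAdjoint _).sub (hX.isSelfAdjoint _)))
      (expI_mem_unitary ((hX.isSelfAdjoint _).sub (hX.isSelfAdjoint _))))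
    have e : x * (Q * expI (X (s + h) - X s) * star (R * a * b) - 1) * y =
        x * Q * (expI (X (s + h) - X s) - a * b) * (star (a * b) * star R * y) +
          x * (Q * star R - 1) * y := by
      have h2 : x * Q * (a * b) * (star (a * b) * star R * y) = x * Q * star R * y := by
        rw [show x * Q * (a * b) * (star (a * b) * star R * y) =
          x * Q * (a * b * star (a * b)) * star R * y by noncomm_ring, hab, mul_one]
      rw [mul_sub (x * Q), sub_mul _ _ (star (a * b) * star R * y), h2, mul_assoc R, star_mul R]
      generalize star (a * b) = Z
      noncomm_ring
    rw [e, map_add]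
    refine (norm_add_le _ _).trans ((add_le_add h1 (ih (s + h))).trans_eq ?_)
    push_cast
    ring

end Evol

/-! ### The stochastic differential equation on small intervals -/

section Equation

variable {ι : D →⋆ₐ[ℂ] A} {E : A →ₗ[ℂ] D} {σ : D →CP D} {X U : ℝ≥0 → A}

/-- Increments of stochastic integrals over small intervals, weakly to first order. -/
lemma norm_map_stochIntegral_sub_le (hX : IsFreeBrownianMotion ι E σ X)
    (hE : IsConditionedMeasure ι E) {C : ℝ} (hC0 : 0 ≤ C)
    (hC : ∀ u v : ℝ≥0, u ≤ v → ‖X v - X u‖ ≤ C * √((v : ℝ) - u))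
    (hU : ∀ t, U t ∈ pastAlg ι X t) {u v : ℝ≥0} (huv : u ≤ v) {z y Ju Jv : A} {K L S η : ℝ}
    (hK : 0 ≤ K) (hL : 0 ≤ L) (hS : √((v : ℝ) - u) ≤ S)
    (hz : ∀ p q, u ≤ p → p ≤ q → q ≤ v → NearOuter ι X K p q z)
    (hy : ∀ p q, u ≤ p → p ≤ q → q ≤ v → NearOuter ι X L p q y)
    (hη : ∀ r, u ≤ r → r ≤ v → ‖U r - U u‖ ≤ η)
    (hJu : IsStochIntegral E X (fun _ => 1) U u Ju)
    (hJv : IsStochIntegral E X (fun _ => 1) U v Jv) :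
    ‖E (z * (Jv - Ju - (X v - X u) * U u) * y)‖ ≤
      ((v : ℝ) - u) * (C * η * (K * ‖y‖ + (‖z‖ + K * S) * L)) := by
  have hS0 : 0 ≤ S := (Real.sqrt_nonneg _).trans hS
  have hη0 : 0 ≤ η := (norm_nonneg _).trans (hη u le_rfl huv)
  set B := C * η * (K * ‖y‖ + (‖z‖ + K * S) * L) with hB
  -- The increment of `X` is centred and `U p - U u` belongs to the past of `p`. One factor `√(q -
  -- p)` comes from the norm of the increment and one from freeness, so the bounds add up to the
  -- length of `[u, v]`.
  have hpiece : ∀ p q, u ≤ p → p ≤ q → q ≤ v →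
      ‖E (z * ((X q - X p) * (U p - U u)) * y)‖ ≤ ((q : ℝ) - p) * B := by
    intro p q hup hpq hqv
    have hR : U p - U u ∈ outerAlg ι X p q :=
      pastAlg_le_outerAlg le_rfl q (sub_mem (hU p) (pastAlg_mono hup (hU u)))
    have hp : ‖U p - U u‖ ≤ η := hη p hup (hpq.trans hqv)
    have hpqS : √((q : ℝ) - p) ≤ S := by
      refine le_trans (Real.sqrt_le_sqrt ?_) hS
      have := NNReal.coe_le_coe.mpr hup
      have := NNReal.coe_le_coe.mpr hqv
      linarith
    have h := hX.norm_map_near_le hE (hz p q hup hpq hqv) ((hy p q hup hpq hqv).mem_mul_left hR)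
      hK hpqS (m := X q - X p) (sub_mem_incrClosure hpq ⟨le_rfl, le_rfl⟩) (hX.map_sub_eq_zero p q)
    rw [show z * ((X q - X p) * (U p - U u)) * y = z * (X q - X p) * ((U p - U u) * y) by
      noncomm_ring]
    have hsq : √((q : ℝ) - p) * √((q : ℝ) - p) = (q : ℝ) - p :=
      Real.mul_self_sqrt (sub_nonneg.mpr (NNReal.coe_le_coe.mpr hpq))
    have h1 : ‖(U p - U u) * y‖ ≤ η * ‖y‖ := (norm_mul_le _ _).trans (by gcongr)
    calc _ ≤ _ := h
      _ ≤ C * √((q : ℝ) - p) * √((q : ℝ) - p) *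
            (K * (η * ‖y‖) + (‖z‖ + K * S) * (η * L)) := by
          have := hC p q hpq
          gcongr
      _ = (√((q : ℝ) - p) * √((q : ℝ) - p)) * B := by rw [hB]; ring
      _ = _ := by rw [hsq]
  refine le_of_forall_pos_le_add fun ε hε => ?_
  obtain ⟨δ₁, hδ₁, h₁⟩ := hJu z y (ε / 2) (by positivity)
  obtain ⟨δ₂, hδ₂, h₂⟩ := hJv z y (ε / 2) (by positivity)
  obtain ⟨n, hn⟩ := exists_nat_gt ((v : ℝ) / min δ₁ δ₂)
  have hδ : 0 < min δ₁ δ₂ := lt_min hδ₁ hδ₂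
  have hn0 : (0 : ℝ) < n := lt_of_le_of_lt (by positivity) hn
  have hn0' : (n : ℝ≥0) ≠ 0 := by
    intro h
    have : (n : ℝ) = 0 := by exact_mod_cast congrArg NNReal.toReal h
    linarith
  have hvn : (v : ℝ) / n < min δ₁ δ₂ := by
    rw [div_lt_iff₀ hδ] at hn
    rw [div_lt_iff₀ hn0]
    linarith
  have huvR : (u : ℝ) ≤ v := NNReal.coe_le_coe.mpr huv
  set f : ℝ≥0 := u / n with hf
  set g : ℝ≥0 := (v - u) / n with hg
  have hnf : (n : ℝ≥0) * f = u := mul_div_cancel₀ u hn0'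
  have hng : (n : ℝ≥0) * g = v - u := mul_div_cancel₀ _ hn0'
  have hfδ : (f : ℝ) < min δ₁ δ₂ := by
    refine lt_of_le_of_lt ?_ hvn
    rw [hf, NNReal.coe_div, NNReal.coe_natCast]
    gcongr
  have hgR : (g : ℝ) = ((v : ℝ) - u) / n := by
    rw [hg, NNReal.coe_div, NNReal.coe_sub huv, NNReal.coe_natCast]
  have hgδ : (g : ℝ) < min δ₁ δ₂ := by
    refine lt_of_le_of_lt ?_ hvn
    rw [hgR]
    have : (0 : ℝ) ≤ u := u.2
    gcongr
    linarith
  -- `n` equal steps on `[0, u]` followed by `n` equal steps on `[u, v]`. The same sequence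
  -- discretizes `[0, u]` and `[0, v]`, so the Riemann sums subtract exactly.
  set π : ℕ → ℝ≥0 := fun k => (min k n : ℕ) * f + (k - n : ℕ) * g with hπ
  have hπ1 : ∀ k ≤ n, π k = k * f := fun k hk => by
    change ((min k n : ℕ) : ℝ≥0) * f + ((k - n : ℕ) : ℝ≥0) * g = _
    rw [min_eq_left hk, Nat.sub_eq_zero_of_le hk]
    simp
  have hπ2 : ∀ j, π (n + j) = u + j * g := fun j => by
    simp [hπ, hnf]
  have hstep1 : ∀ k < n, π k ≤ π (k + 1) ∧ (π (k + 1) : ℝ) - π k < min δ₁ δ₂ := fun k hk => by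
    rw [hπ1 k hk.le, hπ1 (k + 1) hk]
    refine ⟨by gcongr; simp, ?_⟩
    push_cast
    linarith
  have hstep2 : ∀ j, π (n + j) ≤ π (n + j + 1) ∧
      (π (n + j + 1) : ℝ) - π (n + j) < min δ₁ δ₂ := fun j => by
    rw [add_assoc n j 1, hπ2, hπ2]
    refine ⟨by gcongr; simp, ?_⟩
    push_cast
    linarith
  have hd1 : IsDiscretization u δ₁ n π :=
    ⟨by simp [hπ1 0 n.zero_le], by rw [hπ1 n le_rfl, hnf],
      fun k hk => ⟨(hstep1 k hk).1, (hstep1 k hk).2.trans_le (min_le_left _ _)⟩⟩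
  have hd2 : IsDiscretization v δ₂ (n + n) π := by
    refine ⟨by simp [hπ1 0 n.zero_le], by rw [hπ2, hng, add_tsub_cancel_of_le huv], fun k _ => ?_⟩
    rcases lt_or_ge k n with hk | hk
    · exact ⟨(hstep1 k hk).1, (hstep1 k hk).2.trans_le (min_le_right _ _)⟩
    · obtain ⟨j, rfl⟩ := Nat.exists_eq_add_of_le hk
      exact ⟨(hstep2 j).1, (hstep2 j).2.trans_le (min_le_right _ _)⟩
  have hsum : riemannSum X (fun _ => 1) U (n + n) π = riemannSum X (fun _ => 1) U n π +
      ∑ j ∈ Finset.range n, (X (u + (j + 1 : ℕ) * g) - X (u + j * g)) * U (u + j * g) := by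
    rw [riemannSum, Finset.sum_range_add, riemannSum]
    congr 1
    refine Finset.sum_congr rfl fun j _ => ?_
    rw [one_mul, add_assoc n j 1, hπ2, hπ2]
  have htel : (X v - X u) * U u =
      ∑ j ∈ Finset.range n, (X (u + (j + 1 : ℕ) * g) - X (u + j * g)) * U u := by
    rw [← Finset.sum_mul, Finset.sum_range_sub (fun j : ℕ => X (u + j * g)), hng,
      add_tsub_cancel_of_le huv]
    simp
  have hsplit : z * (Jv - Ju - (X v - X u) * U u) * y =
      z * (riemannSum X (fun _ => 1) U n π - Ju) * y -
      z * (riemannSum X (fun _ => 1) U (n + n) π - Jv) * y +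
      ∑ j ∈ Finset.range n, z * ((X (u + (j + 1 : ℕ) * g) - X (u + j * g)) *
        (U (u + j * g) - U u)) * y := by
    rw [← Finset.sum_mul, ← Finset.mul_sum]
    simp only [mul_sub _ _ (U u)]
    rw [Finset.sum_sub_distrib, ← htel, hsum]
    noncomm_ring
  have hlast : ‖E (∑ j ∈ Finset.range n, z * ((X (u + (j + 1 : ℕ) * g) - X (u + j * g)) *
        (U (u + j * g) - U u)) * y)‖ ≤ ((v : ℝ) - u) * B := by
    rw [map_sum]
    refine (norm_sum_le _ _).trans ?_
    calc _ ≤ ∑ j ∈ Finset.range n, (g : ℝ) * B := by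
          refine Finset.sum_le_sum fun j hj => ?_
          have hj' : j + 1 ≤ n := Finset.mem_range.mp hj
          refine (hpiece _ _ le_self_add (by gcongr; simp) ?_).trans_eq ?_
          · calc u + (j + 1 : ℕ) * g ≤ u + n * g := by gcongr
              _ = v := by rw [hng, add_tsub_cancel_of_le huv]
          · push_cast; ring
      _ = _ := by
          rw [Finset.sum_const, Finset.card_range, nsmul_eq_mul, hgR]
          field_simp
  rw [hsplit, map_add, map_sub]
  calc _ ≤ ε / 2 + ε / 2 + ((v : ℝ) - u) * B :=
        (norm_add_le _ _).trans (add_le_add ((norm_sub_le _ _).trans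
          (add_le_add (h₁ n π hd1).le (h₂ (n + n) π hd2).le)) hlast)
    _ = _ := by ring

lemma IsEvolution.mem_pastAlg (hU : IsEvolution ι E σ X U) (hX : IsFreeBrownianMotion ι E σ X)
    (t : ℝ≥0) : U t ∈ pastAlg ι X t :=
  filtration_le_pastAlg hX.zero t (hU.adapted t)

lemma norm_integral_sub_le (hU : Continuous U) {u v : ℝ≥0} (huv : u ≤ v) {η : ℝ}
    (hη : ∀ r, u ≤ r → r ≤ v → ‖U r - U u‖ ≤ η) :
    ‖(∫ s in (0 : ℝ)..(v : ℝ), U s.toNNReal) - (∫ s in (0 : ℝ)..(u : ℝ), U s.toNNReal) -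
      ((v : ℝ) - u) • U u‖ ≤ ((v : ℝ) - u) * η := by
  have huvR : (u : ℝ) ≤ v := NNReal.coe_le_coe.mpr huv
  have hc : Continuous fun s : ℝ => U s.toNNReal := hU.comp continuous_real_toNNReal
  rw [intervalIntegral.integral_interval_sub_left (hc.intervalIntegrable _ _)
    (hc.intervalIntegrable _ _), ← intervalIntegral.integral_const,
    ← intervalIntegral.integral_sub (hc.intervalIntegrable _ _)
      (continuous_const.intervalIntegrable _ _)]
  refine (intervalIntegral.norm_integral_le_of_norm_le_const (C := η) fun s hs => ?_).trans_eq ?_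
  · rw [Set.uIoc_of_le huvR] at hs
    exact hη _ (NNReal.le_toNNReal_of_coe_le hs.1.le) (Real.toNNReal_le_iff_le_coe.mpr hs.2)
  · rw [abs_of_nonneg (sub_nonneg.mpr huvR), mul_comm]

/-- The solution of the equation and the unitary increment agree to first order, weakly. -/
lemma exists_norm_map_step_le (hX : IsFreeBrownianMotion ι E σ X)
    (hE : IsConditionedMeasure ι E) {C : ℝ} (hC0 : 0 ≤ C)
    (hC : ∀ u v : ℝ≥0, u ≤ v → ‖X v - X u‖ ≤ C * √((v : ℝ) - u))
    (hU : IsEvolution ι E σ X U) {x y : A} (hx : x ∈ algOver ι (Set.range X))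
    (hy : y ∈ algOver ι (Set.range X)) {Ub : ℝ} (hUb0 : 0 ≤ Ub) :
    ∃ c₁ c₂ : ℝ, 0 ≤ c₁ ∧ 0 ≤ c₂ ∧ ∀ u v : ℝ≥0, u ≤ v → √((v : ℝ) - u) ≤ 1 → ‖U u‖ ≤ Ub →
      ∀ η : ℝ, (∀ r, u ≤ r → r ≤ v → ‖U r - U u‖ ≤ η) → ∀ w ∈ pastAlg ι X u, ‖w‖ ≤ 1 →
      ‖E (x * w * (star (expI (X v - X u)) * U v - U u) * y)‖ ≤
        ((v : ℝ) - u) * (c₁ * η + c₂ * √((v : ℝ) - u)) := by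
  obtain ⟨K, hK0, hK⟩ := exists_nearOuter hX.zero hC0 hC hx zero_le_one
  obtain ⟨L, hL0, hL⟩ := exists_nearOuter hX.zero hC0 hC hy zero_le_one
  set κ : A := ι ((1 / 2 : ℂ) • σ 1) with hκ
  set Kz := K * (1 + C) + (‖x‖ + K) * C with hKz
  set zb := ‖x‖ * (1 + C) with hzb
  set M := Real.exp C with hM
  have hKz0 : 0 ≤ Kz := by positivity
  have hzb0 : 0 ≤ zb := by positivity
  refine ⟨‖x‖ * (C ^ 2 * M) * ‖y‖ + C * (Kz * ‖y‖ + (zb + Kz * 1) * L) + zb * ‖κ‖ * ‖y‖,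
    ‖x‖ * (C ^ 2 * M) * (C * M * Ub) * ‖y‖ +
      (1 / 2 * C ^ 2 + ‖κ‖) * (Kz * (Ub * ‖y‖) + (zb + Kz * 1) * (Ub * L)) +
      zb * (C ^ 3 * M * Ub) * ‖y‖, by positivity, by positivity, ?_⟩
  intro u v huv hr1 hUu η hη w hw hw1
  have huvR : (u : ℝ) ≤ v := NNReal.coe_le_coe.mpr huv
  have hη0 : 0 ≤ η := (norm_nonneg _).trans (hη u le_rfl huv)
  set r := √((v : ℝ) - u) with hr
  have hr0 : 0 ≤ r := Real.sqrt_nonneg _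
  have hr2 : (v : ℝ) - u = r ^ 2 := (Real.sq_sqrt (sub_nonneg.mpr huvR)).symm
  set a := X v - X u with ha
  have hasa : IsSelfAdjoint a := (hX.isSelfAdjoint _).sub (hX.isSelfAdjoint _)
  have han : ‖a‖ ≤ C * r := hC u v huv
  have han1 : ‖a‖ ≤ C := han.trans (mul_le_of_le_one_right hC0 hr1)
  have hexpa : Real.exp ‖a‖ ≤ M := Real.exp_le_exp.mpr han1
  obtain ⟨Ju, hJu, hUu'⟩ := hU.equation u
  obtain ⟨Jv, hJv, hUv'⟩ := hU.equation v
  set Iu := ∫ s in (0 : ℝ)..(u : ℝ), U s.toNNReal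
  set Iv := ∫ s in (0 : ℝ)..(v : ℝ), U s.toNNReal
  set e := star (expI a) with he
  have hee : e * expI a = 1 := Unitary.star_mul_self_of_mem (expI_mem_unitary hasa)
  -- `T` is the one-step error, and `e * U v - U u = e * T`. Below, `G` is the oscillation of the
  -- stochastic integral, `r1` that of the drift integral and `r2` the Taylor remainder; `m` is the
  -- square of the increment compensated by the drift.
  set T := U v - expI a * U u with hT
  set G := Jv - Ju - a * U u with hG
  set r1 := κ * (Iv - Iu - ((v : ℝ) - u) • U u) with hr1'
  set r2 := (expI a - (1 + Complex.I • a - (1 / 2 : ℂ) • (a * a))) * U u with hr2'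
  set m := (1 / 2 : ℂ) • (a * a) - ((v : ℝ) - u) • κ with hm
  have hTe : T = Complex.I • G + m * U u - r1 - r2 := by
    have hd : U v - U u = Complex.I • (Jv - Ju) - κ * (Iv - Iu) := by
      rw [hUu', hUv', smul_sub, mul_sub]
      abel
    have hTd : T = (U v - U u) - (expI a - 1) * U u := by rw [hT]; noncomm_ring
    rw [hTd, hd, hG, hm, hr1', hr2']
    simp only [mul_sub, sub_mul, add_mul, smul_sub, smul_mul_assoc, mul_smul_comm, one_mul]
    abel
  -- `e` is replaced by its linear part. The latter is almost outer for every subinterval `[p, q]`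
  -- of `[u, v]`, as removing one increment shows, and this is required by the stochastic integral
  -- estimate. The discarded quadratic part meets `T`, which is itself small.
  set z := x * w * (1 - Complex.I • a) with hz
  have hmain : x * w * (e * U v - U u) * y = x * w * (e - (1 - Complex.I • a)) * T * y +
      (Complex.I • (z * G * y) + z * m * (U u * y) - z * (r1 + r2) * y) := by
    have h1 : e * U v - U u = e * T := by
      rw [hT, mul_sub, ← mul_assoc, hee, one_mul]
    have h2 : z * T * y =
        Complex.I • (z * G * y) + z * m * (U u * y) - z * (r1 + r2) * y := by
      rw [hTe]
      simp only [mul_sub, mul_add, sub_mul, add_mul, mul_smul_comm, smul_mul_assoc, mul_assoc]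
      abel
    rw [h1, ← h2, hz]
    noncomm_ring
  have hxw : ‖x * w‖ ≤ ‖x‖ := (norm_mul_le _ _).trans (mul_le_of_le_one_right (norm_nonneg _) hw1)
  have hlin : ‖1 - Complex.I • a‖ ≤ 1 + C := by
    refine (norm_sub_le _ _).trans (add_le_add (norm_one_le_one A) ?_)
    rwa [norm_smul, Complex.norm_I, one_mul]
  have hzn : ‖z‖ ≤ zb := (norm_mul_le _ _).trans (by rw [hzb]; gcongr)
  have hnear : ∀ p q, u ≤ p → p ≤ q → q ≤ v → √((q : ℝ) - p) ≤ 1 := fun p q hup hpq hqv => by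
    refine le_trans (Real.sqrt_le_sqrt ?_) hr1
    have := NNReal.coe_le_coe.mpr hup
    have := NNReal.coe_le_coe.mpr hqv
    linarith
  have hyn : ∀ p q, u ≤ p → p ≤ q → q ≤ v → NearOuter ι X L p q y := fun p q hup hpq hqv =>
    hL p q hpq (hnear p q hup hpq hqv)
  have hzN : ∀ p q, u ≤ p → p ≤ q → q ≤ v → NearOuter ι X Kz p q z := fun p q hup hpq hqv => by
    have h1 : NearOuter ι X K p q (x * w) :=
      ((hK p q hpq (hnear p q hup hpq hqv)).mul_mem_right
        (pastAlg_le_outerAlg hup q hw)).mono (mul_le_of_le_one_left hK0 hw1)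
    have h2 : NearOuter ι X C p q (1 - Complex.I • a) := by
      refine ⟨1 - Complex.I • ((X p - X u) + (X v - X q)), sub_mem (one_mem _)
        ((outerAlg ι X p q).smul_mem (add_mem (sub_mem_incrClosure hup (Or.inl le_rfl))
          (sub_mem_incrClosure hqv (Or.inr le_rfl))) _), ?_⟩
      rw [sub_sub_sub_cancel_left, ← smul_sub, norm_smul, Complex.norm_I, one_mul, ha,
        ← norm_neg, show -(X p - X u + (X v - X q) - (X v - X u)) = X q - X p by abel]
      exact hC p q hpq
    refine (h1.mul h2 hK0 (hnear p q hup hpq hqv)).mono ?_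
    rw [hKz, mul_one]
    gcongr
  have hTn : ‖T‖ ≤ η + C * M * Ub * r := by
    rw [show T = (U v - U u) - (expI a - 1) * U u by rw [hT]; noncomm_ring]
    calc _ ≤ ‖U v - U u‖ + ‖expI a - 1‖ * ‖U u‖ :=
          (norm_sub_le _ _).trans (add_le_add_right (norm_mul_le _ _) _)
      _ ≤ η + (C * r * M) * Ub := by
          gcongr
          · exact hη v huv le_rfl
          · exact (norm_expI_sub_one_le a).trans (by gcongr)
      _ = _ := by ring
  have hen : ‖e - (1 - Complex.I • a)‖ ≤ C ^ 2 * M * r ^ 2 := by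
    have h := norm_expI_sub_linear_le (-a)
    rw [norm_neg, smul_neg, ← sub_eq_add_neg, ← star_expI hasa] at h
    calc _ ≤ _ := h
      _ ≤ (C * r) ^ 2 * M := by gcongr
      _ = _ := by ring
  have hr1n : ‖r1‖ ≤ ‖κ‖ * (r ^ 2 * η) := by
    refine (norm_mul_le _ _).trans ?_
    rw [← hr2]
    gcongr
    exact norm_integral_sub_le hU.continuous huv hη
  have hr2n : ‖r2‖ ≤ (C * r) ^ 3 * M * Ub := by
    refine (norm_mul_le _ _).trans ?_
    gcongr
    exact (norm_expI_sub_quadratic_le a).trans (by gcongr)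
  have hmn : ‖m‖ ≤ (1 / 2 * C ^ 2 + ‖κ‖) * r ^ 2 := by
    rw [hm]
    calc _ ≤ ‖(1 / 2 : ℂ)‖ * (‖a‖ * ‖a‖) + ‖(v : ℝ) - u‖ * ‖κ‖ := by
          refine (norm_sub_le _ _).trans ?_
          rw [norm_smul, norm_smul]
          gcongr
          exact norm_mul_le _ _
      _ ≤ 1 / 2 * ((C * r) * (C * r)) + r ^ 2 * ‖κ‖ := by
          rw [hr2, Real.norm_of_nonneg (by positivity)]
          gcongr
          norm_num
      _ = _ := by ring
  have hai : a ∈ innerAlg ι X u v := sub_mem_incrClosure huv ⟨le_rfl, le_rfl⟩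
  have hmi : m ∈ innerAlg ι X u v := by
    refine sub_mem ((innerAlg ι X u v).smul_mem (mul_mem hai hai) _) ?_
    rw [← Complex.coe_smul]
    exact (innerAlg ι X u v).smul_mem (coe_mem_incrClosure _ _) _
  -- Here the drift coefficient `σ(1) / 2` enters: it is half the variance rate of the increment.
  have hm0 : E m = 0 := by
    rw [hm, ← Complex.coe_smul, map_sub, map_smul, map_smul, hX.map_sub_mul_self huv, hκ,
      hE.map_coe, ← Complex.coe_smul, smul_comm, sub_self]
  have hUy : NearOuter ι X (Ub * L) u v (U u * y) :=
    ((hyn u v le_rfl huv le_rfl).mem_mul_left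
      (pastAlg_le_outerAlg le_rfl v (hU.mem_pastAlg hX u))).mono (by gcongr)
  have hUyn : ‖U u * y‖ ≤ Ub * ‖y‖ := (norm_mul_le _ _).trans (by gcongr)
  have b1 : ‖E (x * w * (e - (1 - Complex.I • a)) * T * y)‖ ≤
      ‖x‖ * (C ^ 2 * M * r ^ 2) * (η + C * M * Ub * r) * ‖y‖ := by
    refine (hE.norm_map_le _).trans ((norm_mul_le _ _).trans ?_)
    gcongr
    refine (norm_mul_le _ _).trans ?_
    gcongr
    refine (norm_mul_le _ _).trans ?_
    gcongr
  have b2 : ‖E (z * G * y)‖ ≤ r ^ 2 * (C * η * (Kz * ‖y‖ + (zb + Kz * 1) * L)) := by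
    refine (norm_map_stochIntegral_sub_le hX hE hC0 hC (hU.mem_pastAlg hX) huv hKz0 hL0 hr1 hzN hyn
      hη hJu hJv).trans ?_
    rw [hr2]
    gcongr
  have b3 : ‖E (z * m * (U u * y))‖ ≤ (1 / 2 * C ^ 2 + ‖κ‖) * r ^ 2 * r *
      (Kz * (Ub * ‖y‖) + (zb + Kz * 1) * (Ub * L)) := by
    refine (hX.norm_map_near_le hE (hzN u v le_rfl huv le_rfl) hUy hKz0 hr1 hmi hm0).trans ?_
    gcongr
  have b4 : ‖E (z * (r1 + r2) * y)‖ ≤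
      zb * (‖κ‖ * (r ^ 2 * η) + (C * r) ^ 3 * M * Ub) * ‖y‖ := by
    refine (hE.norm_map_mul_mul_le _ _ _).trans ?_
    gcongr
    exact (norm_add_le _ _).trans (add_le_add hr1n hr2n)
  rw [hmain, map_add, map_sub, map_add, map_smul]
  calc _ ≤ ‖E (x * w * (e - (1 - Complex.I • a)) * T * y)‖ + (‖E (z * G * y)‖ +
        ‖E (z * m * (U u * y))‖ + ‖E (z * (r1 + r2) * y)‖) := by
        refine (norm_add_le _ _).trans (add_le_add_right ((norm_sub_le _ _).trans
          (add_le_add_left ((norm_add_le _ _).trans_eq ?_) _)) _)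
        rw [norm_smul, Complex.norm_I, one_mul]
    _ ≤ _ := add_le_add b1 (add_le_add (add_le_add b2 b3) b4)
    _ = _ := by rw [hr2]; ring

end Equation

/-! ### Weak and strong convergence -/

section Convergence

open Filter Topology

variable {ι : D →⋆ₐ[ℂ] A} {E : A →ₗ[ℂ] D}

/-- Convergence of the moments `𝔼[x (·) y]`. -/
def WeakTendsto (E : A →ₗ[ℂ] D) (u : ℕ → A) (a : A) : Prop :=
  ∀ x y, Tendsto (fun n => E (x * u n * y)) atTop (𝓝 (E (x * a * y)))

lemma WeakTendsto.star (hE : IsConditionedMeasure ι E) {u : ℕ → A} {a : A}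
    (h : WeakTendsto E u a) : WeakTendsto E (fun n => star (u n)) (star a) := fun x y => by
  have e : ∀ b : A, E (x * Star.star b * y) = Star.star (E (Star.star y * b * Star.star x)) :=
    fun b => by rw [← hE.map_star]; simp [mul_assoc]
  simp only [e]
  exact (continuous_star.tendsto _).comp (h _ _)

/-- A three-epsilon argument based on the uniform bound. It reduces weak limits to polynomial test
elements, the ones for which the near-independence estimates hold. -/
lemma tendsto_map_of_dense (hE : IsConditionedMeasure ι E) {S : Set A} (hS : Dense S)
    {u : ℕ → A} {B : ℝ} (hB : ∀ n, ‖u n‖ ≤ B)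
    (h : ∀ x ∈ S, ∀ y ∈ S, Tendsto (fun n => E (x * u n * y)) atTop (𝓝 0)) (x y : A) :
    Tendsto (fun n => E (x * u n * y)) atTop (𝓝 0) := by
  have hB0 : 0 ≤ B := (norm_nonneg _).trans (hB 0)
  rw [Metric.tendsto_atTop]
  intro ε hε
  have approx : ∀ z : A, ∀ η > 0, ∃ z' ∈ S, ‖z - z'‖ < η := fun z η hη => by
    obtain ⟨z', hz, hz'⟩ := Metric.dense_iff.mp hS z η hη
    exact ⟨z', hz', by rwa [Metric.mem_ball, dist_comm, dist_eq_norm] at hz⟩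
  obtain ⟨x', hx', hxx⟩ := approx x (ε / (3 * (B * ‖y‖ + 1))) (by positivity)
  obtain ⟨y', hy', hyy⟩ := approx y (ε / (3 * (B * ‖x'‖ + 1))) (by positivity)
  obtain ⟨N, hN⟩ := Metric.tendsto_atTop.mp (h x' hx' y' hy') (ε / 3) (by positivity)
  refine ⟨N, fun n hn => ?_⟩
  have h1 := hN n hn
  rw [dist_zero_right] at h1 ⊢
  rw [show x * u n * y = (x - x') * u n * y + x' * u n * (y - y') + x' * u n * y' by noncomm_ring,
    map_add, map_add]
  have h2 : ‖E ((x - x') * u n * y)‖ ≤ ε / 3 := by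
    refine (hE.norm_map_mul_mul_le _ _ _).trans ?_
    rw [lt_div_iff₀ (by positivity)] at hxx
    calc ‖x - x'‖ * ‖u n‖ * ‖y‖ ≤ ‖x - x'‖ * B * ‖y‖ := by gcongr; exact hB n
      _ ≤ _ := by nlinarith [norm_nonneg (x - x')]
  have h3 : ‖E (x' * u n * (y - y'))‖ ≤ ε / 3 := by
    refine (hE.norm_map_mul_mul_le _ _ _).trans ?_
    rw [lt_div_iff₀ (by positivity)] at hyy
    calc ‖x'‖ * ‖u n‖ * ‖y - y'‖ ≤ ‖x'‖ * B * ‖y - y'‖ := by gcongr; exact hB n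
      _ ≤ _ := by nlinarith [norm_nonneg (y - y')]
  calc _ ≤ ‖E ((x - x') * u n * y)‖ + ‖E (x' * u n * (y - y'))‖ + ‖E (x' * u n * y')‖ :=
        norm_add₃_le
    _ < ε := by linarith

lemma weakTendsto_iff {u : ℕ → A} {a : A} :
    WeakTendsto E u a ↔ ∀ x y, Tendsto (fun n => E (x * (u n - a) * y)) atTop (𝓝 0) := by
  refine forall₂_congr fun x y => ?_
  simp only [mul_sub, sub_mul, map_sub]
  exact tendsto_sub_nhds_zero_iff.symm

lemma WeakTendsto.unique (hE' : IsNondegenerate E) {u : ℕ → A} {a b : A} (ha : WeakTendsto E u a)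
    (hb : WeakTendsto E u b) : a = b := by
  refine sub_eq_zero.mp (hE' _ fun x y => ?_)
  rw [mul_sub, sub_mul, map_sub, tendsto_nhds_unique (ha x y) (hb x y), sub_self]

/-- Bounded convergence of a sequence and of its adjoints in the seminorms `‖(·) y‖`. -/
structure StrongTendsto (E : A →ₗ[ℂ] D) (u : ℕ → A) (a : A) : Prop where
  bounded : ∃ B, ∀ n, ‖u n‖ ≤ B
  left : ∀ y, Tendsto (fun n => condNorm E ((u n - a) * y)) atTop (𝓝 0)
  right : ∀ y, Tendsto (fun n => condNorm E (star (u n - a) * y)) atTop (𝓝 0)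

namespace StrongTendsto

variable {u v : ℕ → A} {a b : A}

lemma const (a : A) : StrongTendsto E (fun _ => a) a where
  bounded := ⟨‖a‖, fun _ => le_rfl⟩
  left y := by simp [condNorm]
  right y := by simp [condNorm]

lemma weakTendsto (hE : IsConditionedMeasure ι E) (h : StrongTendsto E u a) :
    WeakTendsto E u a := by
  refine weakTendsto_iff.mpr fun x y => squeeze_zero_norm (fun n => ?_)
    (by simpa using (h.left y).const_mul (condNorm E (star x)))
  rw [mul_assoc]
  exact hE.norm_map_mul_le _ _

lemma star (h : StrongTendsto E u a) :
    StrongTendsto E (fun n => star (u n)) (star a) where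
  bounded := by simpa using h.bounded
  left y := by simpa using h.right y
  right y := by simpa using h.left y

lemma add (hE : IsConditionedMeasure ι E) (hu : StrongTendsto E u a) (hv : StrongTendsto E v b) :
    StrongTendsto E (fun n => u n + v n) (a + b) where
  bounded := by
    obtain ⟨B, hB⟩ := hu.bounded
    obtain ⟨B', hB'⟩ := hv.bounded
    exact ⟨B + B', fun n => (norm_add_le _ _).trans (add_le_add (hB n) (hB' n))⟩
  left y := by
    refine squeeze_zero (fun n => condNorm_nonneg _) (fun n => ?_)
      (by simpa using (hu.left y).add (hv.left y))
    rw [add_sub_add_comm, add_mul]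
    exact hE.condNorm_add_le _ _
  right y := by
    have h := (hu.right y).add (hv.right y)
    rw [add_zero] at h
    refine squeeze_zero (fun n => condNorm_nonneg _) (fun n => ?_) h
    rw [add_sub_add_comm, star_add, add_mul]
    exact hE.condNorm_add_le _ _

/-- In `u v - a b = u (v - b) + (u - a) b` the bounded factor `u` acts from the left, and `b` joins
the test element. The adjoint is treated in the same way, with `v` as the bounded factor. -/
lemma mul (hE : IsConditionedMeasure ι E) (hu : StrongTendsto E u a) (hv : StrongTendsto E v b) :
    StrongTendsto E (fun n => u n * v n) (a * b) := by
  obtain ⟨B, hB⟩ := hu.bounded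
  obtain ⟨B', hB'⟩ := hv.bounded
  have hB0 : 0 ≤ B := (norm_nonneg _).trans (hB 0)
  have hB0' : 0 ≤ B' := (norm_nonneg _).trans (hB' 0)
  refine ⟨⟨B * B', fun n => (norm_mul_le _ _).trans ?_⟩, fun y => ?_, fun y => ?_⟩
  · have := hB n
    have := hB' n
    gcongr
  · refine squeeze_zero (fun n => condNorm_nonneg _) (fun n => ?_)
      (by simpa using ((hv.left y).const_mul B).add (hu.left (b * y)))
    rw [show (u n * v n - a * b) * y = u n * ((v n - b) * y) + (u n - a) * (b * y) by
      noncomm_ring]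
    refine (hE.condNorm_add_le _ _).trans (add_le_add_left ((hE.condNorm_mul_le _ _).trans ?_) _)
    exact mul_le_mul_of_nonneg_right (hB n) (condNorm_nonneg _)
  · have h := ((hu.right y).const_mul B').add (hv.right (Star.star a * y))
    rw [mul_zero, add_zero] at h
    refine squeeze_zero (fun n => condNorm_nonneg _) (fun n => ?_) h
    rw [show Star.star (u n * v n - a * b) * y =
      Star.star (v n) * (Star.star (u n - a) * y) + Star.star (v n - b) * (Star.star a * y) by
        simp only [star_sub, star_mul]; noncomm_ring]
    refine (hE.condNorm_add_le _ _).trans (add_le_add_left ((hE.condNorm_mul_le _ _).trans ?_) _)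
    rw [norm_star]
    exact mul_le_mul_of_nonneg_right (hB' n) (condNorm_nonneg _)

/-- Weak convergence of unitaries to a unitary is strong. -/
lemma of_unitary (hE : IsConditionedMeasure ι E) (hu : ∀ n, u n ∈ unitary A) (ha : a ∈ unitary A)
    (h : WeakTendsto E u a) : StrongTendsto E u a := by
  have key : ∀ {u : ℕ → A} {a : A}, (∀ n, u n ∈ unitary A) → a ∈ unitary A →
      WeakTendsto E u a → ∀ y, Tendsto (fun n => condNorm E ((u n - a) * y)) atTop (𝓝 0) := by
    intro u a hu ha h y
    -- For unitaries the quadratic terms of `|(u - a) y|²` are constant and equal to `y* y`, so only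
    -- the cross terms, which converge weakly, are left.
    have e : ∀ n, condNorm E ((u n - a) * y) =
        √‖(E (Star.star y * y) - E (Star.star y * Star.star (u n) * (a * y))) +
          (E (Star.star y * y) - E (Star.star y * Star.star a * u n * y))‖ := fun n => by
      rw [condNorm, ← map_sub, ← map_sub, ← map_add]
      congr 3
      have h1 := Unitary.star_mul_self_of_mem (hu n)
      have h2 := Unitary.star_mul_self_of_mem ha
      calc _ = Star.star y * (Star.star (u n) * u n) * y +
            Star.star y * (Star.star a * a) * y - Star.star y * Star.star (u n) * (a * y) -
            Star.star y * Star.star a * u n * y := by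
              simp only [star_mul, star_sub]; noncomm_ring
        _ = _ := by rw [h1, h2, mul_one]; abel
    simp only [e]
    have h1 := h.star hE (Star.star y) (a * y)
    have h2 := h (Star.star y * Star.star a) y
    have ha1 : Star.star y * Star.star a * (a * y) = Star.star y * y := by
      rw [show Star.star y * Star.star a * (a * y) = Star.star y * (Star.star a * a) * y by
        noncomm_ring, Unitary.star_mul_self_of_mem ha, mul_one]
    have ha2 : Star.star y * Star.star a * a * y = Star.star y * y := by
      rw [← ha1]; noncomm_ring
    rw [ha1] at h1
    rw [ha2] at h2
    have h3 := ((tendsto_const_nhds (x := E (Star.star y * y))).sub h1).add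
      ((tendsto_const_nhds (x := E (Star.star y * y))).sub h2)
    have h4 := (Real.continuous_sqrt.tendsto _).comp h3.norm
    simp only [sub_self, add_zero, norm_zero, Real.sqrt_zero] at h4
    exact h4
  exact ⟨⟨1, fun n => norm_le_one_of_mem_unitary (hu n)⟩, key hu ha h, fun y => by
    simpa using key (fun n => Unitary.star_mem (hu n)) (Unitary.star_mem ha) (h.star hE) y⟩

end StrongTendsto

end Convergence

/-! ### Convergence of the products of unitary increments -/

section Limits

open Filter Topology

variable {ι : D →⋆ₐ[ℂ] A} {E : A →ₗ[ℂ] D} {σ : D →CP D} {X U : ℝ≥0 → A}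

/-- The product of unitary increments over the `n`-th dyadic partition of `[s, t]`. -/
def dyadicEvol (X : ℝ≥0 → A) (s t : ℝ≥0) (n : ℕ) : A := evol X s ((t - s) / 2 ^ n) (2 ^ n)

lemma dyadicEvol_mem_unitary (hX : IsFreeBrownianMotion ι E σ X) (s t : ℝ≥0) (n : ℕ) :
    dyadicEvol X s t n ∈ unitary A :=
  evol_mem_unitary hX _ _ _

/-- There are `2 ^ n` intervals, each contributing `O((2 ^ (-n)) ^ (3/2))`, so the total is `O(2 ^
(-n/2))`. -/
lemma exists_norm_map_dyadicEvol_succ_le (hX : IsFreeBrownianMotion ι E σ X)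
    (hE : IsConditionedMeasure ι E) {C : ℝ} (hC0 : 0 ≤ C)
    (hC : ∀ u v : ℝ≥0, u ≤ v → ‖X v - X u‖ ≤ C * √((v : ℝ) - u)) (s t : ℝ≥0) {x y : A}
    (hx : x ∈ algOver ι (Set.range X)) (hy : y ∈ algOver ι (Set.range X)) :
    ∃ K : ℝ, 0 ≤ K ∧ ∀ n, ‖E (x * (dyadicEvol X s t n * star (dyadicEvol X s t (n + 1)) - 1) * y)‖ ≤
      K * (√(1 / 2)) ^ n := by
  set l : ℝ≥0 := t - s with hl
  obtain ⟨K, hK0, hK⟩ := exists_norm_map_evol_half_le hX hE hC0 hC hx hy (Real.sqrt_nonneg (l : ℝ))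
  refine ⟨K * √(l : ℝ) ^ 3, by positivity, fun n => ?_⟩
  set q := √(1 / 2 : ℝ) with hq
  have hq2 : q ^ 2 = 1 / 2 := Real.sq_sqrt (by norm_num)
  have hq0 : 0 ≤ q := Real.sqrt_nonneg _
  have hsq : √(((l / 2 ^ n : ℝ≥0)) : ℝ) = √(l : ℝ) * q ^ n := by
    rw [show √(l : ℝ) * q ^ n = √((√(l : ℝ) * q ^ n) ^ 2) by rw [Real.sqrt_sq (by positivity)]]
    congr 1
    rw [mul_pow, Real.sq_sqrt l.coe_nonneg, ← pow_mul, mul_comm n 2, pow_mul, hq2]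
    push_cast
    rw [one_div, inv_pow, div_eq_mul_inv]
  have h := hK (l / 2 ^ n) (by
    refine Real.sqrt_le_sqrt ?_
    push_cast
    exact div_le_self l.2 (one_le_pow₀ (by norm_num))) (2 ^ n) s
  rw [hsq, div_div, ← pow_succ, ← pow_succ'] at h
  refine h.trans_eq ?_
  have e : (2 : ℝ) ^ n * (q ^ n) ^ 2 = 1 := by
    rw [← pow_mul, mul_comm n 2, pow_mul, hq2, ← mul_pow]; norm_num
  push_cast
  calc _ = K * √(l : ℝ) ^ 3 * q ^ n * ((2 : ℝ) ^ n * (q ^ n) ^ 2) := by ring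
    _ = _ := by rw [e, mul_one]

/-- The adjoints of the products of unitary increments form Cauchy sequences. -/
lemma exists_condNorm_star_dyadicEvol_le (hX : IsFreeBrownianMotion ι E σ X)
    (hE : IsConditionedMeasure ι E) {C : ℝ} (hC0 : 0 ≤ C)
    (hC : ∀ u v : ℝ≥0, u ≤ v → ‖X v - X u‖ ≤ C * √((v : ℝ) - u)) (s t : ℝ≥0) {y : A}
    (hy : y ∈ algOver ι (Set.range X)) {ε : ℝ} (hε : 0 < ε) :
    ∃ N, ∀ n ≥ N, ∀ m ≥ n,
      condNorm E (star (dyadicEvol X s t n - dyadicEvol X s t m) * y) ≤ ε := by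
  set W := dyadicEvol X s t with hW
  have hWu : ∀ n, W n ∈ unitary A := dyadicEvol_mem_unitary hX s t
  obtain ⟨K, hK0, hK⟩ := exists_norm_map_dyadicEvol_succ_le hX hE hC0 hC s t (star_mem hy) hy
  set q := √(1 / 2 : ℝ) with hq
  have hq0 : 0 ≤ q := Real.sqrt_nonneg _
  have hq1 : q < 1 := by
    rw [hq, Real.sqrt_lt' one_pos]; norm_num
  -- The weak estimate bounds the square of the seminorm by a multiple of `q ^ n`; the seminorm
  -- itself therefore decays like `√q ^ n`.
  set ρ := √q with hρ
  have hρ0 : 0 ≤ ρ := Real.sqrt_nonneg _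
  have hρ1 : ρ < 1 := by
    rw [hρ, Real.sqrt_lt' one_pos]; simpa using hq1
  have hstep : ∀ n, condNorm E (star (W n - W (n + 1)) * y) ≤ √(2 * K) * ρ ^ n := fun n => by
    refine abs_le_of_sq_le_sq' ?_ (by positivity) |>.2
    rw [condNorm_sq, mul_pow, Real.sq_sqrt (by positivity), ← pow_mul, mul_comm n 2, pow_mul,
      Real.sq_sqrt hq0]
    have h1 := Unitary.mul_star_self_of_mem (hWu n)
    have h2 := Unitary.mul_star_self_of_mem (hWu (n + 1))
    set z := star y * (W n * star (W (n + 1)) - 1) * y with hz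
    -- By unitarity the square is linear in the weak differences already estimated.
    have e : star (star (W n - W (n + 1)) * y) * (star (W n - W (n + 1)) * y) = -z - star z := by
      calc _ = star y * (W n * star (W n)) * y + star y * (W (n + 1) * star (W (n + 1))) * y -
            star y * (W n * star (W (n + 1))) * y - star y * (W (n + 1) * star (W n)) * y := by
              simp only [star_mul, star_sub, star_star]; noncomm_ring
        _ = _ := by
              rw [h1, h2, hz]
              simp only [star_mul, star_sub, star_star, star_one]; noncomm_ring
    rw [e, map_sub, map_neg, hE.map_star]
    refine (norm_sub_le _ _).trans ?_
    rw [norm_neg, norm_star]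
    linarith [hK n]
  set K' := √(2 * K) / (1 - ρ) with hK'
  have h1ρ : 0 < 1 - ρ := by linarith
  have hchain : ∀ n k, condNorm E (star (W n - W (n + k)) * y) ≤ K' * ρ ^ n - K' * ρ ^ (n + k) := by
    intro n k
    induction k with
    | zero => simp [condNorm]
    | succ k ih =>
      have e : star (W n - W (n + (k + 1))) * y =
          star (W n - W (n + k)) * y + star (W (n + k) - W (n + k + 1)) * y := by
        rw [← add_mul, ← star_add, sub_add_sub_cancel, add_assoc]
      rw [e]
      refine (hE.condNorm_add_le _ _).trans ((add_le_add ih (hstep _)).trans_eq ?_)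
      have : √(2 * K) = K' * (1 - ρ) := by rw [hK', div_mul_cancel₀ _ h1ρ.ne']
      rw [this, ← add_assoc, pow_succ]
      ring
  have hlim : Tendsto (fun n => K' * ρ ^ n) atTop (𝓝 0) := by
    simpa using (tendsto_pow_atTop_nhds_zero_of_lt_one hρ0 hρ1).const_mul K'
  obtain ⟨N, hN⟩ := eventually_atTop.mp (hlim.eventually_le_const hε)
  refine ⟨N, fun n hn m hm => ?_⟩
  obtain ⟨k, rfl⟩ := Nat.exists_eq_add_of_le hm
  have hK0' : 0 ≤ K' := by positivity
  have := hchain n k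
  have := hN n hn
  have : 0 ≤ K' * ρ ^ (n + k) := by positivity
  linarith

lemma dense_algOver (hA : (algOver ι (Set.range X)).topologicalClosure = ⊤) :
    Dense (algOver ι (Set.range X) : Set A) := by
  rw [dense_iff_closure_eq, ← StarSubalgebra.topologicalClosure_coe, hA]
  rfl

/-- The unitary increments compensate the solution of the equation, weakly. -/
lemma tendsto_map_star_dyadicEvol (hX : IsFreeBrownianMotion ι E σ X)
    (hE : IsConditionedMeasure ι E) (hA : (algOver ι (Set.range X)).topologicalClosure = ⊤)
    {C : ℝ} (hC0 : 0 ≤ C) (hC : ∀ u v : ℝ≥0, u ≤ v → ‖X v - X u‖ ≤ C * √((v : ℝ) - u))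
    (hU : IsEvolution ι E σ X U) {s t : ℝ≥0} (hst : s ≤ t) (x y : A) :
    Tendsto (fun n => E (x * (star (dyadicEvol X s t n) * U t - U s) * y)) atTop (𝓝 0) := by
  have hbd : ∀ n, ‖star (dyadicEvol X s t n) * U t - U s‖ ≤ ‖U t‖ + ‖U s‖ := fun n => by
    refine (norm_sub_le _ _).trans (add_le_add_left ((norm_mul_le _ _).trans ?_) _)
    rw [norm_star]
    exact mul_le_of_le_one_left (norm_nonneg _)
      (norm_le_one_of_mem_unitary (dyadicEvol_mem_unitary hX s t n))
  refine tendsto_map_of_dense hE (dense_algOver hA) hbd (fun x hx y hy => ?_) x y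
  obtain ⟨Ub, hUb⟩ := isCompact_Icc.exists_bound_of_continuousOn
    (hU.continuous.continuousOn (s := Set.Icc s t))
  have hUb0 : 0 ≤ Ub := (norm_nonneg _).trans (hUb s ⟨le_rfl, hst⟩)
  obtain ⟨c₁, c₂, hc₁, hc₂, hstep⟩ := exists_norm_map_step_le hX hE hC0 hC hU hx hy hUb0
  have huc := isCompact_Icc.uniformContinuousOn_of_continuous
    (hU.continuous.continuousOn (s := Set.Icc s t))
  rw [Metric.uniformContinuousOn_iff] at huc
  set l : ℝ≥0 := t - s with hl
  rw [Metric.tendsto_atTop]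
  intro ε hε
  -- Chosen so that the oscillation of `U` contributes at most `ε / 2` over the whole interval. The
  -- `+ 1` prevents division by zero.
  set η := ε / (2 * ((l : ℝ) * c₁ + 1)) with hη
  have hη0 : 0 < η := by positivity
  obtain ⟨δ, hδ, hδU⟩ := huc η hη0
  have hh0 : Tendsto (fun n : ℕ => (((l / 2 ^ n : ℝ≥0)) : ℝ)) atTop (𝓝 0) := by
    have := (tendsto_pow_atTop_nhds_zero_of_lt_one (by norm_num : (0 : ℝ) ≤ 1 / 2)
      (by norm_num)).const_mul (l : ℝ)
    simpa [div_eq_mul_inv] using this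
  have hsq0 : Tendsto (fun n : ℕ => √(((l / 2 ^ n : ℝ≥0)) : ℝ)) atTop (𝓝 0) := by
    have h0 := (Real.continuous_sqrt.tendsto _).comp hh0
    rw [Real.sqrt_zero] at h0
    exact h0
  have hsmall : Tendsto (fun n : ℕ => (l : ℝ) * c₂ * √(((l / 2 ^ n : ℝ≥0)) : ℝ)) atTop (𝓝 0) := by
    simpa using hsq0.const_mul ((l : ℝ) * c₂)
  obtain ⟨N, hN⟩ := eventually_atTop.mp ((hh0.eventually_lt_const hδ).and
    ((hsq0.eventually_le_const one_pos).and (hsmall.eventually_lt_const (half_pos hε))))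
  refine ⟨N, fun n hn => ?_⟩
  obtain ⟨hn1, hn2, hn3⟩ := hN n hn
  rw [dist_zero_right]
  set h : ℝ≥0 := l / 2 ^ n with hh
  have htot : ((2 ^ n : ℕ) : ℝ≥0) * h = l := by
    rw [hh]; push_cast; exact mul_div_cancel₀ _ (by positivity)
  -- Telescoping over the partition. The adjoint of the product of the earlier factors is a
  -- contraction in the past algebra, as `exists_norm_map_step_le` requires of `w`.
  have htel : ∀ k ≤ 2 ^ n, ‖E (x * (star (evol X s h k) * U (s + k * h) - U s) * y)‖ ≤
      k * ((h : ℝ) * (c₁ * η + c₂ * √(h : ℝ))) := by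
    intro k
    induction k with
    | zero => intro _; simp [evol]
    | succ k ih =>
      intro hk
      have hkh : s + k * h ≤ s + (k + 1 : ℕ) * h := by gcongr; simp
      have hkt : s + (k + 1 : ℕ) * h ≤ t := by
        calc s + (k + 1 : ℕ) * h ≤ s + (2 ^ n : ℕ) * h := by gcongr
          _ = t := by rw [htot, hl, add_tsub_cancel_of_le hst]
      have hsub : ((s + (k + 1 : ℕ) * h : ℝ≥0) : ℝ) - (s + k * h : ℝ≥0) = h := by push_cast; ring
      have h1 := hstep (s + k * h) (s + (k + 1 : ℕ) * h) hkh (by rwa [hsub])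
        (hUb _ ⟨le_self_add, hkh.trans hkt⟩) η (fun r hr1 hr2 => ?_) (star (evol X s h k))
        (star_mem (evol_mem_pastAlg _ _ _)) (by rw [norm_star]; exact norm_evol_le hX _ _ _)
      · rw [hsub] at h1
        have e : x * (star (evol X s h (k + 1)) * U (s + (k + 1 : ℕ) * h) - U s) * y =
            x * star (evol X s h k) * (star (expI (X (s + (k + 1 : ℕ) * h) - X (s + k * h))) *
              U (s + (k + 1 : ℕ) * h) - U (s + k * h)) * y +
            x * (star (evol X s h k) * U (s + k * h) - U s) * y := by
          rw [evol, star_mul]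
          noncomm_ring
        rw [e, map_add]
        refine (norm_add_le _ _).trans ((add_le_add h1 (ih (by omega))).trans_eq ?_)
        push_cast
        ring
      · rw [← dist_eq_norm]
        refine (hδU r ⟨le_self_add.trans hr1, hr2.trans hkt⟩ _ ⟨le_self_add, hkh.trans hkt⟩ ?_).le
        rw [NNReal.dist_eq, abs_of_nonneg (sub_nonneg.mpr (NNReal.coe_le_coe.mpr hr1))]
        have := NNReal.coe_le_coe.mpr hr2
        linarith
  have hfin := htel (2 ^ n) le_rfl
  rw [htot, hl, add_tsub_cancel_of_le hst] at hfin
  refine hfin.trans_lt ?_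
  have htotR : ((2 ^ n : ℕ) : ℝ) * h = l := by exact_mod_cast congrArg NNReal.toReal htot
  rw [← mul_assoc, htotR, mul_add, ← mul_assoc, ← mul_assoc]
  have h4 : (l : ℝ) * c₁ * η ≤ ε / 2 := by
    rw [hη, mul_div_assoc', div_le_div_iff₀ (by positivity) two_pos]
    nlinarith [mul_nonneg l.2 hc₁]
  linarith

/-- The products of unitary increments propagate the solution of the equation. -/
lemma tendsto_map_dyadicEvol_mul (hX : IsFreeBrownianMotion ι E σ X)
    (hE : IsConditionedMeasure ι E) (hA : (algOver ι (Set.range X)).topologicalClosure = ⊤)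
    {C : ℝ} (hC0 : 0 ≤ C) (hC : ∀ u v : ℝ≥0, u ≤ v → ‖X v - X u‖ ≤ C * √((v : ℝ) - u))
    (hU : IsEvolution ι E σ X U) {s t : ℝ≥0} (hst : s ≤ t) :
    WeakTendsto E (fun n => dyadicEvol X s t n * U s) (U t) := by
  set W := dyadicEvol X s t with hW
  have hWu : ∀ n, W n ∈ unitary A := dyadicEvol_mem_unitary hX s t
  have hW1 : ∀ n, ‖W n‖ ≤ 1 := fun n => norm_le_one_of_mem_unitary (hWu n)
  have hbd : ∀ n, ‖W n * U s - U t‖ ≤ ‖U s‖ + ‖U t‖ := fun n =>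
    (norm_sub_le _ _).trans (add_le_add_left ((norm_mul_le _ _).trans
      (mul_le_of_le_one_left (norm_nonneg _) (hW1 n))) _)
  have hbd' : ∀ n, ‖star (W n) * U t - U s‖ ≤ ‖U t‖ + ‖U s‖ := fun n => by
    refine (norm_sub_le _ _).trans (add_le_add_left ((norm_mul_le _ _).trans ?_) _)
    rw [norm_star]
    exact mul_le_of_le_one_left (norm_nonneg _) (hW1 n)
  refine weakTendsto_iff.mpr (tendsto_map_of_dense hE (dense_algOver hA) hbd fun x hx y _ => ?_)
  rw [Metric.tendsto_atTop]
  intro ε hε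
  set B := (‖U t‖ + ‖U s‖) * ‖y‖ with hB
  obtain ⟨N, hN⟩ := exists_condNorm_star_dyadicEvol_le hX hE hC0 hC s t (star_mem hx)
    (ε := ε / (2 * (B + 1))) (by positivity)
  obtain ⟨N', hN'⟩ := Metric.tendsto_atTop.mp
    (tendsto_map_star_dyadicEvol hX hE hA hC0 hC hU hst (x * W N) y) (ε / 2) (half_pos hε)
  refine ⟨max N N', fun n hn => ?_⟩
  have h1 := hN N le_rfl n ((le_max_left _ _).trans hn)
  have h2 := hN' n ((le_max_right _ _).trans hn)
  rw [dist_zero_right] at h2 ⊢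
  set d := star (W n) * U t - U s with hd
  -- The difference equals `-x * W n * d * y`. Replacing `W n` by a fixed `W N` costs little by the
  -- Cauchy property of the adjoints, and `d` tends weakly to zero against the fixed element `x * W
  -- N`.
  have e : x * (W n * U s - U t) * y = x * (W N - W n) * (d * y) - x * W N * d * y := by
    have h3 : W n * d = U t - W n * U s := by
      rw [hd, mul_sub, ← mul_assoc, Unitary.mul_star_self_of_mem (hWu n), one_mul]
    rw [show x * (W N - W n) * (d * y) - x * W N * d * y = -(x * (W n * d) * y) by noncomm_ring, h3]
    noncomm_ring
  have h4 : ‖E (x * (W N - W n) * (d * y))‖ ≤ ε / 2 := by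
    refine (hE.norm_map_mul_le _ _).trans ?_
    have h5 : condNorm E (d * y) ≤ B := (hE.condNorm_le _).trans ((norm_mul_le _ _).trans
      (mul_le_mul_of_nonneg_right (hbd' n) (norm_nonneg _)))
    rw [star_mul]
    calc _ ≤ ε / (2 * (B + 1)) * B := by
          gcongr
          exact condNorm_nonneg _
      _ ≤ ε / 2 := by
          rw [div_mul_eq_mul_div, div_le_div_iff₀ (by positivity) two_pos]
          nlinarith
  rw [e, map_sub]
  calc _ ≤ ‖E (x * (W N - W n) * (d * y))‖ + ‖E (x * W N * d * y)‖ := norm_sub_le _ _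
    _ < ε := by linarith

/-- The solution of the equation is unitary. -/
theorem IsEvolution.mem_unitary (hX : IsFreeBrownianMotion ι E σ X)
    (hE : IsConditionedMeasure ι E) (hE' : IsNondegenerate E)
    (hA : (algOver ι (Set.range X)).topologicalClosure = ⊤)
    (hU : IsEvolution ι E σ X U) (t : ℝ≥0) : U t ∈ unitary A := by
  obtain ⟨C, hC0, hC⟩ := hX.exists_norm_sub_le hE hE' hA
  set W := dyadicEvol X 0 t with hW
  have hWu : ∀ n, W n ∈ unitary A := dyadicEvol_mem_unitary hX 0 t
  have hw : WeakTendsto E W (U t) := by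
    simpa [hU.init] using tendsto_map_dyadicEvol_mul hX hE hA hC0 hC hU (zero_le (a := t))
  have hws := hw.star hE
  rw [Unitary.mem_iff]
  constructor
  -- The same sequence has the weak limits `star (U t) * U t` and `U 0 = 1`.
  · have h1 : WeakTendsto E (fun n => star (W n) * U t) (star (U t) * U t) := fun x y => by
      simpa [mul_assoc] using hws x (U t * y)
    have h2 : WeakTendsto E (fun n => star (W n) * U t) 1 := weakTendsto_iff.mpr fun x y => by
      simpa [hU.init] using tendsto_map_star_dyadicEvol hX hE hA hC0 hC hU (zero_le (a := t)) x y
    exact h1.unique hE' h2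
  -- The other relation cannot follow from weak limits alone. The Cauchy property makes `W n * star
  -- (W m)` weakly close to `1` for all `m ≥ n ≥ N`; let first `m` and then `n` tend to infinity.
  · have hzero : ∀ x ∈ algOver ι (Set.range X), ∀ y ∈ algOver ι (Set.range X),
        E (x * (U t * star (U t) - 1) * y) = 0 := by
      intro x hx y hy
      have hle : ∀ ε > 0, ‖E (x * (U t * star (U t) - 1) * y)‖ ≤ ‖x‖ * ε := by
        intro ε hε
        obtain ⟨N, hN⟩ := exists_condNorm_star_dyadicEvol_le hX hE hC0 hC 0 t hy hε
        have h1 : ∀ n ≥ N, ∀ m ≥ n, ‖E (x * W n * star (W m) * y) - E (x * y)‖ ≤ ‖x‖ * ε := by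
          intro n hn m hm
          have e : x * y = x * W n * star (W n) * y := by
            rw [mul_assoc x, Unitary.mul_star_self_of_mem (hWu n), mul_one]
          rw [norm_sub_rev, e, ← map_sub, show x * W n * star (W n) * y - x * W n * star (W m) * y =
            x * W n * (star (W n - W m) * y) by rw [star_sub]; noncomm_ring]
          refine (hE.norm_map_mul_le _ _).trans ?_
          refine mul_le_mul ?_ (hN n hn m hm) (condNorm_nonneg _) (norm_nonneg _)
          refine (hE.condNorm_le _).trans ?_
          rw [norm_star]
          exact (norm_mul_le _ _).trans (mul_le_of_le_one_right (norm_nonneg _)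
            (norm_le_one_of_mem_unitary (hWu n)))
        have h2 : ∀ n ≥ N, ‖E (x * W n * (star (U t) * y)) - E (x * y)‖ ≤ ‖x‖ * ε := by
          intro n hn
          have h3 := ((hws (x * W n) y).sub_const (E (x * y))).norm
          rw [← mul_assoc]
          exact le_of_tendsto h3 (eventually_atTop.mpr ⟨n, fun m hm => h1 n hn m hm⟩)
        have h3 := ((hw x (star (U t) * y)).sub_const (E (x * y))).norm
        have h4 := le_of_tendsto h3 (eventually_atTop.mpr ⟨N, h2⟩)
        rw [← map_sub] at h4
        rw [show x * (U t * star (U t) - 1) * y = x * U t * (star (U t) * y) - x * y by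
          noncomm_ring]
        exact h4
      refine norm_le_zero_iff.mp (le_of_forall_pos_le_add fun ε hε => ?_)
      refine (hle (ε / (‖x‖ + 1)) (by positivity)).trans ?_
      rw [mul_div_assoc', div_le_iff₀ (by positivity)]
      nlinarith [norm_nonneg x]
    refine sub_eq_zero.mp (hE' _ fun x y => ?_)
    refine tendsto_nhds_unique (tendsto_const_nhds (f := (atTop : Filter ℕ))) ?_
    refine tendsto_map_of_dense hE (dense_algOver hA) (u := fun _ : ℕ => U t * star (U t) - 1)
      (fun _ => le_rfl) (fun x hx y hy => ?_) x y
    rw [hzero x hx y hy]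
    exact tendsto_const_nhds

/-- The products of unitary increments converge to the increments of the solution. -/
lemma strongTendsto_dyadicEvol (hX : IsFreeBrownianMotion ι E σ X)
    (hE : IsConditionedMeasure ι E) (hE' : IsNondegenerate E)
    (hA : (algOver ι (Set.range X)).topologicalClosure = ⊤)
    (hU : IsEvolution ι E σ X U) {s t : ℝ≥0} (hst : s ≤ t) :
    StrongTendsto E (dyadicEvol X s t) (U t * star (U s)) := by
  obtain ⟨C, hC0, hC⟩ := hX.exists_norm_sub_le hE hE' hA
  have hu := hU.mem_unitary hX hE hE' hA
  refine .of_unitary hE (dyadicEvol_mem_unitary hX s t)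
    (mul_mem (hu t) (Unitary.star_mem (hu s))) fun x y => ?_
  have h := tendsto_map_dyadicEvol_mul hX hE hA hC0 hC hU hst x (star (U s) * y)
  have e : ∀ a : A, x * (a * U s) * (star (U s) * y) = x * a * y := fun a => by
    rw [show x * (a * U s) * (star (U s) * y) = x * a * (U s * star (U s)) * y by noncomm_ring,
      Unitary.mul_star_self_of_mem (hu s), mul_one]
  simp only [e] at h
  simpa only [mul_assoc] using h

end Limits

/-! ### The increments of the solution -/

section SolutionIncrements

open Filter Topology

variable {ι : D →⋆ₐ[ℂ] A} {E : A →ₗ[ℂ] D} {σ : D →CP D} {X U : ℝ≥0 → A}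

lemma inverse_eq_star_of_mem_unitary {u : A} (hu : u ∈ unitary A) : Ring.inverse u = star u := by
  have hunit : IsUnit u := ⟨Unitary.toUnits ⟨u, hu⟩, rfl⟩
  rw [← mul_one (Ring.inverse u), Ring.inverse_mul_eq_iff_eq_mul _ _ _ hunit,
    Unitary.mul_star_self_of_mem hu]

/-- Strong sequential limits of elements of a `*`-algebra form a `*`-algebra. -/
lemma exists_strongTendsto_of_mem_algOver (hE : IsConditionedMeasure ι E) {B : StarSubalgebra ℂ A}
    (hι : ∀ d, ι d ∈ B) {S : Set A}
    (hS : ∀ a ∈ S, ∃ u : ℕ → A, (∀ n, u n ∈ B) ∧ StrongTendsto E u a) {b : A}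
    (hb : b ∈ algOver ι S) : ∃ u : ℕ → A, (∀ n, u n ∈ B) ∧ StrongTendsto E u b := by
  induction hb using StarAlgebra.adjoin_induction with
  | mem x hx =>
    rcases hx with ⟨d, rfl⟩ | hx
    · exact ⟨fun _ => ι d, fun _ => hι d, .const _⟩
    · exact hS x hx
  | algebraMap r => exact ⟨_, fun _ => B.algebraMap_mem r, .const _⟩
  | add x y _ _ hx hy =>
    obtain ⟨u, hu, hux⟩ := hx
    obtain ⟨v, hv, hvy⟩ := hy
    exact ⟨_, fun n => add_mem (hu n) (hv n), hux.add hE hvy⟩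
  | mul x y _ _ hx hy =>
    obtain ⟨u, hu, hux⟩ := hx
    obtain ⟨v, hv, hvy⟩ := hy
    exact ⟨_, fun n => mul_mem (hu n) (hv n), hux.mul hE hvy⟩
  | star x _ hx =>
    obtain ⟨u, hu, hux⟩ := hx
    exact ⟨_, fun n => star_mem (hu n), hux.star⟩

/-- The increments of the solution after time `s` are free from the past of `s`. -/
theorem IsEvolution.isFreeOver_increments (hX : IsFreeBrownianMotion ι E σ X)
    (hE : IsConditionedMeasure ι E) (hE' : IsNondegenerate E)
    (hA : (algOver ι (Set.range X)).topologicalClosure = ⊤)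
    (hU : IsEvolution ι E σ X U) (s : ℝ≥0) :
    IsFreeOver E ![filtration ι X s,
      algOver ι {V | ∃ t, s ≤ t ∧ V = U t * Ring.inverse (U s)}] := by
  have hfree : IsFreeOver E ![pastAlg ι X s, futureAlg ι X s] :=
    hX.isFreeOver_incrClosure hE fun _ _ _ _ _ _ hP hQ => .inl (hP.trans hQ)
  refine hfree.of_weak_limits hE ?_ ?_
  · intro k d
    fin_cases k
    · exact coe_mem_incrClosure _ d
    · exact coe_mem_incrClosure _ d
  · intro k b hb
    fin_cases k
    · exact ⟨fun _ => b, fun _ => filtration_le_pastAlg hX.zero s hb, fun _ _ => tendsto_const_nhds⟩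
    · obtain ⟨u, hu, hub⟩ := exists_strongTendsto_of_mem_algOver hE
        (B := futureAlg ι X s) (coe_mem_incrClosure _) (by
          rintro _ ⟨t, hst, rfl⟩
          rw [inverse_eq_star_of_mem_unitary (hU.mem_unitary hX hE hE' hA s)]
          exact ⟨_, fun n => evol_mem_futureAlg _ _ _, strongTendsto_dyadicEvol hX hE hE' hA hU hst⟩)
        hb
      exact ⟨u, hu, hub.weakTendsto hE⟩

/-- The Brownian motion together with its shift, as a process in the product algebra. -/
def shiftPair (X : ℝ≥0 → A) (s r : ℝ≥0) : A × A := (X (s + r) - X s, X r)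

lemma isSelfAdjoint_shiftPair (hX : IsFreeBrownianMotion ι E σ X) (s r : ℝ≥0) :
    IsSelfAdjoint (shiftPair X s r) :=
  Prod.ext ((hX.isSelfAdjoint _).sub (hX.isSelfAdjoint _)) (hX.isSelfAdjoint _)

/-- Brownian motion has stationary increments. -/
lemma IsFreeBrownianMotion.map_fst_eq_map_snd (hX : IsFreeBrownianMotion ι E σ X)
    (hE : IsConditionedMeasure ι E) (s : ℝ≥0) {p : A × A}
    (hp : p ∈ (algOver (ι.prod ι) (Set.range (shiftPair X s))).topologicalClosure) :
    E p.1 = E p.2 := by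
  have hfst : ∀ w : List (ℝ≥0 × D),
      ((w.map fun x => shiftPair X s x.1 * ι.prod ι x.2).prod).1 =
        (w.map fun x => (X (s + x.1) - X s) * ι x.2).prod := fun w => by
    rw [← RingHom.coe_fst, map_list_prod, List.map_map]
    rfl
  have hsnd : ∀ w : List (ℝ≥0 × D),
      ((w.map fun x => shiftPair X s x.1 * ι.prod ι x.2).prod).2 =
        (w.map fun x => (X x.1 - X 0) * ι x.2).prod := fun w => by
    rw [← RingHom.coe_snd, map_list_prod, List.map_map]
    simp [Function.comp_def, shiftPair, hX.zero]
  -- Moments of increments depend only on their covariances, and these are invariant under time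
  -- shifts.
  have hcov : ∀ i j : ℝ≥0, incrCov (s + i) s (s + j) s = incrCov i 0 j 0 := fun i j => by
    simp [incrCov, min_add_add_left]
  have hword : ((algOver (ι.prod ι) (Set.range (shiftPair X s)) : StarSubalgebra ℂ (A × A)) :
      Set (A × A)) ⊆ {p | E p.1 = E p.2} := by
    refine (algOver_le_span_words (isSelfAdjoint_shiftPair hX s)).trans ?_
    have h : Submodule.span ℂ {a | ∃ (d : D) (w : List (ℝ≥0 × D)),
        a = ι.prod ι d * (w.map fun x => shiftPair X s x.1 * ι.prod ι x.2).prod} ≤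
        LinearMap.eqLocus (E ∘ₗ LinearMap.fst ℂ A A) (E ∘ₗ LinearMap.snd ℂ A A) := by
      refine Submodule.span_le.mpr ?_
      rintro _ ⟨d, w, rfl⟩
      change E (ι d * _) = E (ι d * _)
      rw [hE.map_mul_left, hE.map_mul_left, hfst, hsnd,
        hX.moment_increments (fun r => s + r) (fun _ => s),
        hX.moment_increments (fun r => r) (fun _ => 0)]
      simp only [hcov]
    exact h
  have hclosed : IsClosed {p : A × A | E p.1 = E p.2} :=
    isClosed_eq (hE.continuous.comp continuous_fst) (hE.continuous.comp continuous_snd)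
  rw [← SetLike.mem_coe, StarSubalgebra.topologicalClosure_coe] at hp
  exact closure_minimal hword hclosed hp

lemma expI_prod (a b : A) : expI ((a, b) : A × A) = (expI a, expI b) := by
  let +nondep : NormedAlgebra ℚ A := .restrictScalars ℚ ℂ A
  let +nondep : NormedAlgebra ℚ (A × A) := .restrictScalars ℚ ℂ (A × A)
  exact Prod.ext (NormedSpace.map_exp (RingHom.fst A A) continuous_fst _)
    (NormedSpace.map_exp (RingHom.snd A A) continuous_snd _)

/-- Exponentials and products in `A × A` are componentwise, and the offset `X s` cancels in
increments. The two products are thus one construction applied to the pair, and their joint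
membership in the closed algebra allows the comparison of laws. -/
lemma evol_shiftPair (s h : ℝ≥0) (k : ℕ) :
    evol (shiftPair X s) 0 h k = (evol X s h k, evol X 0 h k) := by
  induction k with
  | zero => rfl
  | succ k ih =>
    rw [evol, ih, evol, evol]
    simp only [shiftPair, Prod.mk_sub_mk, expI_prod, Prod.mk_mul_mk, zero_add, sub_sub_sub_cancel_right]

lemma StrongTendsto.word (hE : IsConditionedMeasure ι E) {u : ℕ → A} {a : A}
    (h : StrongTendsto E u a) (w : List (Bool × D)) :
    StrongTendsto E (fun n => (w.map fun p => (if p.1 then Star.star (u n) else u n) * ι p.2).prod)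
      (w.map fun p => (if p.1 then Star.star a else a) * ι p.2).prod := by
  induction w with
  | nil => exact .const _
  | cons p w ih =>
    simp only [List.map_cons, List.prod_cons]
    refine StrongTendsto.mul hE (StrongTendsto.mul hE ?_ (.const _)) ih
    rcases p with ⟨_ | _, d⟩
    · simpa using h
    · simpa using h.star

/-- The distribution of the increments of the solution is stationary. -/
theorem IsEvolution.sameDistribution_increments (hX : IsFreeBrownianMotion ι E σ X)
    (hE : IsConditionedMeasure ι E) (hE' : IsNondegenerate E)
    (hA : (algOver ι (Set.range X)).topologicalClosure = ⊤)
    (hU : IsEvolution ι E σ X U) {s t : ℝ≥0} (hst : s ≤ t) :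
    SameDistribution ι E (U t * Ring.inverse (U s)) (U (t - s)) := by
  intro w
  rw [inverse_eq_star_of_mem_unitary (hU.mem_unitary hX hE hE' hA s)]
  have h1 := ((strongTendsto_dyadicEvol hX hE hE' hA hU hst).word hE w).weakTendsto hE 1 1
  have h2 := ((strongTendsto_dyadicEvol hX hE hE' hA hU (zero_le (a := t - s))).word
    hE w).weakTendsto hE 1 1
  simp only [hU.init, star_one, mul_one, one_mul] at h1 h2
  refine tendsto_nhds_unique (h1.congr fun n => ?_) h2
  set B := (algOver (ι.prod ι) (Set.range (shiftPair X s))).topologicalClosure with hB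
  -- `evol_mem` is applied in the product algebra, over the diagonal embedding of `D`. It requires
  -- no probabilistic hypothesis on the process, so the pair is admissible.
  have hp : (dyadicEvol X s t n, dyadicEvol X 0 (t - s) n) ∈ B := by
    rw [dyadicEvol, dyadicEvol, tsub_zero, ← evol_shiftPair]
    refine StarSubalgebra.topologicalClosure_mono (algOver_le (coe_mem_algOver _) ?_)
      (evol_mem (ι := ι.prod ι) (X := shiftPair X s) 0 ((t - s) / 2 ^ n) (2 ^ n))
    rintro _ ⟨a, b, _, _, rfl⟩
    exact sub_mem (mem_algOver ⟨b, rfl⟩) (mem_algOver ⟨a, rfl⟩)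
  have hw : ∀ w : List (Bool × D), ((w.map fun p => (if p.1 then star (dyadicEvol X s t n) else dyadicEvol X s t n) *
        ι p.2).prod,
      (w.map fun p => (if p.1 then star (dyadicEvol X 0 (t - s) n)
        else dyadicEvol X 0 (t - s) n) * ι p.2).prod) ∈ B := by
    intro w
    induction w with
    | nil => exact one_mem B
    | cons p w ih =>
      simp only [List.map_cons, List.prod_cons]
      rw [← Prod.mk_mul_mk, ← Prod.mk_mul_mk]
      refine mul_mem (mul_mem ?_ (StarSubalgebra.le_topologicalClosure _
        (coe_mem_algOver (ι := ι.prod ι) _ p.2))) ih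
      · rcases p with ⟨_ | _, d⟩
        · exact hp
        · exact star_mem hp
  exact hX.map_fst_eq_map_snd hE s (hw w)

end SolutionIncrements

end CondFree

end

theorem mainTheorem2 {D A : Type*}
    [CStarAlgebra D] [PartialOrder D] [StarOrderedRing D] [CStarAlgebra A]
    (ι : D →⋆ₐ[ℂ] A) (E : A →ₗ[ℂ] D) (σ : D →CP D) (X U : ℝ≥0 → A)
    (hE : CondFree.IsConditionedMeasure ι E)
    (hE' : CondFree.IsNondegenerate E)
    (hX : CondFree.IsFreeBrownianMotion ι E σ X)
    (hA : (CondFree.algOver ι (Set.range X)).topologicalClosure = ⊤)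
    (hU : CondFree.IsEvolution ι E σ X U) :
    (∀ t, U t ∈ unitary A) ∧
    (∀ s, CondFree.IsFreeOver E
      ![CondFree.filtration ι X s,
        CondFree.algOver ι {V | ∃ t, s ≤ t ∧ V = U t * Ring.inverse (U s)}]) ∧
    (∀ s t, s ≤ t →
      CondFree.SameDistribution ι E (U t * Ring.inverse (U s)) (U (t - s))) :=
  ⟨hU.mem_unitary hX hE hE' hA, hU.isFreeOver_increments hX hE hE' hA,
    fun _ _ hst => hU.sameDistribution_increments hX hE hE' hA hst⟩
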